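/- Consider the following computational problem. Instance: a boolean decision tree $T$ over $N\ge 1$ boolean variables (inner nodes query a variable, leaves carry an output bit; $T$ computes $f_T:\{0,1\}^N\to\{0,1\}$), a vector $x\in\{0,1\}^N$, an index $i\in[N]$, and a Markovian distribution $P$ over $\{0,1\}^N$, $$P(X_1,\dots,X_N)=P_{init}(X_1)\prod_{j=1}^{N-1}P_j(X_{j+1}\mid X_j),$$ given by its parameters: a probability distribution $P_{init}$ on $\{0,1\}$ and $2\times 2$ stochastic matrices $P_1,\dots,P_{N-1}$, all of whose entries are positive rational numbers, written as fractions in binary. Output: the SHAP score $$\mathrm{SHAP}(T,x,i,P)=\sum_{S\subseteq[N]\setminus\{i\}}\frac{|S|!\,(N-|S|-1)!}{N!}\,\bigl[v(S\cup\{i\})-v(S)\bigr],\qquad v(S)=\mathbb E_{X\sim P}\bigl[f_T(X)\mid X_S=x_S\bigr],$$ as a fraction of integers written in binary (not necessarily reduced). Then this problem is in FP: there is a Turing machine which solves it exactly, in time polynomial in the length of the encoding of $(T,x,i,P)$. The same holds for the variant of the score $$\sum_{S\subsetneq[N]}\frac{|S|!\,(N-|S|-1)!}{N!}\,\bigl[v(S)-v(S\setminus\{i\})\bigr].$$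 -/

import Mathlib

namespace MarkovShap

open Computability

/-! ### Decision trees over boolean variables -/

/-- A decision tree over the boolean variables `X 0, …, X (N - 1)`: a leaf carries the output,
an inner node queries a variable, goes to `lo` on the answer `false` and to `hi` on `true`. -/
inductive DecisionTree (N : ℕ) : Type
  | leaf (b : Bool) : DecisionTree N
  | node (v : Fin N) (lo hi : DecisionTree N) : DecisionTree N

/-- The boolean function computed by a decision tree. -/
def DecisionTree.eval {N : ℕ} : DecisionTree N → (Fin N → Bool) → Bool
  | .leaf b, _ => b
  | .node v lo hi, X => if X v then hi.eval X else lo.eval X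

/-- The same function with values in `{0, 1} ⊆ ℚ`. -/
def DecisionTree.toFun {N : ℕ} (T : DecisionTree N) (X : Fin N → Bool) : ℚ :=
  if T.eval X then 1 else 0

/-! ### Markovian distributions over boolean vectors -/

/-- A presentation of a rational number as a fraction `num / den`, not necessarily reduced. -/
structure Fraction : Type where
  num : ℤ
  den : ℕ
  den_pos : 0 < den

/-- The rational number presented by a fraction. -/
def Fraction.val (q : Fraction) : ℚ := (q.num : ℚ) / (q.den : ℚ)

/-- The parameters of a Markovian distribution over boolean vectors of dimension `n + 1`: the
initial distribution and the `n` transition matrices (`trans k a b` is the probability that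
coordinate `k + 1` is `b`, given that coordinate `k` is `a`).  All entries are positive. -/
structure MarkovChain (n : ℕ) : Type where
  init : Bool → Fraction
  trans : Fin n → Bool → Bool → Fraction
  init_pos : ∀ a, 0 < (init a).val
  init_sum : ∑ a, (init a).val = 1
  trans_pos : ∀ k a b, 0 < (trans k a b).val
  trans_sum : ∀ k a, ∑ b, (trans k a b).val = 1

/-- The probability of the vector `X`. -/
def MarkovChain.prob {n : ℕ} (P : MarkovChain n) (X : Fin (n + 1) → Bool) : ℚ :=
  (P.init (X 0)).val * ∏ k : Fin n, (P.trans k (X k.castSucc) (X k.succ)).val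

/-! ### The SHAP score -/

/-- The value function `v(S) = 𝔼[f(X) | X_S = x_S]`, where `X` has probability mass function `P`. -/
def value {N : ℕ} (f : (Fin N → Bool) → ℚ) (x : Fin N → Bool) (P : (Fin N → Bool) → ℚ)
    (S : Finset (Fin N)) : ℚ :=
  (∑ X : Fin N → Bool with ∀ j ∈ S, X j = x j, P X * f X) /
    ∑ X : Fin N → Bool with ∀ j ∈ S, X j = x j, P X

/-- The SHAP score of feature `i`: the Shapley value of player `i` in the game `value f x P`. -/
def shap {N : ℕ} (f : (Fin N → Bool) → ℚ) (x : Fin N → Bool) (i : Fin N)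
    (P : (Fin N → Bool) → ℚ) : ℚ :=
  ∑ S : Finset (Fin N) with i ∉ S,
    ((S.card.factorial * (N - S.card - 1).factorial : ℕ) : ℚ) / (N.factorial : ℚ) *
      (value f x P (insert i S) - value f x P S)

/-- The variant of the SHAP score in which the weight `|S|! (N - |S| - 1)! / N!` multiplies the
difference `v(S) - v(S \ {i})`.  The sum runs over the coalitions for which the weight makes sense,
that is, those different from the set of all features. -/
def shapAlt {N : ℕ} (f : (Fin N → Bool) → ℚ) (x : Fin N → Bool) (i : Fin N)
    (P : (Fin N → Bool) → ℚ) : ℚ :=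
  ∑ S : Finset (Fin N) with S ≠ Finset.univ,
    ((S.card.factorial * (N - S.card - 1).factorial : ℕ) : ℚ) / (N.factorial : ℚ) *
      (value f x P S - value f x P (S.erase i))

/-! ### The computational problem -/

/-- An instance of the problem, with `N = n + 1` boolean variables: a decision tree, a vector to
explain, a feature and a Markovian distribution. -/
structure Instance : Type where
  n : ℕ
  tree : DecisionTree (n + 1)
  x : Fin (n + 1) → Bool
  i : Fin (n + 1)
  P : MarkovChain n

/-- The SHAP score to be computed. -/
def Instance.shap (a : Instance) : ℚ := MarkovShap.shap a.tree.toFun a.x a.i a.P.prob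

/-- The variant `shapAlt` of the score. -/
def Instance.shapAlt (a : Instance) : ℚ := MarkovShap.shapAlt a.tree.toFun a.x a.i a.P.prob

/-! ### Encodings over a finite alphabet

Indices of variables are written in unary; they are smaller than the number of variables, which is
the number of bits of the vector to explain.  All other numbers are written in binary. -/

/-- A natural number in binary, least significant bit first, ended by a comma. -/
def encodeBin (m : ℕ) : List Γ' := (encodeNat m).map Γ'.bit ++ [Γ'.comma]

/-- A natural number in unary, ended by a comma. -/
def encodeUnary (m : ℕ) : List Γ' := (unaryEncodeNat m).map Γ'.bit ++ [Γ'.comma]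

/-- A boolean vector, ended by a comma. -/
def encodeVector {N : ℕ} (x : Fin N → Bool) : List Γ' :=
  (List.ofFn x).map Γ'.bit ++ [Γ'.comma]

/-- A fraction: sign bit (`true` for negative), absolute value of the numerator, denominator. -/
def Fraction.encode (q : Fraction) : List Γ' :=
  Γ'.bit (decide (q.num < 0)) :: (encodeBin q.num.natAbs ++ encodeBin q.den)

/-- A decision tree in prefix notation. -/
def DecisionTree.encode {N : ℕ} : DecisionTree N → List Γ'
  | .leaf b => [Γ'.bit b]
  | .node v lo hi => Γ'.bra :: (encodeUnary v ++ (lo.encode ++ hi.encode))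

/-- A `2 × 2` matrix of fractions, row by row. -/
def encodeMatrix (M : Bool → Bool → Fraction) : List Γ' :=
  (M false false).encode ++ ((M false true).encode ++
    ((M true false).encode ++ (M true true).encode))

/-- The parameters of a Markovian distribution. -/
def MarkovChain.encode {n : ℕ} (P : MarkovChain n) : List Γ' :=
  (P.init false).encode ++ ((P.init true).encode ++
    (List.ofFn fun k => encodeMatrix (P.trans k)).flatten)

/-- An instance: the vector to explain, the feature, the distribution and the decision tree. -/
def Instance.encode (a : Instance) : List Γ' :=
  encodeVector a.x ++ (encodeUnary a.i ++ (a.P.encode ++ a.tree.encode))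

/-! ### Polynomial time -/

/-- A function from `α` to `ℚ` is in FP, with respect to an encoding of `α` over a finite alphabet,
if some Turing machine that stops after a number of steps bounded by a polynomial in the length of
the input maps the encoding of each `a` to the encoding of a fraction that presents `F a`. -/
def InFP {α αΓ : Type} (enc : α → List αΓ) (F : α → ℚ) : Prop :=
  ∃ f : α → Fraction, (∀ a, (f a).val = F a) ∧
    Nonempty (Turing.TM2ComputableInPolyTime enc Fraction.encode f)

/-! ### The encoding of instances is faithful -/

theorem bits_comma_cancel : ∀ {l m : List Bool} {r s : List Γ'},
    l.map Γ'.bit ++ [Γ'.comma] ++ r = m.map Γ'.bit ++ [Γ'.comma] ++ s → l = m ∧ r = s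
  | [], [], r, s, h => by simpa using h
  | [], _ :: _, r, s, h => by simp at h
  | _ :: _, [], r, s, h => by simp at h
  | a :: l, b :: m, r, s, h => by
    simp only [List.map_cons, List.cons_append, List.cons.injEq, Γ'.bit.injEq] at h
    obtain ⟨h1, h2⟩ := bits_comma_cancel h.2
    exact ⟨by rw [h.1, h1], h2⟩

theorem encodeBin_cancel {l m : ℕ} {r s : List Γ'}
    (h : encodeBin l ++ r = encodeBin m ++ s) : l = m ∧ r = s := by
  obtain ⟨h1, h2⟩ := bits_comma_cancel h
  exact ⟨by simpa using congrArg decodeNat h1, h2⟩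

theorem encodeUnary_cancel {l m : ℕ} {r s : List Γ'}
    (h : encodeUnary l ++ r = encodeUnary m ++ s) : l = m ∧ r = s := by
  obtain ⟨h1, h2⟩ := bits_comma_cancel h
  exact ⟨by simpa using congrArg unaryDecodeNat h1, h2⟩

theorem Fraction.encode_cancel {p q : Fraction} {r s : List Γ'}
    (h : p.encode ++ r = q.encode ++ s) : p = q ∧ r = s := by
  obtain ⟨a, b, hb⟩ := p
  obtain ⟨c, d, hd⟩ := q
  simp only [Fraction.encode, List.cons_append, List.append_assoc, List.cons.injEq,
    Γ'.bit.injEq, decide_eq_decide] at h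
  obtain ⟨h0, h⟩ := h
  obtain ⟨h1, h⟩ := encodeBin_cancel h
  obtain ⟨h2, h3⟩ := encodeBin_cancel h
  have h4 : a = c := by omega
  subst h4 h2
  exact ⟨rfl, h3⟩

theorem DecisionTree.encode_cancel {N : ℕ} : ∀ {T U : DecisionTree N} {r s : List Γ'},
    T.encode ++ r = U.encode ++ s → T = U ∧ r = s
  | .leaf _, .leaf _, _, _, h => by simpa [DecisionTree.encode] using h
  | .leaf _, .node _ _ _, _, _, h => by simp [DecisionTree.encode] at h
  | .node _ _ _, .leaf _, _, _, h => by simp [DecisionTree.encode] at h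
  | .node v lo hi, .node w lo' hi', _, _, h => by
    simp only [DecisionTree.encode, List.cons_append, List.append_assoc, List.cons.injEq,
      true_and] at h
    obtain ⟨h1, h⟩ := encodeUnary_cancel h
    obtain ⟨h2, h⟩ := DecisionTree.encode_cancel h
    obtain ⟨h3, h⟩ := DecisionTree.encode_cancel h
    exact ⟨by rw [Fin.ext h1, h2, h3], h⟩

theorem encodeMatrix_cancel {M M' : Bool → Bool → Fraction} {r s : List Γ'}
    (h : encodeMatrix M ++ r = encodeMatrix M' ++ s) : M = M' ∧ r = s := by
  simp only [encodeMatrix, List.append_assoc] at h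
  obtain ⟨h1, h⟩ := Fraction.encode_cancel h
  obtain ⟨h2, h⟩ := Fraction.encode_cancel h
  obtain ⟨h3, h⟩ := Fraction.encode_cancel h
  obtain ⟨h4, h⟩ := Fraction.encode_cancel h
  refine ⟨?_, h⟩
  funext a b
  cases a <;> cases b <;> assumption

theorem encodeMatrices_cancel : ∀ {n : ℕ} {M M' : Fin n → Bool → Bool → Fraction} {r s : List Γ'},
    (List.ofFn fun k => encodeMatrix (M k)).flatten ++ r =
      (List.ofFn fun k => encodeMatrix (M' k)).flatten ++ s → M = M' ∧ r = s
  | 0, _, _, _, _, h => ⟨funext fun k => k.elim0, by simpa using h⟩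
  | n + 1, M, M', _, _, h => by
    simp only [List.ofFn_succ, List.flatten_cons, List.append_assoc] at h
    obtain ⟨h1, h⟩ := encodeMatrix_cancel h
    obtain ⟨h2, h⟩ := encodeMatrices_cancel h
    refine ⟨?_, h⟩
    funext k
    refine Fin.cases h1 (fun j => congrFun h2 j) k

theorem MarkovChain.encode_cancel {n : ℕ} {P Q : MarkovChain n} {r s : List Γ'}
    (h : P.encode ++ r = Q.encode ++ s) : P = Q ∧ r = s := by
  obtain ⟨i, t, _, _, _, _⟩ := P
  obtain ⟨i', t', _, _, _, _⟩ := Q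
  simp only [MarkovChain.encode, List.append_assoc] at h
  obtain ⟨h1, h⟩ := Fraction.encode_cancel h
  obtain ⟨h2, h⟩ := Fraction.encode_cancel h
  obtain ⟨h3, h4⟩ := encodeMatrices_cancel h
  have h5 : i = i' := by funext a; cases a <;> assumption
  subst h5 h3
  exact ⟨rfl, h4⟩

/-- Distinct instances have distinct encodings. -/
theorem Instance.encode_injective : Function.Injective Instance.encode := by
  rintro ⟨n, T, x, i, P⟩ ⟨n', T', x', i', P'⟩ h
  simp only [Instance.encode] at h
  obtain ⟨h1, h⟩ := bits_comma_cancel h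
  have hn : n = n' := by simpa using congrArg List.length h1
  subst hn
  obtain ⟨h2, h⟩ := encodeUnary_cancel h
  obtain ⟨h3, h⟩ := MarkovChain.encode_cancel h
  have h4 : T = T' := (DecisionTree.encode_cancel (r := []) (s := []) (by simpa using h)).1
  rw [List.ofFn_injective h1, Fin.ext h2, h3, h4]

end MarkovShap

/-! ### Compiling structured stack programs into Turing machines. -/

namespace MarkovShap

open Computability

/-! ### Structured stack programs -/

/-! The score is linear in the function, and a decision tree is the sum, over its leaves with output
`true`, of products of one-variable indicators (`DecisionTree.sum_cubes`). So it suffices to handle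
`f = ∏ g_j(X_j)`, once for each such leaf.

For a product, the Markov property makes `v(S)` factor. At a member of `S` the chain is pinned to
`x`, so numerator and denominator of the conditional expectation both split into matrix products
over the gaps between consecutive members. A sum over all coalitions, with weights depending only on
their size, therefore obeys a recursion along the chain. Once a member has been passed, the rest
depends only on the position of that member and on the number of free members so far, which leaves
polynomially many values. This recursion is `pathSum`; `pathSum_ofFn` identifies it with the sum
over coalitions. The score is the difference of two such sums, with `i` forced into and out of the
coalitions (`weightedSum_value_prod`, `weightedSum_tree`). The variant of the score only has other
weights (`shapAlt_eq_weightedSum`).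

The computation has to be exact with numbers of polynomial length. A nonzero factor of a transition
matrix cancels in all quotients (`pathSum_scale`), so the matrices may be taken with natural number
entries. The table of every position is stored as numerators over one common denominator. Adding a
position in front multiplies that denominator, and all old tables, by the product of the
denominators met in one scan (`scan_spec`, `dp_spec`); positivity of the entries keeps it nonzero.
Each position thus adds polynomially many digits (`dp_sizeLE`). Without the common denominator, each
table would be built from products of the denominators of all later ones, and the length could
double at every position.

For the machine, a small language of loops over four stacks is compiled to a `TM2` machine that
takes the same number of steps, up to the final halt (`Run.stepsTo`, `Prog.computable`). All data
are coded as binary trees on one stack, and `PTime` is the class of functions computed there in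
polynomial time. It is closed under composition, pairing and case distinction, and under folds whose
intermediate results have polynomial size (`PTime.foldl_of_le`). Such a size bound is the only real
obligation when an algorithm is shown to be in the class; most other goals are left to `fun_prop`.
`PTime.computable` returns from trees to words, `readInstance_encode` shows that the parser is
correct, and `score_data` that the computed fraction is the score. -/

/-- The stacks of the machine: data, reversal buffer, saved values and control. -/
inductive Stk : Type
  | D | A | B | C
  deriving DecidableEq

instance : Fintype Stk := ⟨{.D, .A, .B, .C}, fun k => by cases k <;> decide⟩

/-- Contents of the four stacks. -/
def stk (d a b c : List Γ') : Stk → List Γ'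
  | .D => d
  | .A => a
  | .B => b
  | .C => c

section
variable (d a b c l : List Γ')

@[simp] theorem stk_D : stk d a b c .D = d := rfl
@[simp] theorem stk_A : stk d a b c .A = a := rfl
@[simp] theorem stk_B : stk d a b c .B = b := rfl
@[simp] theorem stk_C : stk d a b c .C = c := rfl

@[simp] theorem update_stk_D : Function.update (stk d a b c) .D l = stk l a b c := by
  funext k; cases k <;> rfl

@[simp] theorem update_stk_A : Function.update (stk d a b c) .A l = stk d l b c := by
  funext k; cases k <;> rfl

@[simp] theorem update_stk_B : Function.update (stk d a b c) .B l = stk d a l c := by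
  funext k; cases k <;> rfl

@[simp] theorem update_stk_C : Function.update (stk d a b c) .C l = stk d a b l := by
  funext k; cases k <;> rfl

end

/-- Structured programs over the stacks. `loop k c p` pops a symbol `o` from stack `k`
(`none` if the stack is empty), runs `p o`, and repeats if `c o` holds. -/
inductive Prog : Type
  | skip : Prog
  | push (k : Stk) (a : Γ') : Prog
  | seq (p q : Prog) : Prog
  | loop (k : Stk) (c : Option Γ' → Bool) (p : Option Γ' → Prog) : Prog

/-- `Run p S t S'`: program `p` transforms the stacks `S` to `S'` in `t` steps. -/
inductive Run : Prog → (Stk → List Γ') → ℕ → (Stk → List Γ') → Prop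
  | skip {S} : Run .skip S 1 S
  | push {k a S} : Run (.push k a) S 1 (Function.update S k (a :: S k))
  | seq {p q S S' S'' t t'} : Run p S t S' → Run q S' t' S'' → Run (.seq p q) S (t + t') S''
  | halt {k c p S S' t} : c (S k).head? = false →
      Run (p (S k).head?) (Function.update S k (S k).tail) t S' → Run (.loop k c p) S (1 + t) S'
  | step {k c p S S' S'' t t'} : c (S k).head? = true →
      Run (p (S k).head?) (Function.update S k (S k).tail) t S' →
      Run (.loop k c p) S' t' S'' → Run (.loop k c p) S (1 + t + t') S''

/-- Labels of the machine that executes a program. -/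
def Prog.Lab : Prog → Type
  | .skip => Unit
  | .push _ _ => Unit
  | .seq p q => p.Lab ⊕ q.Lab
  | .loop _ _ p => Option (Σ o, (p o).Lab)

/-- A program has finitely many labels. -/
@[reducible] noncomputable def Prog.fintypeLab : (p : Prog) → Fintype p.Lab
  | .skip => inferInstanceAs (Fintype Unit)
  | .push _ _ => inferInstanceAs (Fintype Unit)
  | .seq p q =>
    have := p.fintypeLab
    have := q.fintypeLab
    inferInstanceAs (Fintype (p.Lab ⊕ q.Lab))
  | .loop _ _ p =>
    have := fun o => (p o).fintypeLab
    inferInstanceAs (Fintype (Option (Σ o, (p o).Lab)))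

/-- The label at which the execution of a program starts. -/
def Prog.entry : (p : Prog) → p.Lab
  | .skip => ()
  | .push _ _ => ()
  | .seq p _ => .inl p.entry
  | .loop _ _ _ => none

/-- The statement at a label of a program that is embedded by `ι` and continues at `x`. -/
def Prog.stmt {Λ : Type} : (p : Prog) → (p.Lab → Λ) → Λ → p.Lab →
    Turing.TM2.Stmt (fun _ : Stk => Γ') Λ (Option Γ')
  | .skip, _, x, _ => .goto fun _ => x
  | .push k a, _, x, _ => .push k (fun _ => a) (.goto fun _ => x)
  | .seq p q, ι, _, .inl l => p.stmt (fun l => ι (.inl l)) (ι (.inr q.entry)) l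
  | .seq _ q, ι, x, .inr l => q.stmt (fun l => ι (.inr l)) x l
  | .loop k _ p, ι, _, none => .pop k (fun _ o => o) (.goto fun o => ι (some ⟨o, (p o).entry⟩))
  | .loop _ c p, ι, x, some ⟨o, l⟩ =>
    (p o).stmt (fun l => ι (some ⟨o, l⟩)) (if c o then ι none else x) l

/-- In `t` steps, the machine `M` goes from `C` to `C'`. -/
def StepsTo {Λ : Type} (M : Λ → Turing.TM2.Stmt (fun _ : Stk => Γ') Λ (Option Γ')) (t : ℕ)
    (C C' : Turing.TM2.Cfg (fun _ : Stk => Γ') Λ (Option Γ')) : Prop :=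
  (flip bind (Turing.TM2.step M))^[t] (some C) = some C'

theorem StepsTo.trans {Λ : Type} {M : Λ → Turing.TM2.Stmt (fun _ : Stk => Γ') Λ (Option Γ')}
    {t t' : ℕ} {C C' C'' : Turing.TM2.Cfg (fun _ : Stk => Γ') Λ (Option Γ')}
    (h : StepsTo M t C C') (h' : StepsTo M t' C' C'') : StepsTo M (t + t') C C'' := by
  unfold StepsTo at *
  rw [Nat.add_comm, Function.iterate_add_apply, h, h']

theorem StepsTo.single {Λ : Type} {M : Λ → Turing.TM2.Stmt (fun _ : Stk => Γ') Λ (Option Γ')}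
    {l : Λ} {v : Option Γ'} {S : Stk → List Γ'} :
    StepsTo M 1 ⟨some l, v, S⟩ (Turing.TM2.stepAux (M l) v S) := rfl

/-- A machine that contains the code of a program simulates its runs. -/
theorem Run.stepsTo {Λ : Type} {M : Λ → Turing.TM2.Stmt (fun _ : Stk => Γ') Λ (Option Γ')}
    {p : Prog} {S S' : Stk → List Γ'} {t : ℕ} (h : Run p S t S') (ι : p.Lab → Λ) (x : Λ)
    (hM : ∀ l, M (ι l) = p.stmt ι x l) (v : Option Γ') :
    ∃ v', StepsTo M t ⟨some (ι p.entry), v, S⟩ ⟨some x, v', S'⟩ := by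
  induction h generalizing x v with
  | skip =>
    have h0 := StepsTo.single (M := M) (l := ι ()) (v := v) (S := ‹_›)
    rw [show M (ι ()) = _ from hM ()] at h0
    exact ⟨v, h0⟩
  | push =>
    have h0 := StepsTo.single (M := M) (l := ι ()) (v := v) (S := ‹_›)
    rw [show M (ι ()) = _ from hM ()] at h0
    exact ⟨v, h0⟩
  | seq _ _ ih ih' =>
    rename_i p q _ _ _ _ _ _ _
    obtain ⟨v', h⟩ := ih (fun l => ι (.inl l)) _ (fun l => hM (.inl l)) v
    obtain ⟨v'', h'⟩ := ih' (fun l => ι (.inr l)) _ (fun l => hM (.inr l)) v'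
    exact ⟨v'', h.trans h'⟩
  | halt hc _ ih =>
    rename_i k c p S _ _ _
    have h0 := StepsTo.single (M := M) (l := ι none) (v := v) (S := S)
    rw [show M (ι none) = _ from hM none] at h0
    obtain ⟨v', h⟩ := ih (fun l => ι (some ⟨_, l⟩)) x
      (fun l => (hM (some ⟨_, l⟩)).trans (by simp [Prog.stmt, hc])) (S k).head?
    exact ⟨v', h0.trans h⟩
  | step hc _ _ ih ih' =>
    rename_i k c p S _ _ _ _ _ _
    have h0 := StepsTo.single (M := M) (l := ι none) (v := v) (S := S)
    rw [show M (ι none) = _ from hM none] at h0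
    -- As the test succeeds, the continuation of the body is the loop head `ι none`; in the case
    -- `halt` it is the exit `x`.
    obtain ⟨v', h⟩ := ih (fun l => ι (some ⟨_, l⟩)) (ι none)
      (fun l => (hM (some ⟨_, l⟩)).trans (by simp [Prog.stmt, hc])) (S k).head?
    obtain ⟨v'', h'⟩ := ih' ι x hM v'
    exact ⟨v'', (h0.trans h).trans h'⟩

/-- The Turing machine that executes a program, with input and output on stack `B`. -/
noncomputable def Prog.machine (p : Prog) : Turing.FinTM2 where
  K := Stk
  k₀ := .B
  k₁ := .B
  Γ _ := Γ'
  Λ := Option p.Lab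
  main := some p.entry
  ΛFin := have := p.fintypeLab; inferInstanceAs (Fintype (Option p.Lab))
  σ := Option Γ'
  initialState := none
  Γk₀Fin := inferInstanceAs (Fintype Γ')
  m
    -- A halting configuration must carry the initial internal state, so the register with the last
    -- popped symbol is cleared first.
    | none => .load (fun _ => none) .halt
    | some l => p.stmt some none l

theorem initList_machine (p : Prog) (l : List Γ') :
    Turing.initList p.machine l = ⟨some (some p.entry), none, stk [] [] l []⟩ := by
  unfold Turing.initList
  congr 1
  funext k
  cases k <;> rfl

theorem haltList_machine (p : Prog) (l : List Γ') :
    Turing.haltList p.machine l = ⟨none, none, stk [] [] l []⟩ := by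
  unfold Turing.haltList
  congr 1
  funext k
  cases k <;> rfl

/-- A program with polynomially bounded runs yields a polynomial time Turing machine. -/
theorem Prog.computable {α β : Type} {ea : α → List Γ'} {eb : β → List Γ'} {f : α → β} (p : Prog)
    (q : Polynomial ℕ)
    (h : ∀ a, ∃ t ≤ q.eval (ea a).length, Run p (stk [] [] (ea a) []) t (stk [] [] (eb (f a)) [])) :
    Nonempty (Turing.TM2ComputableInPolyTime ea eb f) := by
  have h' : ∀ a, ∃ t ≤ q.eval (ea a).length, (flip bind p.machine.step)^[t + 1]
      (some (Turing.initList p.machine (ea a))) = some (Turing.haltList p.machine (eb (f a))) := by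
    intro a
    obtain ⟨t, ht, hr⟩ := h a
    obtain ⟨v, hv⟩ := hr.stepsTo (M := p.machine.m) some none (fun _ => rfl) none
    refine ⟨t, ht, ?_⟩
    rw [initList_machine, haltList_machine]
    exact hv.trans (StepsTo.single (M := p.machine.m))
  exact ⟨{
    tm := p.machine
    inputAlphabet := Equiv.refl _
    outputAlphabet := Equiv.refl _
    time := q + 1
    outputsFun := fun a =>
      { steps := (h' a).choose + 1
        evals_in_steps := by
          have := (h' a).choose_spec.2
          simp only [Equiv.invFun_as_coe, Equiv.refl_symm, Equiv.coe_refl, Option.map_some]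
          erw [List.map_id, List.map_id]
          exact this
        steps_le_m := by
          have := (h' a).choose_spec.1
          simpa using this } }⟩

end MarkovShap

/-! ### An instruction set for binary trees, with explicit time bounds. -/

namespace MarkovShap

open Computability

/-! ### Runs with time bounds -/

/-- Program `p` transforms the stacks `S` to `S'` in at most `T` steps. -/
def Runs (p : Prog) (S : Stk → List Γ') (T : ℕ) (S' : Stk → List Γ') : Prop :=
  ∃ t ≤ T, Run p S t S'

theorem Runs.mono {p : Prog} {S S' : Stk → List Γ'} {T T' : ℕ} (h : Runs p S T S')
    (hT : T ≤ T') : Runs p S T' S' :=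
  let ⟨t, ht, hr⟩ := h
  ⟨t, ht.trans hT, hr⟩

theorem Runs.skip {S : Stk → List Γ'} : Runs .skip S 1 S := ⟨1, le_rfl, .skip⟩

theorem Runs.push {k : Stk} {x : Γ'} {S S' : Stk → List Γ'}
    (h : Function.update S k (x :: S k) = S') : Runs (.push k x) S 1 S' := by
  subst h
  exact ⟨1, le_rfl, .push⟩

theorem Runs.seq {p q : Prog} {S S' S'' : Stk → List Γ'} {T T' : ℕ} (h : Runs p S T S')
    (h' : Runs q S' T' S'') : Runs (.seq p q) S (T + T') S'' :=
  let ⟨t, ht, hr⟩ := h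
  let ⟨t', ht', hr'⟩ := h'
  ⟨t + t', by omega, .seq hr hr'⟩

theorem Runs.halt {k : Stk} {c : Option Γ' → Bool} {p : Option Γ' → Prog} {S S₁ S' : Stk → List Γ'}
    {T : ℕ} {o : Option Γ'} (ho : (S k).head? = o) (hS : Function.update S k (S k).tail = S₁)
    (hc : c o = false) (h : Runs (p o) S₁ T S') : Runs (.loop k c p) S (T + 1) S' := by
  subst ho hS
  obtain ⟨t, ht, hr⟩ := h
  exact ⟨1 + t, by omega, .halt hc hr⟩

theorem Runs.step {k : Stk} {c : Option Γ' → Bool} {p : Option Γ' → Prog}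
    {S S₁ S' S'' : Stk → List Γ'} {T T' : ℕ} {o : Option Γ'} (ho : (S k).head? = o)
    (hS : Function.update S k (S k).tail = S₁) (hc : c o = true) (h : Runs (p o) S₁ T S')
    (h' : Runs (.loop k c p) S' T' S'') : Runs (.loop k c p) S (T + T' + 1) S'' := by
  subst ho hS
  obtain ⟨t, ht, hr⟩ := h
  obtain ⟨t', ht', hr'⟩ := h'
  exact ⟨1 + t + t', by omega, .step hc hr hr'⟩

section
variable {x : Γ'} {d a b c : List Γ'} {T T' : ℕ} {S S' : Stk → List Γ'} {p : Option Γ' → Prog}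
  {f : Option Γ' → Bool}

theorem Runs.pushD : Runs (.push .D x) (stk d a b c) 1 (stk (x :: d) a b c) :=
  Runs.push (update_stk_D ..)

theorem Runs.pushA : Runs (.push .A x) (stk d a b c) 1 (stk d (x :: a) b c) :=
  Runs.push (update_stk_A ..)

theorem Runs.pushB : Runs (.push .B x) (stk d a b c) 1 (stk d a (x :: b) c) :=
  Runs.push (update_stk_B ..)

theorem Runs.pushC : Runs (.push .C x) (stk d a b c) 1 (stk d a b (x :: c)) :=
  Runs.push (update_stk_C ..)

theorem Runs.popD (h : Runs (p (some x)) (stk d a b c) T S) :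
    Runs (.loop .D (fun _ => false) p) (stk (x :: d) a b c) (T + 1) S :=
  Runs.halt (o := some x) rfl (update_stk_D ..) rfl h

theorem Runs.stopC (hf : f (some x) = false) (h : Runs (p (some x)) (stk d a b c) T S) :
    Runs (.loop .C f p) (stk d a b (x :: c)) (T + 1) S :=
  Runs.halt (o := some x) rfl (update_stk_C ..) hf h

theorem Runs.stepC (hf : f (some x) = true) (h : Runs (p (some x)) (stk d a b c) T S)
    (h' : Runs (.loop .C f p) S T' S') :
    Runs (.loop .C f p) (stk d a b (x :: c)) (T + T' + 1) S' :=
  Runs.step (o := some x) rfl (update_stk_C ..) hf h h'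

end

/-- The number of symbols on all stacks. -/
def stkSize (S : Stk → List Γ') : ℕ :=
  (S .D).length + (S .A).length + (S .B).length + (S .C).length

theorem stkSize_tail_le (S : Stk → List Γ') (k : Stk) :
    stkSize (Function.update S k (S k).tail) ≤ stkSize S := by
  cases k <;> simp [stkSize]

/-- A step pushes at most one symbol. Hence a time bound is also a bound on the size of the output,
which is what makes polynomial time closed under composition. -/
theorem Run.stkSize_le {p : Prog} {S S' : Stk → List Γ'} {t : ℕ} (h : Run p S t S') :
    stkSize S' ≤ stkSize S + t := by
  induction h with
  | skip => omega
  | push => rename_i k a S; cases k <;> simp [stkSize] <;> omega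
  | seq => omega
  | @halt k _ _ S _ _ _ _ ih => have := stkSize_tail_le S k; omega
  | @step k _ _ S _ _ _ _ _ _ _ ih ih' => have := stkSize_tail_le S k; omega

/-! ### Trees on the data stack -/

/-- Binary trees: the universal data type. -/
inductive Tr : Type
  | nil : Tr
  | cons (a b : Tr) : Tr

/-- A tree in prefix notation. -/
def Tr.toks : Tr → List Γ'
  | .nil => [.bit false]
  | .cons a b => .bit true :: (a.toks ++ b.toks)

/-- The size of a tree. -/
def Tr.size (t : Tr) : ℕ := t.toks.length

@[simp] theorem Tr.size_nil : Tr.nil.size = 1 := rfl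

@[simp] theorem Tr.size_cons (a b : Tr) : (Tr.cons a b).size = a.size + b.size + 1 := by
  simp [Tr.size, Tr.toks]

theorem Tr.size_pos (t : Tr) : 0 < t.size := by cases t <;> simp

theorem Tr.bit_of_mem_toks {t : Tr} {x : Γ'} (h : x ∈ t.toks) : ∃ b, x = .bit b := by
  induction t with
  | nil => exact ⟨false, by simpa [Tr.toks] using h⟩
  | cons a b iha ihb =>
    simp only [Tr.toks, List.mem_cons, List.mem_append] at h
    rcases h with h | h | h
    exacts [⟨_, h⟩, iha h, ihb h]

/-- Pop a symbol and continue depending on it. -/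
abbrev Prog.pop (k : Stk) (p : Option Γ' → Prog) : Prog := .loop k (fun _ => false) p

/-- Pop symbols up to a comma and process them. -/
abbrev Prog.flush (k : Stk) (p : Γ' → Prog) : Prog :=
  .loop k (fun o => o != some .comma && o != none) fun
    | none => .skip
    | some x => if x = .comma then .skip else p x

/-- The body of the loop that moves a tree to stack `A`. -/
def Prog.moveBody : Option Γ' → Prog
  | some .blank => .pop .D fun
    | some (.bit true) => .seq (.push .A (.bit true)) (.seq (.push .C .blank) (.push .C .blank))
    | _ => .push .A (.bit false)
  | _ => .skip

/-- Move as many trees as there are blanks on `C` from `D` to `A`. -/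
abbrev Prog.moveLoop : Prog := .loop .C (fun o => o == some .blank) Prog.moveBody

/-- Move a tree from `D` to `A`, reversing it and putting a comma below. -/
def Prog.move : Prog :=
  .seq (.push .A .comma) (.seq (.push .C .comma) (.seq (.push .C .blank) .moveLoop))

/-- Every blank on `C` stands for a subtree that is still to be read: the token `true` replaces one
blank by two, the token `false` consumes one. The rest of the loop enters as the hypothesis `h`, so
that the induction hypotheses for the two subtrees can be chained. -/
theorem Runs.moveLoop (t : Tr) {d a b c : List Γ'} {T : ℕ} {S : Stk → List Γ'}
    (h : Runs .moveLoop (stk d (t.toks.reverse ++ a) b c) T S) :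
    Runs .moveLoop (stk (t.toks ++ d) a b (.blank :: c)) (T + 5 * t.size) S := by
  induction t generalizing d a c T with
  | nil => exact (Runs.stepC rfl (Runs.popD Runs.pushA) h).mono (by simp; omega)
  | cons u v ihu ihv =>
    have h1 := ihu (a := .bit true :: a) (c := .blank :: c) (ihv (by simpa [Tr.toks] using h))
    simp only [Tr.toks, List.cons_append, List.append_assoc]
    exact (Runs.stepC rfl (Runs.popD (Runs.seq Runs.pushA (Runs.seq Runs.pushC Runs.pushC)))
      h1).mono (by simp; omega)

theorem Runs.move (t : Tr) {d a b c : List Γ'} :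
    Runs .move (stk (t.toks ++ d) a b c) (5 * t.size + 5)
      (stk d (t.toks.reverse ++ .comma :: a) b c) :=
  (Runs.seq Runs.pushA (Runs.seq Runs.pushC (Runs.seq Runs.pushC (Runs.moveLoop t (T := 2)
    (Runs.stopC (x := .comma) rfl Runs.skip))))).mono (by omega)

/-- A loop invariant: `F u v` is the configuration in which the symbols `u`, latest first, have been
processed and `v` still lies above the comma on stack `k`. -/
theorem Runs.flush {k : Stk} {p : Γ' → Prog} {n : ℕ} (w : List Γ') {S S' : Stk → List Γ'}
    (F : List Γ' → List Γ' → Stk → List Γ') (hF : ∀ u v, (F u v) k = v ++ .comma :: S' k)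
    (hw : ∀ x ∈ w, x ≠ .comma)
    (hp : ∀ u x v, Runs (p x) (Function.update (F u (x :: v)) k (v ++ .comma :: S' k)) n
      (F (x :: u) v))
    (hS : F [] w = S) (hS' : Function.update (F w.reverse []) k (S' k) = S') :
    Runs (.flush k p) S (w.length * (n + 1) + 2) S' := by
  have key : ∀ (v u : List Γ'), (∀ x ∈ v, x ≠ .comma) → u.reverse ++ v = w →
      Runs (.flush k p) (F u v) (v.length * (n + 1) + 2) S' := by
    intro v
    induction v with
    | nil =>
      intro u _ hu
      simp only [List.append_nil] at hu
      subst hu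
      refine (Runs.halt (T := 1) (o := some .comma) (S₁ := S') (by simp [hF]) ?_ rfl ?_).mono ?_
      · simpa [hF] using hS'
      · simpa using Runs.skip
      · simp
    | cons x v ih =>
      intro u hv hu
      have hx : x ≠ .comma := hv x (by simp)
      refine (Runs.step (T := n) (o := some x) (S' := F (x :: u) v) (by simp [hF]) rfl
        (by simp [hx]) ?_
        (ih (x :: u) (fun y hy => hv y (by simp [hy])) (by simpa using hu))).mono ?_
      · simpa [hF, hx] using hp u x v
      · simp only [List.length_cons]; ring_nf; omega
  rw [← hS]
  exact key w [] hw rfl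

theorem Tr.ne_comma_of_mem_toks {t : Tr} {x : Γ'} (h : x ∈ t.toks) : x ≠ .comma := by
  obtain ⟨b, rfl⟩ := Tr.bit_of_mem_toks h
  simp

/-- Remove a tree from `D`. -/
def Prog.drop : Prog := .seq .move (.flush .A fun _ => .skip)

theorem Runs.drop (t : Tr) {d a b c : List Γ'} :
    Runs .drop (stk (t.toks ++ d) a b c) (7 * t.size + 7) (stk d a b c) := by
  refine (Runs.seq (Runs.move t) (Runs.flush (n := 1) t.toks.reverse
    (fun _ v => stk d (v ++ .comma :: a) b c) (by simp) ?_ ?_ rfl (by simp))).mono ?_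
  · exact fun x hx => Tr.ne_comma_of_mem_toks (by simpa using hx)
  · intro u x v
    simpa using Runs.skip
  · simp [Tr.size]; omega

/-- Move a tree back from `A` to `D`. -/
def Prog.restore : Prog := .flush .A fun x => .push .D x

theorem Runs.restore (t : Tr) {d a b c : List Γ'} :
    Runs .restore (stk d (t.toks.reverse ++ .comma :: a) b c) (2 * t.size + 2)
      (stk (t.toks ++ d) a b c) := by
  refine (Runs.flush (n := 1) t.toks.reverse
    (fun u v => stk (u ++ d) (v ++ .comma :: a) b c) (by simp) ?_ ?_ rfl (by simp)).mono ?_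
  · exact fun x hx => Tr.ne_comma_of_mem_toks (by simpa using hx)
  · intro u x v
    exact Runs.push (by simp)
  · simp [Tr.size]; omega

/-- Save a copy of the tree on `D` on stack `B`. -/
def Prog.save : Prog :=
  .seq .move (.seq (.push .B .comma) (.flush .A fun x => .seq (.push .D x) (.push .B x)))

theorem Runs.save (t : Tr) {d a b c : List Γ'} :
    Runs .save (stk (t.toks ++ d) a b c) (8 * t.size + 8)
      (stk (t.toks ++ d) a (t.toks ++ .comma :: b) c) := by
  refine (Runs.seq (Runs.move t) (Runs.seq Runs.pushB
    (Runs.flush (n := 2) t.toks.reverse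
    (fun u v => stk (u ++ d) (v ++ .comma :: a) (u ++ .comma :: b) c) (by simp) ?_ ?_ rfl
      (by simp)))).mono ?_
  · exact fun x hx => Tr.ne_comma_of_mem_toks (by simpa using hx)
  · intro u x v
    exact Runs.seq (Runs.push rfl) (Runs.push (by simp))
  · simp [Tr.size]; omega

/-- Move a saved tree from `B` to `D`. -/
def Prog.load : Prog :=
  .seq (.push .A .comma) (.seq (.flush .B fun x => .push .A x) .restore)

theorem Runs.load (t : Tr) {d a b c : List Γ'} :
    Runs .load (stk d a (t.toks ++ .comma :: b) c) (4 * t.size + 5)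
      (stk (t.toks ++ d) a b c) := by
  refine (Runs.seq Runs.pushA (Runs.seq
    (Runs.flush (n := 1) t.toks
      (S' := stk d (t.toks.reverse ++ .comma :: a) b c)
      (fun u v => stk d (u ++ .comma :: a) (v ++ .comma :: b) c) (by simp) ?_ ?_ rfl
      (by simp)) (Runs.restore t))).mono ?_
  · exact fun x hx => Tr.ne_comma_of_mem_toks hx
  · intro u x v
    exact Runs.push (by simp)
  · simp [Tr.size]; omega

/-! ### Programs that transform trees -/

/-- Program `p` replaces the tree `x` on the data stack by `y` in at most `T` steps. -/
def Maps (p : Prog) (x y : Tr) (T : ℕ) : Prop :=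
  ∀ d a b c, Runs p (stk (x.toks ++ d) a b c) T (stk (y.toks ++ d) a b c)

theorem Maps.mono {p : Prog} {x y : Tr} {T T' : ℕ} (h : Maps p x y T) (hT : T ≤ T') :
    Maps p x y T' := fun d a b c => (h d a b c).mono hT

theorem Maps.size_le {p : Prog} {x y : Tr} {T : ℕ} (h : Maps p x y T) : y.size ≤ x.size + T := by
  obtain ⟨t, ht, hr⟩ := h [] [] [] []
  have := hr.stkSize_le
  simp [stkSize] at this
  simp only [Tr.size]
  omega

theorem Maps.skip (x : Tr) : Maps .skip x x 1 := fun _ _ _ _ => Runs.skip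

theorem Maps.seq {p q : Prog} {x y z : Tr} {T T' : ℕ} (h : Maps p x y T) (h' : Maps q y z T') :
    Maps (.seq p q) x z (T + T') := fun d a b c => (h d a b c).seq (h' d a b c)

/-- Apply two programs to copies of the same tree and pair the results. -/
def Prog.pair (p q : Prog) : Prog :=
  .seq .save (.seq q (.seq .load (.seq p (.push .D (.bit true)))))

/-- The program `q` runs first, so that `y` ends up above `z` as prefix notation demands. The saved
copy of `x` survives on `B` because `Maps` leaves whatever lies deeper on the stacks untouched. -/
theorem Maps.pair {p q : Prog} {x y z : Tr} {T T' : ℕ} (h : Maps p x y T) (h' : Maps q x z T') :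
    Maps (.pair p q) x (.cons y z) (T + T' + 12 * x.size + 14) := by
  intro d a b c
  refine (Runs.seq (Runs.save x) (Runs.seq (h' _ _ _ _) (Runs.seq (Runs.load x)
    (Runs.seq (h _ _ _ _) (Runs.push ?_))))).mono (by omega)
  simp [Tr.toks]

/-- The first component of a pair. -/
def Prog.fst : Prog := .pop .D fun _ => .seq .move (.seq .drop .restore)

theorem Maps.fst (x y : Tr) : Maps .fst (.cons x y) x (7 * (Tr.cons x y).size + 20) := by
  intro d a b c
  refine (Runs.halt (o := some (.bit true)) (S₁ := stk (x.toks ++ (y.toks ++ d)) a b c) rfl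
    (by simp [Tr.toks]) rfl (Runs.seq (Runs.move x) (Runs.seq (Runs.drop y)
      (Runs.restore x)))).mono ?_
  simp; omega

/-- The second component of a pair. -/
def Prog.snd : Prog := .pop .D fun _ => .drop

theorem Maps.snd (x y : Tr) : Maps .snd (.cons x y) y (7 * (Tr.cons x y).size + 20) := by
  intro d a b c
  refine (Runs.halt (o := some (.bit true)) (S₁ := stk (x.toks ++ (y.toks ++ d)) a b c) rfl
    (by simp [Tr.toks]) rfl (Runs.drop x)).mono ?_
  simp; omega

/-- Put a tree on the data stack. -/
def Prog.pushTree : Tr → Prog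
  | .nil => .push .D (.bit false)
  | .cons u v => .seq (pushTree v) (.seq (pushTree u) (.push .D (.bit true)))

theorem Runs.pushTree (t : Tr) {d a b c : List Γ'} :
    Runs (.pushTree t) (stk d a b c) t.size (stk (t.toks ++ d) a b c) := by
  induction t generalizing d with
  | nil => exact Runs.push (by simp [Tr.toks])
  | cons u v ihu ihv =>
    exact (Runs.seq ihv (Runs.seq ihu (Runs.push (by simp [Tr.toks])))).mono (by simp; omega)

theorem Maps.const (t x : Tr) : Maps (.seq .drop (.pushTree t)) x t (7 * x.size + 7 + t.size) :=
  fun _ _ _ _ => Runs.seq (Runs.drop x) (Runs.pushTree t)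

/-- Continue depending on whether the first component of a pair is `nil`. -/
def Prog.ifNil (p q : Prog) : Prog :=
  .pop .D fun _ => .pop .D fun
    | some (.bit true) => .seq (.push .D (.bit true)) (.seq (.push .D (.bit true)) q)
    | _ => .seq (.push .D (.bit false)) (.seq (.push .D (.bit true)) p)

theorem Maps.ifNil_nil {p q : Prog} {x y : Tr} {T : ℕ} (h : Maps p (.cons .nil x) y T) :
    Maps (.ifNil p q) (.cons .nil x) y (T + 4) := fun d a b c =>
  (Runs.popD (Runs.popD (Runs.seq Runs.pushD (Runs.seq Runs.pushD (h d a b c))))).mono (by omega)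

theorem Maps.ifNil_cons {p q : Prog} {u v x y : Tr} {T : ℕ}
    (h : Maps q (.cons (.cons u v) x) y T) :
    Maps (.ifNil p q) (.cons (.cons u v) x) y (T + 4) := fun d a b c =>
  (Runs.popD (Runs.popD (Runs.seq Runs.pushD (Runs.seq Runs.pushD (h d a b c))))).mono (by omega)

/-- The body of the loop of `Prog.while`. -/
def Prog.whileBody (p : Prog) : Option Γ' → Prog
  | some .blank => .pop .D fun _ => .pop .D fun
    | some (.bit true) => .seq (.push .D (.bit true)) (.seq (.push .D (.bit true))
        (.seq p (.push .C .blank)))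
    | _ => .seq (.push .D (.bit false)) (.push .D (.bit true))
  | _ => .skip

/-- Repeat a program as long as the first component of the pair on the data stack is not `nil`. -/
def Prog.while (p : Prog) : Prog :=
  .seq (.push .C .comma) (.seq (.push .C .blank)
    (.loop .C (fun o => o == some .blank) (Prog.whileBody p)))

/-- The sequence `s` lists the trees before each round. On `C`, a blank requests another round and
the comma below it ends the loop; this keeps the control flow apart from the data, whose leading
tokens are popped for the test and pushed back. -/
theorem Maps.while {p : Prog} {T : ℕ} (n : ℕ) (s : ℕ → Tr)
    (hs : ∀ j < n, (∃ u v x, s j = .cons (.cons u v) x) ∧ Maps p (s j) (s (j + 1)) T)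
    (hn : ∃ x, s n = .cons .nil x) : Maps (.while p) (s 0) (s n) (n * (T + 10) + 10) := by
  intro d a b c
  have key : ∀ m ≤ n, Runs (.loop .C (fun o => o == some .blank) (Prog.whileBody p))
      (stk ((s (n - m)).toks ++ d) a b (.blank :: .comma :: c)) (m * (T + 10) + 8)
      (stk ((s n).toks ++ d) a b c) := by
    intro m
    induction m with
    | zero =>
      intro _
      obtain ⟨x, hx⟩ := hn
      simp only [Nat.sub_zero, hx]
      exact (Runs.stepC rfl (Runs.popD (Runs.popD (Runs.seq Runs.pushD Runs.pushD)))
        (Runs.stopC rfl Runs.skip)).mono (by omega)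
    | succ m ih =>
      intro hm
      obtain ⟨⟨u, v, x, hx⟩, hp⟩ := hs (n - (m + 1)) (by omega)
      rw [show n - (m + 1) + 1 = n - m by omega] at hp
      have hp' := hp d a b (.comma :: c)
      simp only [hx] at hp' ⊢
      refine (Runs.stepC rfl (Runs.popD (Runs.popD (Runs.seq Runs.pushD (Runs.seq Runs.pushD
        (Runs.seq hp' Runs.pushC))))) (ih (by omega))).mono ?_
      ring_nf; omega
  exact (Runs.seq Runs.pushC (Runs.seq Runs.pushC (by simpa using key n le_rfl))).mono (by omega)

end MarkovShap

/-! ### The class of polynomial time functions and its closure properties. -/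

namespace MarkovShap

open Computability

/-! ### Polynomial time functions -/

/-- A representation of the elements of a type by trees. -/
class Code (α : Type) where
  code : α → Tr

open Code

variable {α β γ δ σ : Type} [Code α] [Code β] [Code γ] [Code δ] [Code σ]

/-- The size of the representation of an element. -/
def sz (a : α) : ℕ := (code a).size

instance : Code Unit := ⟨fun _ => .nil⟩

instance : Code Bool := ⟨fun b => if b then .cons .nil .nil else .nil⟩

instance : Code (α × β) := ⟨fun p => .cons (code p.1) (code p.2)⟩

/-- The representation of a list. -/
def codeList : List α → Tr
  | [] => .nil
  | a :: l => .cons (code a) (codeList l)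

instance : Code (List α) := ⟨codeList⟩

instance : Code ℕ := ⟨fun n => code n.bits⟩

instance {p : α → Prop} : Code {a // p a} := ⟨fun a => code a.1⟩

/-- A symbol is represented by whether it is a bit, whether it is a bracket, and its value. -/
def symTriple : Γ' → Bool × Bool × Bool
  | .bit b => (true, false, b)
  | .bra => (false, true, false)
  -- Blank, closing bracket and comma share a code; of these, only the comma occurs in instances and
  -- in output.
  | _ => (false, false, false)

instance : Code Γ' := ⟨fun x => code (symTriple x)⟩

theorem sz_pos (a : α) : 0 < sz a := Tr.size_pos _

@[simp] theorem sz_prod (p : α × β) : sz p = sz p.1 + sz p.2 + 1 := by simp [sz, code]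

@[simp] theorem sz_nil : sz ([] : List α) = 1 := rfl

@[simp] theorem sz_cons (a : α) (l : List α) : sz (a :: l) = sz a + sz l + 1 := by
  simp [sz, code, codeList]

theorem sz_bool_le (b : Bool) : sz b ≤ 3 := by cases b <;> simp [sz, code]

theorem sz_append (l m : List α) : sz (l ++ m) + 1 = sz l + sz m := by
  induction l with
  | nil => simp [Nat.add_comm]
  | cons a l ih => simp; omega

theorem sz_reverse (l : List α) : sz l.reverse = sz l := by
  induction l with
  | nil => rfl
  | cons a l ih => have := sz_append l.reverse [a]; simp at *; omega

theorem length_lt_sz (l : List α) : l.length < sz l := by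
  induction l with
  | nil => simp
  | cons a l ih => simp; omega

theorem sz_le_of_mem {l : List α} {a : α} (h : a ∈ l) : sz a < sz l := by
  induction l with
  | nil => simp at h
  | cons b l ih =>
    rcases List.mem_cons.1 h with rfl | h
    · rw [sz_cons]; omega
    · have := ih h; rw [sz_cons]; omega

theorem sz_le_of_forall_le {l : List α} {m : ℕ} (h : ∀ a ∈ l, sz a ≤ m) :
    sz l ≤ l.length * (m + 1) + 1 := by
  induction l with
  | nil => simp
  | cons b l ih =>
    have h1 := ih fun a ha => h a (by simp [ha])
    have h2 := h b (by simp)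
    simp only [sz_cons, List.length_cons]
    ring_nf at *
    omega

theorem sz_sublist_le {l m : List α} (h : l.Sublist m) : sz l ≤ sz m := by
  induction h with
  | slnil => simp
  | cons a _ ih => simp; omega
  | cons_cons a _ ih => simp; omega

theorem polyEval_mono (q : Polynomial ℕ) {m n : ℕ} (h : m ≤ n) : q.eval m ≤ q.eval n := by
  simp only [Polynomial.eval_eq_sum, Polynomial.sum]
  gcongr

/-- A quantity is bounded by a polynomial in the size of the argument. -/
@[fun_prop]
def PolyBd (g : α → ℕ) : Prop := ∃ q : Polynomial ℕ, ∀ a, g a ≤ q.eval (sz a)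

theorem PolyBd.mono {g h : α → ℕ} (hh : PolyBd h) (hg : ∀ a, g a ≤ h a) : PolyBd g :=
  let ⟨q, hq⟩ := hh
  ⟨q, fun a => (hg a).trans (hq a)⟩

@[fun_prop]
theorem PolyBd.const (n : ℕ) : PolyBd fun _ : α => n := ⟨Polynomial.C n, fun _ => by simp⟩

@[fun_prop]
theorem PolyBd.add {g h : α → ℕ} (hg : PolyBd g) (hh : PolyBd h) : PolyBd fun a => g a + h a :=
  let ⟨q, hq⟩ := hg
  let ⟨r, hr⟩ := hh
  ⟨q + r, fun a => by simpa using Nat.add_le_add (hq a) (hr a)⟩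

@[fun_prop]
theorem PolyBd.mul {g h : α → ℕ} (hg : PolyBd g) (hh : PolyBd h) : PolyBd fun a => g a * h a :=
  let ⟨q, hq⟩ := hg
  let ⟨r, hr⟩ := hh
  ⟨q * r, fun a => by simpa using Nat.mul_le_mul (hq a) (hr a)⟩

@[fun_prop]
theorem PolyBd.eval (r : Polynomial ℕ) {g : α → ℕ} (hg : PolyBd g) : PolyBd fun a => r.eval (g a) :=
  let ⟨q, hq⟩ := hg
  ⟨r.comp q, fun a => by simpa using polyEval_mono r (hq a)⟩

theorem PolyBd.sz : PolyBd fun a : α => sz a := ⟨.X, fun a => by simp⟩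

/-- Some program computes the function in polynomial time. -/
@[fun_prop]
def PTime (f : α → β) : Prop :=
  ∃ (p : Prog) (T : α → ℕ), PolyBd T ∧ ∀ a, Maps p (code a) (code (f a)) (T a)

@[fun_prop]
theorem PTime.sz {f : α → β} (hf : PTime f) : PolyBd fun a => sz (f a) :=
  let ⟨_, _, hT, h⟩ := hf
  (PolyBd.sz.add hT).mono fun a => (h a).size_le

@[fun_prop]
theorem PolyBd.comp {g : β → ℕ} {f : α → β} (hg : PolyBd g) (hf : PTime f) :
    PolyBd fun a => g (f a) :=
  let ⟨q, hq⟩ := hg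
  (PolyBd.eval q hf.sz).mono fun a => hq (f a)

theorem PTime.of_code_eq {f : α → β} (h : ∀ a, code (f a) = code a) : PTime f :=
  ⟨.skip, fun _ => 1, .const 1, fun a => by rw [h]; exact Maps.skip _⟩

@[fun_prop]
theorem PTime.id : PTime fun a : α => a := .of_code_eq fun _ => rfl

@[fun_prop]
theorem PTime.const (b : β) : PTime fun _ : α => b :=
  ⟨_, fun a => 7 * MarkovShap.sz a + 7 + (code b).size, ((PolyBd.const 7).mul .sz).add (.const 7)
    |>.add (.const _), fun _ => Maps.const _ _⟩

@[fun_prop]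
theorem PTime.comp {g : β → γ} {f : α → β} (hg : PTime g) (hf : PTime f) :
    PTime fun a => g (f a) :=
  let ⟨p, T, hT, h⟩ := hf
  let ⟨p', T', hT', h'⟩ := hg
  ⟨.seq p p', fun a => T a + T' (f a), hT.add (hT'.comp hf), fun a => (h a).seq (h' (f a))⟩

@[fun_prop]
theorem PTime.pair {f : α → β} {g : α → γ} (hf : PTime f) (hg : PTime g) :
    PTime fun a => (f a, g a) :=
  let ⟨p, T, hT, h⟩ := hf
  let ⟨p', T', hT', h'⟩ := hg
  ⟨.pair p p', fun a => T a + T' a + 12 * MarkovShap.sz a + 14,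
    ((hT.add hT').add ((PolyBd.const 12).mul .sz)).add (.const 14), fun a => (h a).pair (h' a)⟩

theorem PTime.of_fst : PTime fun p : α × β => p.1 :=
  ⟨.fst, fun a => 7 * MarkovShap.sz a + 20, ((PolyBd.const 7).mul .sz).add (.const 20),
    fun _ => Maps.fst _ _⟩

theorem PTime.of_snd : PTime fun p : α × β => p.2 :=
  ⟨.snd, fun a => 7 * MarkovShap.sz a + 20, ((PolyBd.const 7).mul .sz).add (.const 20),
    fun _ => Maps.snd _ _⟩

@[fun_prop]
theorem PTime.fst {f : α → β × γ} (hf : PTime f) : PTime fun a => (f a).1 := of_fst.comp hf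

@[fun_prop]
theorem PTime.snd {f : α → β × γ} (hf : PTime f) : PTime fun a => (f a).2 := of_snd.comp hf

@[fun_prop]
theorem PTime.val {p : β → Prop} {f : α → {b // p b}} (hf : PTime f) : PTime fun a => (f a).1 :=
  (of_code_eq fun _ => rfl : PTime fun b : {b // p b} => b.1).comp hf

/-- Case distinction on a list. -/
def listCases (l : List β) (z : γ) (s : β → List β → γ) : γ :=
  match l with
  | [] => z
  | b :: t => s b t

@[fun_prop]
theorem PTime.listCases {l : α → List β} {f : α → γ} {g : α → β → List β → γ} (hl : PTime l)
    (hf : PTime f) (hg : PTime fun p : α × β × List β => g p.1 p.2.1 p.2.2) :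
    PTime fun a => MarkovShap.listCases (l a) (f a) (g a) := by
  obtain ⟨r, U, hU, hr⟩ := hl.pair PTime.id
  obtain ⟨p, T, hT, h⟩ := hf
  obtain ⟨p', T', ⟨q', hq'⟩, h'⟩ := hg
  have hp := (hl.pair PTime.id).sz
  refine ⟨.seq r (.ifNil (.seq .snd p) (.seq (.pair .snd .fst) p')), fun a => U a +
    (7 * MarkovShap.sz (l a, a) + 20 + T a + (26 * MarkovShap.sz (l a, a) + 54 +
      q'.eval (MarkovShap.sz (l a, a))) + 4), by fun_prop, fun a => (hr a).seq ?_⟩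
  change Maps _ (.cons (code (l a)) (code a)) (code (MarkovShap.listCases (l a) (f a) (g a))) _
  have hs : MarkovShap.sz (l a, a) = (Tr.cons (code (l a)) (code a)).size := rfl
  rw [hs]
  rcases hla : l a with _ | ⟨b, t⟩
  · exact (Maps.ifNil_nil ((Maps.snd _ _).seq (h a))).mono
      (by change _ ≤ 7 * (Tr.cons .nil (code a)).size + _ + _ + _ + _; omega)
  · have h2 := hq' (a, b, t)
    refine (Maps.ifNil_cons (((Maps.snd _ _).pair (Maps.fst _ _)).seq (h' (a, b, t)))).mono ?_
    -- A nonempty list has the same tree as the pair of its head and tail, so swapping the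
    -- components of `(b :: t, a)` gives the code of `(a, b, t)`.
    rw [show MarkovShap.sz (a, b, t) = (Tr.cons (code (b :: t)) (code a)).size by
      simp [MarkovShap.sz, code, codeList]; omega] at h2
    simp only [code, codeList] at h2 ⊢
    omega

@[fun_prop]
theorem PTime.cond {c : α → Bool} {f g : α → β} (hc : PTime c) (hf : PTime f) (hg : PTime g) :
    PTime fun a => bif c a then f a else g a := by
  obtain ⟨r, U, hU, hr⟩ := hc.pair PTime.id
  obtain ⟨p, T, hT, h⟩ := hf
  obtain ⟨p', T', hT', h'⟩ := hg
  have hp := (hc.pair PTime.id).sz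
  refine ⟨.seq r (.ifNil (.seq .snd p') (.seq .snd p)), fun a => U a +
    (7 * MarkovShap.sz (c a, a) + 20 + T a + T' a + 4), by fun_prop, fun a => (hr a).seq ?_⟩
  change Maps _ (.cons (code (c a)) (code a)) (code (bif c a then f a else g a)) _
  have hs : MarkovShap.sz (c a, a) = (Tr.cons (code (c a)) (code a)).size := rfl
  rw [hs]
  cases c a
  · exact (Maps.ifNil_nil ((Maps.snd _ _).seq (h' a))).mono
      (by change _ ≤ 7 * (Tr.cons .nil (code a)).size + _ + _ + _ + _; omega)
  · exact (Maps.ifNil_cons ((Maps.snd _ _).seq (h a))).mono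
      (by change _ ≤ 7 * (Tr.cons (.cons .nil .nil) (code a)).size + _ + _ + _ + _; omega)

theorem PTime.congr {f g : α → β} (hf : PTime f) (h : ∀ a, f a = g a) : PTime g :=
  funext h ▸ hf

@[fun_prop]
theorem PTime.isEmpty {l : α → List β} (hl : PTime l) : PTime fun a => (l a).isEmpty :=
  (hl.listCases (PTime.const true) (g := fun _ _ _ => false) (by fun_prop)).congr
    fun a => by cases l a <;> rfl

@[fun_prop]
theorem PTime.headD {l : α → List β} {d : α → β} (hl : PTime l) (hd : PTime d) :
    PTime fun a => (l a).headD (d a) :=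
  (hl.listCases hd (g := fun _ b _ => b) (by fun_prop)).congr fun a => by cases l a <;> rfl

@[fun_prop]
theorem PTime.tail {l : α → List β} (hl : PTime l) : PTime fun a => (l a).tail :=
  (hl.listCases (PTime.const []) (g := fun _ _ t => t) (by fun_prop)).congr
    fun a => by cases l a <;> rfl

@[fun_prop]
theorem PTime.cons {f : α → β} {g : α → List β} (hf : PTime f) (hg : PTime g) :
    PTime fun a => f a :: g a := hf.pair hg

@[fun_prop]
theorem PTime.not {f : α → Bool} (hf : PTime f) : PTime fun a => !f a :=
  (hf.cond (.const false) (.const true)).congr fun a => by cases f a <;> rfl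

@[fun_prop]
theorem PTime.and {f g : α → Bool} (hf : PTime f) (hg : PTime g) : PTime fun a => f a && g a :=
  (hf.cond hg (.const false)).congr fun a => by cases f a <;> rfl

@[fun_prop]
theorem PTime.or {f g : α → Bool} (hf : PTime f) (hg : PTime g) : PTime fun a => f a || g a :=
  (hf.cond (.const true) hg).congr fun a => by cases f a <;> rfl

@[fun_prop]
theorem PTime.xor {f g : α → Bool} (hf : PTime f) (hg : PTime g) :
    PTime fun a => Bool.xor (f a) (g a) :=
  (hf.cond hg.not hg).congr fun a => by cases f a <;> simp

theorem code_head_tail {l : List β} (h : l ≠ []) :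
    code l = .cons (code (l.head h)) (code l.tail) := by
  cases l with
  | nil => exact absurd rfl h
  | cons => rfl

/-- A fold is computable in polynomial time if the intermediate results are small. -/
theorem PTime.foldl_of_le {l : α → List β} {i : α → σ} {f : α → σ → β → σ} {B : α → ℕ}
    (hl : PTime l) (hi : PTime i) (hf : PTime fun p : α × σ × β => f p.1 p.2.1 p.2.2)
    (hB : PolyBd B) (h : ∀ a l', l' <+: l a → MarkovShap.sz (l'.foldl (f a) (i a)) ≤ B a) :
    PTime fun a => (l a).foldl (f a) (i a) := by
  -- The fold becomes a while loop on triples (remaining list, state, parameter). Restricting its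
  -- body to nonempty lists makes the head available without a default element of `β`.
  have hbody : PTime fun p : {p : List β × σ × α // p.1 ≠ []} =>
      (p.1.1.tail, f p.1.2.2 p.1.2.1 (p.1.1.head p.2), p.1.2.2) := by
    have hh : PTime fun p : {p : List β × σ × α // p.1 ≠ []} => p.1.1.head p.2 :=
      ⟨.seq .fst .fst, fun p => (7 * MarkovShap.sz p + 20) + (7 * MarkovShap.sz p + 20),
        by fun_prop,
        fun ⟨⟨l, x⟩, hl⟩ => by
          have h1 := Maps.fst (code l) (code x)
          have hs : MarkovShap.sz (⟨(l, x), hl⟩ : {p : List β × σ × α // p.1 ≠ []}) =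
            (code l).size + (code x).size + 1 := by simp [MarkovShap.sz, code]
          refine (h1.seq (z := code (l.head hl)) (T' := 7 * (code l).size + 20) ?_).mono ?_
          · rw [code_head_tail hl]; exact Maps.fst _ _
          · beta_reduce; rw [hs]; simp; omega⟩
    have := hf.comp (f := fun p : {p : List β × σ × α // p.1 ≠ []} =>
      (p.1.2.2, p.1.2.1, p.1.1.head p.2)) (by fun_prop)
    fun_prop
  obtain ⟨r, U, hU, hr⟩ := hl.pair (hi.pair PTime.id)
  obtain ⟨p, T, ⟨q, hq⟩, h'⟩ := hbody
  -- A bound for the size of every triple met by the loop; the time of each round is then at most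
  -- `q.eval (N a)`.
  let N : α → ℕ := fun a => MarkovShap.sz (l a) + B a + MarkovShap.sz a + 2
  have hN : PolyBd N := by fun_prop
  refine ⟨.seq r (.seq (.while p) (.seq .snd .fst)), fun a => U a +
    (MarkovShap.sz (l a) * (q.eval (N a) + 10) + 10 + ((7 * N a + 20) + (7 * N a + 20))),
    by fun_prop, fun a => (hr a).seq ?_⟩
  let s : ℕ → List β × σ × α := fun j => ((l a).drop j, ((l a).take j).foldl (f a) (i a), a)
  have hs : ∀ j, MarkovShap.sz (s j) ≤ N a := by
    intro j
    have h1 := sz_sublist_le (List.drop_sublist j (l a))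
    have h2 := h a _ (List.take_prefix j (l a))
    simp only [sz_prod, s, N]
    omega
  have hw := Maps.while (p := p) (T := q.eval (N a)) (l a).length (fun j => code (s j)) ?_ ?_
  · have h0 : s 0 = (l a, i a, a) := rfl
    have h1 := hs (l a).length
    have h2 := length_lt_sz (l a)
    simp only [h0, s, List.drop_length, List.take_length] at hw h1
    refine (hw.seq ((Maps.snd _ _).seq (Maps.fst _ _))).mono ?_
    have h3 : (l a).length * (q.eval (N a) + 10) ≤ MarkovShap.sz (l a) * (q.eval (N a) + 10) := by
      gcongr
    simp only [MarkovShap.sz, code, Tr.size_cons] at h1 h3 ⊢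
    omega
  · intro j hj
    have hne : (l a).drop j ≠ [] := by simpa using hj
    refine ⟨⟨_, _, _, congrArg₂ Tr.cons (code_head_tail hne) rfl⟩, ?_⟩
    have h1 := (h' ⟨s j, hne⟩).mono ((hq _).trans (polyEval_mono q (hs j)))
    have h2 : s (j + 1) = ((s j).1.tail, f (s j).2.2 (s j).2.1 ((s j).1.head hne), (s j).2.2) := by
      simp only [s, List.tail_drop, List.head_drop]
      rw [List.take_add_one, List.getElem?_eq_getElem hj, List.foldl_append]
      rfl
    rw [h2]
    exact h1
  · exact ⟨_, by simp [s, code, codeList]; rfl⟩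

end MarkovShap

/-! ### List operations and binary arithmetic in polynomial time. -/

namespace MarkovShap

open Computability Code

variable {α β γ δ σ : Type} [Code α] [Code β] [Code γ] [Code δ] [Code σ]

/-! ### Lists -/

theorem PTime.of_code {f : α → β} {g : α → γ} (hg : PTime g) (h : ∀ a, code (f a) = code (g a)) :
    PTime f :=
  let ⟨p, T, hT, hp⟩ := hg
  ⟨p, T, hT, fun a => by rw [h]; exact hp a⟩

/-- An element of a list is smaller than the list, so a bound in terms of the element is uniform
over the list. -/
theorem PolyBd.comp_pair {G : α × β → ℕ} (hG : PolyBd G) {l : α → List β} (hl : PTime l) :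
    ∃ B : α → ℕ, PolyBd B ∧ ∀ a, ∀ b ∈ l a, G (a, b) ≤ B a := by
  obtain ⟨q, hq⟩ := hG
  refine ⟨fun a => q.eval (MarkovShap.sz a + MarkovShap.sz (l a) + 1), ?_, fun a b hb => ?_⟩
  · have := hl.sz
    have := PolyBd.sz (α := α)
    fun_prop
  · refine (hq _).trans (polyEval_mono q ?_)
    have := sz_le_of_mem hb
    simp
    omega

/-- A fold is computable in polynomial time if every step increases the size of the state
by an amount that does not depend on the state. -/
theorem PTime.foldl {l : α → List β} {i : α → σ} {f : α → σ → β → σ}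
    (hl : PTime l) (hi : PTime i) (hf : PTime fun p : α × σ × β => f p.1 p.2.1 p.2.2)
    (μ : σ → ℕ) (r : Polynomial ℕ) (hμ : ∀ s, MarkovShap.sz s ≤ r.eval (μ s))
    (hi' : PolyBd fun a => μ (i a)) {G : α × β → ℕ} (hG : PolyBd G)
    (h : ∀ a s b, μ (f a s b) ≤ μ s + G (a, b)) : PTime fun a => (l a).foldl (f a) (i a) := by
  obtain ⟨B, hB, hGB⟩ := hG.comp_pair hl
  have hl' := hl.sz
  refine hl.foldl_of_le hi hf (B := fun a => r.eval (μ (i a) + MarkovShap.sz (l a) * B a))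
    (PolyBd.eval r (hi'.add (hl'.mul hB))) ?_
  intro a l' hl'
  refine (hμ _).trans (polyEval_mono r ?_)
  -- Increments independent of the state add up to at most length times `B a`, instead of
  -- compounding.
  have h1 : ∀ (m : List β) s, (∀ b ∈ m, G (a, b) ≤ B a) →
      μ (m.foldl (f a) s) ≤ μ s + m.length * B a := by
    intro m
    induction m with
    | nil => simp
    | cons b m ih =>
      intro s hm
      have h2 := ih (f a s b) fun b hb => hm b (by simp [hb])
      have h3 := h a s b
      have h4 := hm b (by simp)
      simp only [List.foldl_cons, List.length_cons]
      ring_nf at *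
      omega
  refine (h1 l' (i a) fun b hb => hGB a b (hl'.subset hb)).trans ?_
  have := hl'.length_le.trans (length_lt_sz (l a)).le
  gcongr

/-- A fold over a list of values whose size is the measure of the state. -/
theorem PTime.foldl_sz {l : α → List β} {i : α → σ} {f : α → σ → β → σ}
    (hl : PTime l) (hi : PTime i) (hf : PTime fun p : α × σ × β => f p.1 p.2.1 p.2.2)
    {G : α × β → ℕ} (hG : PolyBd G)
    (h : ∀ a s b, MarkovShap.sz (f a s b) ≤ MarkovShap.sz s + G (a, b)) :
    PTime fun a => (l a).foldl (f a) (i a) :=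
  hl.foldl hi hf MarkovShap.sz .X (fun _ => by simp) hi.sz hG h

@[fun_prop]
theorem PTime.reverse {l : α → List β} (hl : PTime l) : PTime fun a => (l a).reverse :=
  (hl.foldl_sz (.const []) (f := fun _ s b => b :: s) (by fun_prop)
    (G := fun p => MarkovShap.sz p.2 + 1) (by fun_prop) fun a s b => by simp; omega).congr
    fun a => by simp

@[fun_prop]
theorem PTime.append {l m : α → List β} (hl : PTime l) (hm : PTime m) :
    PTime fun a => l a ++ m a :=
  (hl.reverse.foldl_sz hm (f := fun _ s b => b :: s) (by fun_prop)
    (G := fun p => MarkovShap.sz p.2 + 1) (by fun_prop) fun a s b => by simp; omega).congr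
    fun a => by simp

@[fun_prop]
theorem PTime.map {l : α → List β} {g : α → β → γ} (hl : PTime l)
    (hg : PTime fun p : α × β => g p.1 p.2) : PTime fun a => (l a).map (g a) :=
  (hl.reverse.foldl_sz (.const []) (f := fun a s b => g a b :: s)
    ((hg.comp (f := fun p : α × List γ × β => (p.1, p.2.2)) (by fun_prop)).cons (by fun_prop))
    (G := fun p => MarkovShap.sz (g p.1 p.2) + 1) (by fun_prop)
    fun a s b => by simp; omega).congr
    fun a => by simp

theorem PTime.foldr {l : α → List β} {i : α → σ} {f : α → β → σ → σ}
    (hl : PTime l) (hi : PTime i) (hf : PTime fun p : α × σ × β => f p.1 p.2.2 p.2.1)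
    (μ : σ → ℕ) (r : Polynomial ℕ) (hμ : ∀ s, MarkovShap.sz s ≤ r.eval (μ s))
    (hi' : PolyBd fun a => μ (i a)) {G : α × β → ℕ} (hG : PolyBd G)
    (h : ∀ a s b, μ (f a b s) ≤ μ s + G (a, b)) : PTime fun a => (l a).foldr (f a) (i a) :=
  (hl.reverse.foldl hi hf μ r hμ hi' hG h).congr fun a => by simp

-- In a fold from the right, an element that fails the test discards all that was collected behind
-- it.
@[fun_prop]
theorem PTime.takeWhile {l : α → List β} {g : α → β → Bool} (hl : PTime l)
    (hg : PTime fun p : α × β => g p.1 p.2) : PTime fun a => (l a).takeWhile (g a) :=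
  (hl.reverse.foldl_sz (.const []) (f := fun a s b => bif g a b then b :: s else [])
    ((hg.comp (f := fun p : α × List β × β => (p.1, p.2.2)) (by fun_prop)).cond (by fun_prop)
      (by fun_prop))
    (G := fun p => MarkovShap.sz p.2 + 1) (by fun_prop)
    fun a s b => by cases g a b <;> simp <;> omega).congr fun a => by
      simp only [List.foldl_reverse]
      induction l a with
      | nil => rfl
      | cons b l ih => cases h : g a b <;> simp [h, ih]

-- The list serves as its own clock. Each tick drops the head if it passes the test; after the first
-- failure the state no longer changes.
@[fun_prop]
theorem PTime.dropWhile {l : α → List β} {g : α → β → Bool} (hl : PTime l)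
    (hg : PTime fun p : α × β => g p.1 p.2) : PTime fun a => (l a).dropWhile (g a) := by
  have hb : PTime fun p : α × List β × β =>
      MarkovShap.listCases p.2.1 [] fun b t => bif g p.1 b then t else b :: t :=
    PTime.listCases (by fun_prop) (.const [])
      (g := fun (p : α × List β × β) b t => bif g p.1 b then t else b :: t)
      ((hg.comp (f := fun p : (α × List β × β) × β × List β => (p.1.1, p.2.1))
        (by fun_prop)).cond (by fun_prop) (by fun_prop))
  refine (hl.foldl_sz hl (f := fun a s _ => MarkovShap.listCases s [] fun b t =>
    bif g a b then t else b :: t) hb (G := fun _ => 0) (by fun_prop) ?_).congr fun a => ?_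
  · intro a s _
    rcases s with _ | ⟨b, t⟩
    · simp [MarkovShap.listCases]
    · cases h : g a b <;> simp [MarkovShap.listCases, h]; omega
  · have key : ∀ (c s : List β), s.length ≤ c.length → c.foldl (fun s _ =>
        MarkovShap.listCases s [] fun b t => bif g a b then t else b :: t) s =
          s.dropWhile (g a) := by
      intro c
      induction c with
      | nil => intro s hs; rw [List.eq_nil_of_length_eq_zero (Nat.le_zero.1 hs)]; rfl
      | cons x c ih =>
        intro s hs
        rcases s with _ | ⟨b, t⟩
        · exact ih [] (by simp)
        · simp only [List.foldl_cons, MarkovShap.listCases]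
          cases h : g a b
          · simp only [cond_false, List.dropWhile_cons, h]
            have hfix : ∀ c : List β, c.foldl (fun s _ => MarkovShap.listCases s [] fun b t =>
                bif g a b then t else b :: t) (b :: t) = b :: t := by
              intro c
              induction c with
              | nil => rfl
              | cons y c ih' => simpa [MarkovShap.listCases, h] using ih'
            exact (hfix c).trans (by simp)
          · simp only [cond_true, List.dropWhile_cons, h, if_true]
            exact ih t (by simpa using hs)
    exact key _ _ le_rfl

/-! ### Binary arithmetic -/

theorem size_le_iff {m n : ℕ} : m.size ≤ n ↔ m < 2 ^ n := Nat.size_le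

theorem sz_nat_le (n : ℕ) : MarkovShap.sz n ≤ 4 * n.size + 1 := by
  have h := sz_le_of_forall_le (l := n.bits) (m := 3) fun b _ => sz_bool_le b
  rw [Nat.size_eq_bits_len] at h
  change MarkovShap.sz n.bits ≤ _
  omega

theorem size_le_sz (n : ℕ) : n.size ≤ MarkovShap.sz n := by
  have h := length_lt_sz n.bits
  rw [Nat.size_eq_bits_len] at h
  exact h.le

theorem size_le_self (n : ℕ) : n.size ≤ n := size_le_iff.2 Nat.lt_two_pow_self

theorem size_add_le (m n : ℕ) : (m + n).size ≤ m.size + n.size + 1 := by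
  have h1 := Nat.lt_size_self m
  have h2 := Nat.lt_size_self n
  rw [size_le_iff]
  have h3 : 2 ^ m.size ≤ 2 ^ (m.size + n.size) := Nat.pow_le_pow_right (by simp) (by simp)
  have h4 : 2 ^ n.size ≤ 2 ^ (m.size + n.size) := Nat.pow_le_pow_right (by simp) (by simp)
  rw [pow_succ]
  omega

theorem size_mul_le (m n : ℕ) : (m * n).size ≤ m.size + n.size := by
  rw [size_le_iff, pow_add]
  exact Nat.mul_lt_mul'' (Nat.lt_size_self m) (Nat.lt_size_self n)

@[fun_prop]
theorem PolyBd.size {f : α → ℕ} (hf : PTime f) : PolyBd fun a => (f a).size :=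
  hf.sz.mono fun _ => size_le_sz _

@[fun_prop]
theorem PTime.bits {f : α → ℕ} (hf : PTime f) : PTime fun a => (f a).bits :=
  hf.of_code fun _ => rfl

@[fun_prop]
theorem PTime.bodd {f : α → ℕ} (hf : PTime f) : PTime fun a => (f a).bodd :=
  (hf.bits.headD (.const false)).congr fun a => by
    rw [Nat.bodd_eq_bits_head]; cases (f a).bits <;> rfl

@[fun_prop]
theorem PTime.div2 {f : α → ℕ} (hf : PTime f) : PTime fun a => (f a).div2 :=
  hf.bits.tail.of_code fun a => by
    change code (f a).div2.bits = _
    rw [Nat.div2_bits_eq_tail]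

@[fun_prop]
theorem PTime.bit {b : α → Bool} {f : α → ℕ} (hb : PTime b) (hf : PTime f) :
    PTime fun a => Nat.bit (b a) (f a) :=
  -- `Nat.bits` has no leading zeros, so the digit `false` in front of the number zero must give the
  -- empty list.
  ((hf.bits.isEmpty.and hb.not).cond (.const []) (hb.cons hf.bits)).of_code fun a => by
    change code (Nat.bit (b a) (f a)).bits = _
    congr 1
    rcases Nat.eq_zero_or_pos (f a) with h0 | h0
    · cases hb : b a
      · simp [h0]
      · rw [Nat.bits_append_bit _ _ fun _ => rfl]; simp [h0]
    · rw [Nat.bits_append_bit _ _ fun h => absurd h h0.ne']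
      have : (f a).bits.isEmpty = false := by
        rw [← Bool.not_eq_true, List.isEmpty_iff_length_eq_zero, Nat.size_eq_bits_len,
          Nat.size_eq_zero]
        exact h0.ne'
      simp [this]

theorem foldr_bit_bits (n : ℕ) : n.bits.foldr Nat.bit 0 = n := by
  induction n using Nat.binaryRec' with
  | zero => simp
  | bit b n hn ih => rw [Nat.bits_append_bit _ _ hn, List.foldr_cons, ih]

theorem size_bit_le (b : Bool) (n : ℕ) : (Nat.bit b n).size ≤ n.size + 1 := by
  rw [size_le_iff, Nat.bit_lt_two_pow_succ_iff]
  exact Nat.lt_size_self n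

theorem size_div2_le (n : ℕ) : n.div2.size ≤ n.size := by
  rw [← Nat.size_eq_bits_len, ← Nat.size_eq_bits_len, Nat.div2_bits_eq_tail]
  simp

/-- The number with given binary digits, least significant first. -/
@[fun_prop]
theorem PTime.ofBits {l : α → List Bool} (hl : PTime l) : PTime fun a => (l a).foldr Nat.bit 0 :=
  hl.foldr (.const 0) (f := fun _ b n => Nat.bit b n) (by fun_prop) Nat.size (4 * .X + 1)
    (fun s => by simpa using sz_nat_le s) (.const _) (.const 1) fun _ _ _ => size_bit_le _ _

/-- One step of a serial operation on binary numbers with a carry bit. The state consists of the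
carry bit, the remaining digits of both numbers and the digits of the result. -/
def serialStep (d c : Bool → Bool → Bool → Bool) (s : Bool × ℕ × ℕ × List Bool) :
    Bool × ℕ × ℕ × List Bool :=
  (c s.1 s.2.1.bodd s.2.2.1.bodd, s.2.1.div2, s.2.2.1.div2,
    d s.1 s.2.1.bodd s.2.2.1.bodd :: s.2.2.2)

/-- Enough time for a serial operation. -/
def serialClock (x y : ℕ) : List Bool := x.bits ++ (y.bits ++ [true])

theorem lt_two_pow_serialClock (x y : ℕ) : x + y < 2 ^ (serialClock x y).length := by
  rw [← size_le_iff]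
  simpa [serialClock, Nat.size_eq_bits_len, ← add_assoc] using size_add_le x y

/-- A tick shortens the operands, or leaves them at zero, and adds one digit to the result, so the
measure grows by at most 4. The carry bit has bounded size and is left out of the measure. -/
theorem PTime.serial {d c : Bool → Bool → Bool → Bool}
    (hd : PTime fun p : Bool × Bool × Bool => d p.1 p.2.1 p.2.2)
    (hc : PTime fun p : Bool × Bool × Bool => c p.1 p.2.1 p.2.2) {f g : α → ℕ}
    (hf : PTime f) (hg : PTime g) : PTime fun a =>
      (serialClock (f a) (g a)).foldl (fun s _ => serialStep d c s) (false, f a, g a, []) := by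
  refine PTime.foldl (f := fun _ s _ => serialStep d c s) (by unfold serialClock; fun_prop)
    (by fun_prop) ?_
    (fun s => s.2.1.size + s.2.2.1.size + MarkovShap.sz s.2.2.2) (8 * .X + 8) ?_ (by fun_prop)
    (G := fun _ => 4) (.const _) ?_
  · have h1 : PTime fun p : α × (Bool × ℕ × ℕ × List Bool) × Bool =>
        (p.2.1.1, p.2.1.2.1.bodd, p.2.1.2.2.1.bodd) := by fun_prop
    have h2 := hd.comp h1
    have h3 := hc.comp h1
    unfold serialStep
    fun_prop
  · rintro ⟨b, x, y, l⟩
    have := sz_bool_le b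
    have := sz_nat_le x
    have := sz_nat_le y
    simp
    omega
  · rintro a ⟨b, x, y, l⟩ _
    have := size_div2_le x
    have := size_div2_le y
    have := sz_bool_le (d b x.bodd y.bodd)
    simp [serialStep]
    omega

/-- The carry bit of addition. -/
def addCarry (c x y : Bool) : Bool := (x && y) || (c && (x || y))

/-- The borrow bit of subtraction. -/
def subBorrow (c x y : Bool) : Bool := (!x && (c || y)) || (c && y)

/-- The digit of a sum or of a difference. -/
def sumDigit (c x y : Bool) : Bool := Bool.xor c (Bool.xor x y)

theorem bit_eq (n : ℕ) : n = 2 * n.div2 + n.bodd.toNat := by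
  conv_lhs => rw [← Nat.bit_bodd_div2 n, Nat.bit_val]

/-- Invariant: the digits in `acc`, most significant first, still have to be appended to the pending
value `x + y + c`. Surplus ticks only produce leading zeros, which `Nat.bit` absorbs. -/
theorem serial_add (l : List Bool) (c : Bool) (x y : ℕ) (acc : List Bool)
    (h : x + y + c.toNat < 2 ^ l.length) :
    (l.foldl (fun s _ => serialStep sumDigit addCarry s) (c, x, y, acc)).2.2.2.foldl
      (fun n b => Nat.bit b n) 0 = acc.foldl (fun n b => Nat.bit b n) (x + y + c.toNat) := by
  induction l generalizing c x y acc with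
  | nil =>
    have : x + y + c.toNat = 0 := by simpa using h
    rw [this]; rfl
  | cons b l ih =>
    have hx := bit_eq x
    have hy := bit_eq y
    -- The full adder identity, checked on the eight combinations of carry and last digits.
    have hs : x + y + c.toNat = Nat.bit (sumDigit c x.bodd y.bodd)
        (x.div2 + y.div2 + (addCarry c x.bodd y.bodd).toNat) := by
      rw [Nat.bit_val]
      revert hx hy
      generalize x.div2 = x'
      generalize y.div2 = y'
      cases c <;> cases x.bodd <;> cases y.bodd <;> simp [sumDigit, addCarry] <;> omega
    rw [List.foldl_cons, serialStep, ih, hs]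
    · rfl
    · rw [hs, List.length_cons, Nat.bit_lt_two_pow_succ_iff] at h
      exact h

/-- The same invariant as for addition; `hxy` excludes a final borrow and is preserved by every
step. -/
theorem serial_sub (l : List Bool) (c : Bool) (x y : ℕ) (acc : List Bool)
    (h : x < 2 ^ l.length) (hxy : y + c.toNat ≤ x) :
    (l.foldl (fun s _ => serialStep sumDigit subBorrow s) (c, x, y, acc)).2.2.2.foldl
      (fun n b => Nat.bit b n) 0 = acc.foldl (fun n b => Nat.bit b n) (x - (y + c.toNat)) := by
  induction l generalizing c x y acc with
  | nil =>
    have : x - (y + c.toNat) = 0 := by simp at h; omega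
    rw [this]; rfl
  | cons b l ih =>
    have hx := bit_eq x
    have hy := bit_eq y
    have hs : x - (y + c.toNat) = Nat.bit (sumDigit c x.bodd y.bodd)
        (x.div2 - (y.div2 + (subBorrow c x.bodd y.bodd).toNat)) ∧
        y.div2 + (subBorrow c x.bodd y.bodd).toNat ≤ x.div2 := by
      rw [Nat.bit_val]
      revert hx hy hxy
      generalize x.div2 = x'
      generalize y.div2 = y'
      cases c <;> cases x.bodd <;> cases y.bodd <;> simp [sumDigit, subBorrow] <;> omega
    rw [List.foldl_cons, serialStep, ih _ _ _ _ _ hs.2, hs.1]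
    · rfl
    · rw [List.length_cons, pow_succ] at h
      omega

/-- The borrow left after all digits tells whether the subtraction fails, so a comparison is a
by-product of the subtraction. -/
theorem serial_lt (l : List Bool) (c : Bool) (x y : ℕ) (acc : List Bool)
    (h : x + y < 2 ^ l.length) :
    (l.foldl (fun s _ => serialStep sumDigit subBorrow s) (c, x, y, acc)).1 =
      decide (x < y + c.toNat) := by
  induction l generalizing c x y acc with
  | nil =>
    have hx : x = 0 := by simp at h; omega
    have hy : y = 0 := by simp at h; omega
    cases c <;> simp [hx, hy]
  | cons b l ih =>
    have hx := bit_eq x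
    have hy := bit_eq y
    rw [List.length_cons, pow_succ] at h
    rw [List.foldl_cons, serialStep, ih _ _ _ _ (by dsimp only; omega)]
    revert hx hy
    generalize x.div2 = x'
    generalize y.div2 = y'
    cases c <;> cases x.bodd <;> cases y.bodd <;> simp [subBorrow] <;> omega

theorem PTime.foldl_bit {l : α → List Bool} (hl : PTime l) :
    PTime fun a => (l a).foldl (fun n b => Nat.bit b n) 0 :=
  hl.reverse.ofBits.congr fun a => by simp

@[fun_prop]
theorem PTime.add {f g : α → ℕ} (hf : PTime f) (hg : PTime g) : PTime fun a => f a + g a :=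
  (PTime.foldl_bit (PTime.serial (d := sumDigit) (c := addCarry) (by unfold sumDigit; fun_prop)
    (by unfold addCarry; fun_prop) hf hg).snd.snd.snd).congr fun a => by
      rw [serial_add _ _ _ _ _ (by simpa using lt_two_pow_serialClock (f a) (g a))]
      simp

theorem PTime.serialSub {f g : α → ℕ} (hf : PTime f) (hg : PTime g) : PTime fun a =>
    (serialClock (f a) (g a)).foldl (fun s _ => serialStep sumDigit subBorrow s)
      (false, f a, g a, []) :=
  PTime.serial (d := sumDigit) (c := subBorrow) (by unfold sumDigit; fun_prop)
    (by unfold subBorrow; fun_prop) hf hg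

@[fun_prop]
theorem PTime.lt {f g : α → ℕ} (hf : PTime f) (hg : PTime g) : PTime fun a => decide (f a < g a) :=
  (PTime.serialSub hf hg).fst.congr fun a => by
    rw [serial_lt _ _ _ _ _ (lt_two_pow_serialClock (f a) (g a))]
    simp

@[fun_prop]
theorem PTime.sub {f g : α → ℕ} (hf : PTime f) (hg : PTime g) : PTime fun a => f a - g a :=
  ((hf.lt hg).cond (.const 0) (PTime.foldl_bit (PTime.serialSub hf hg).snd.snd.snd)).congr
    fun a => by
      by_cases h : f a < g a
      · simp [h, h.le]
      · have h1 := lt_two_pow_serialClock (f a) (g a)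
        rw [serial_sub _ _ _ _ _ (by omega) (by simpa using h)]
        simp [h]

@[fun_prop]
theorem PTime.natEq {f g : α → ℕ} (hf : PTime f) (hg : PTime g) :
    PTime fun a => decide (f a = g a) :=
  ((hf.lt hg).or (hg.lt hf)).not.congr fun a => by
    rw [Bool.eq_iff_iff]
    simp
    omega

-- Horner's scheme: double the partial product and add `g a` if the current digit is set. The size
-- grows per digit by an amount that depends on `g a` only.
@[fun_prop]
theorem PTime.mul {f g : α → ℕ} (hf : PTime f) (hg : PTime g) : PTime fun a => f a * g a := by
  refine (PTime.foldr (f := fun a b s => Nat.bit false s + bif b then g a else 0) hf.bits (.const 0)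
    ?_ Nat.size (4 * .X + 1)
    (fun s => by simpa using sz_nat_le s) (.const _) (G := fun p => (g p.1).size + 2)
    (by fun_prop) fun a s b => ?_).congr fun a => ?_
  · have : PTime fun p : α × ℕ × Bool => g p.1 := by fun_prop
    fun_prop
  · have h1 := size_bit_le false s
    have h2 := size_add_le (Nat.bit false s) (bif b then g a else 0)
    have h3 : (bif b then g a else 0).size ≤ (g a).size := by cases b <;> simp
    dsimp only
    omega
  · have key : ∀ l : List Bool, l.foldr (fun b s => Nat.bit false s + bif b then g a else 0) 0 =
        l.foldr Nat.bit 0 * g a := by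
      intro l
      induction l with
      | nil => simp
      | cons b l ih =>
        rw [List.foldr_cons, List.foldr_cons, ih, Nat.bit_val, Nat.bit_val]
        cases b <;> simp <;> ring
    rw [key, foldr_bit_bits]

@[fun_prop]
theorem PTime.sum {l : α → List ℕ} (hl : PTime l) : PTime fun a => (l a).sum :=
  (hl.foldl (.const 0) (f := fun _ s b => s + b) (by fun_prop) Nat.size (4 * .X + 1)
    (fun s => by simpa using sz_nat_le s) (.const _) (G := fun p => p.2.size + 1) (by fun_prop)
    fun _ s b => size_add_le s b).congr fun a => by rw [List.sum_eq_foldl]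

@[fun_prop]
theorem PTime.prod {l : α → List ℕ} (hl : PTime l) : PTime fun a => (l a).prod :=
  (hl.foldl (.const 1) (f := fun _ s b => s * b) (by fun_prop) Nat.size (4 * .X + 1)
    (fun s => by simpa using sz_nat_le s) (.const _) (G := fun p => p.2.size) (by fun_prop)
    fun _ s b => size_mul_le s b).congr fun a => by rw [List.prod_eq_foldl]

@[fun_prop]
theorem PTime.length {l : α → List β} (hl : PTime l) : PTime fun a => (l a).length :=
  (hl.map (g := fun _ _ => 1) (.const 1)).sum.congr fun a => by simp

/-- The numbers below the length of a list. -/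
@[fun_prop]
theorem PTime.range {l : α → List β} (hl : PTime l) : PTime fun a => List.range (l a).length := by
  have key : ∀ l : List β, l.foldl (fun (s : List ℕ) _ => s.length :: s) [] =
      (List.range l.length).reverse := by
    intro l
    induction l using List.reverseRecOn with
    | nil => rfl
    | append_singleton l b ih =>
      rw [List.foldl_append, ih]
      simp [List.range_succ]
  -- The number added in a step depends on the state, so the criterion with constant increments does
  -- not apply; all numbers are below the length of the list, which gives the bound `B`.
  refine (PTime.reverse (hl.foldl_of_le (.const []) (f := fun _ (s : List ℕ) _ => s.length :: s)
    (by fun_prop) (B := fun a => MarkovShap.sz (l a) * (4 * MarkovShap.sz (l a) + 2) + 1)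
    (by fun_prop) ?_)).congr fun a => ?_
  · intro a l' hl'
    rw [key, sz_reverse]
    have h1 := hl'.length_le.trans (length_lt_sz (l a)).le
    refine (sz_le_of_forall_le (m := 4 * MarkovShap.sz (l a) + 1) ?_).trans ?_
    · intro k hk
      have h2 := sz_nat_le k
      have h3 := size_le_self k
      rw [List.mem_range] at hk
      omega
    · rw [List.length_range]
      gcongr
  · rw [key, List.reverse_reverse]

-- The index is a binary number, possibly huge, so the list acts as the clock: every tick decrements
-- the index and drops the head, until the index is zero. Neither component ever grows.
@[fun_prop]
theorem PTime.getD {l : α → List β} {k : α → ℕ} {d : α → β} (hl : PTime l) (hk : PTime k)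
    (hd : PTime d) : PTime fun a => (l a).getD (k a) (d a) := by
  have key : ∀ (a : α) (m s : List β), m.length = s.length →
      (m.foldl (fun (s : ℕ × List β) _ => bif decide (s.1 = 0) then s else (s.1 - 1, s.2.tail))
        (k a, s)).2.headD (d a) = s.getD (k a) (d a) := by
    intro a m
    generalize k a = n
    induction m generalizing n with
    | nil => intro s hs; rw [List.eq_nil_of_length_eq_zero hs.symm]; rfl
    | cons x m ih =>
      intro s hs
      rcases s with _ | ⟨b, t⟩
      · simp at hs
      · rcases n with _ | n
        · have h0 : ∀ m : List β, m.foldl (fun (s : ℕ × List β) _ =>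
              bif decide (s.1 = 0) then s else (s.1 - 1, s.2.tail)) (0, b :: t) = (0, b :: t) := by
            intro m
            induction m with
            | nil => rfl
            | cons y m ih' => simpa using ih'
          rw [h0]; rfl
        · simpa using ih n t (by simpa using hs)
  refine (PTime.headD (PTime.snd (PTime.foldl_of_le hl (i := fun a => (k a, l a))
    (f := fun _ (s : ℕ × List β) _ => bif decide (s.1 = 0) then s else (s.1 - 1, s.2.tail))
    (by fun_prop) (by fun_prop)
    (B := fun a => 4 * MarkovShap.sz (k a) + MarkovShap.sz (l a) + 2) (by fun_prop) ?_)) hd).congr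
    fun a => key a _ _ rfl
  intro a l' _
  have h1 : ∀ (m : List β) (s : ℕ × List β),
      (m.foldl (fun (s : ℕ × List β) _ =>
        bif decide (s.1 = 0) then s else (s.1 - 1, s.2.tail)) s).1 ≤ s.1 ∧
      MarkovShap.sz (m.foldl (fun (s : ℕ × List β) _ =>
        bif decide (s.1 = 0) then s else (s.1 - 1, s.2.tail)) s).2 ≤ MarkovShap.sz s.2 := by
    intro m
    induction m with
    | nil => simp
    | cons x m ih =>
      intro s
      have h2 := ih (bif decide (s.1 = 0) then s else (s.1 - 1, s.2.tail))
      have h3 := sz_sublist_le (List.tail_sublist s.2)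
      rw [List.foldl_cons]
      by_cases h : s.1 = 0
      · simpa [h] using h2
      · simp only [h, decide_false, cond_false] at h2 ⊢
        exact ⟨h2.1.trans (Nat.sub_le _ _), h2.2.trans h3⟩
  obtain ⟨h2, h3⟩ := h1 l' (k a, l a)
  rw [sz_prod]
  have h4 := sz_nat_le (l'.foldl (fun (s : ℕ × List β) _ =>
    bif decide (s.1 = 0) then s else (s.1 - 1, s.2.tail)) (k a, l a)).1
  have h5 := Nat.size_le_size h2
  have h6 := size_le_sz (k a)
  simp only at h3 h5
  omega

end MarkovShap

namespace MarkovShap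

open Computability Code

/-! ### Input and output -/

/-- Move the input from `B` to `A`. -/
def Prog.read : Prog := .loop .B (fun o => o != none) fun
  | some x => .push .A x
  | none => .skip

theorem Runs.read (w : List Γ') {d a c : List Γ'} :
    Runs .read (stk d a w c) (2 * w.length + 2) (stk d (w.reverse ++ a) [] c) := by
  induction w generalizing a with
  | nil => exact Runs.halt (o := none) rfl (update_stk_B ..) rfl Runs.skip
  | cons x w ih =>
    have h : Runs .read (stk d a (x :: w) c) _ _ :=
      Runs.step (o := some x) (S₁ := stk d a w c) rfl (update_stk_B ..) rfl
        (Runs.pushA (x := x)) (ih (a := x :: a))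
    rw [List.reverse_cons, List.append_assoc]
    exact h.mono (by simp; omega)

/-- Represent the symbols on `A` as a list of trees on `D`. -/
def Prog.parse : Prog := .loop .A (fun o => o != none) fun
  | some x => .seq (.pushTree (code x)) (.push .D (.bit true))
  | none => .skip

theorem sz_symbol_le (x : Γ') : sz x ≤ 11 := by
  have h : ∀ t : Bool × Bool × Bool, sz t ≤ 11 := by
    rintro ⟨a, b, c⟩
    have := sz_bool_le a
    have := sz_bool_le b
    have := sz_bool_le c
    simp
    omega
  exact h (symTriple x)

theorem Runs.parse (w v : List Γ') {d b c : List Γ'} :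
    Runs .parse (stk ((code v).toks ++ d) w b c) (13 * w.length + 2)
      (stk ((code (w.reverse ++ v)).toks ++ d) [] b c) := by
  induction w generalizing v with
  | nil => exact Runs.halt (o := none) rfl (update_stk_A ..) rfl Runs.skip
  | cons x w ih =>
    have h1 := sz_symbol_le x
    have h2 : Runs _ _ _ _ := Runs.seq (Runs.pushTree (code x) (d := (code v).toks ++ d) (a := w)
      (b := b) (c := c)) (Runs.pushD (x := .bit true))
    have h3 := ih (x :: v)
    simp only [code, codeList, Tr.toks, List.append_assoc, List.cons_append] at h2 h3
    have h : Runs .parse (stk ((code v).toks ++ d) (x :: w) b c) _ _ :=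
      Runs.step (o := some x) (S₁ := stk ((code v).toks ++ d) w b c) rfl (update_stk_A ..) rfl h2 h3
    rw [List.reverse_cons, List.append_assoc]
    refine h.mono ?_
    change sz x + 1 + _ + 1 ≤ _
    simp
    omega

/-- Output the symbol whose representation is on `D`. -/
def Prog.emit : Prog :=
  .pop .D fun _ => .pop .D fun
    -- The four skipped tokens are the two leaves of the code of `true`, the token of the inner pair
    -- and the bracket flag; then comes the value of the bit.
    | some (.bit true) => .pop .D fun _ => .pop .D fun _ => .pop .D fun _ => .pop .D fun _ =>
      .pop .D fun
        | some (.bit true) => .pop .D fun _ => .pop .D fun _ => .push .B (.bit true)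
        | _ => .push .B (.bit false)
    | _ => .pop .D fun _ => .pop .D fun _ => .pop .D fun _ => .push .B .comma

theorem Runs.emit {x : Γ'} (hx : x = .comma ∨ ∃ v, x = .bit v) {d a b c : List Γ'} :
    Runs .emit (stk ((code x).toks ++ d) a b c) 10 (stk d a (x :: b) c) := by
  rcases hx with rfl | ⟨v, rfl⟩
  · exact (Runs.popD (Runs.popD (Runs.popD (Runs.popD (Runs.popD Runs.pushB))))).mono (by omega)
  · cases v
    · exact (Runs.popD (Runs.popD (Runs.popD (Runs.popD (Runs.popD (Runs.popD (Runs.popD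
        Runs.pushB))))))).mono (by omega)
    · exact (Runs.popD (Runs.popD (Runs.popD (Runs.popD (Runs.popD (Runs.popD (Runs.popD
        (Runs.popD (Runs.popD Runs.pushB))))))))).mono (by omega)

/-- Output the list of symbols whose representation is on `D`, in reverse order. -/
def Prog.write : Prog := .loop .D (fun o => o == some (.bit true)) fun
  | some (.bit true) => .emit
  | _ => .skip

theorem Runs.write (w : List Γ') (hw : ∀ x ∈ w, x = .comma ∨ ∃ v, x = .bit v) {d a b c : List Γ'} :
    Runs .write (stk ((code w).toks ++ d) a b c) (11 * w.length + 2)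
      (stk d a (w.reverse ++ b) c) := by
  induction w generalizing b with
  | nil => exact Runs.halt (o := some (.bit false)) rfl (update_stk_D ..) rfl Runs.skip
  | cons x w ih =>
    have h2 := Runs.emit (hw x (by simp)) (d := (codeList w).toks ++ d) (a := a) (b := b) (c := c)
    have h3 := ih (fun y hy => hw y (by simp [hy])) (b := x :: b)
    have h : Runs .write (stk ((code (x :: w)).toks ++ d) a b c) _ _ :=
      Runs.step (o := some (.bit true)) (S₁ := stk ((code x).toks ++ ((codeList w).toks ++ d)) a b c)
        rfl (by simp [code, codeList, Tr.toks]) rfl h2 h3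
    rw [List.reverse_cons, List.append_assoc]
    exact h.mono (by simp; omega)

theorem sz_symbols_le (w : List Γ') : sz w ≤ 12 * w.length + 1 := by
  have := sz_le_of_forall_le (l := w) (m := 11) fun x _ => sz_symbol_le x
  omega

/-- A polynomial time function on words yields a polynomial time Turing machine. -/
theorem PTime.computable {f : List Γ' → List Γ'} (hf : PTime f) {α β : Type} {ea : α → List Γ'}
    {eb : β → List Γ'} {g : α → β} (h : ∀ a, f (ea a) = (eb (g a)).reverse)
    (hb : ∀ b, ∀ x ∈ eb b, x = .comma ∨ ∃ v, x = .bit v) :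
    Nonempty (Turing.TM2ComputableInPolyTime ea eb g) := by
  have hl : PolyBd fun w : List Γ' => (f w).length :=
    hf.sz.mono fun w => (length_lt_sz (f w)).le
  obtain ⟨q', hq'⟩ := hl
  obtain ⟨p, T, ⟨q, hq⟩, hp⟩ := hf
  -- The pushed token is the empty list, onto which `parse` puts the symbols. Reading reverses the
  -- input and parsing restores its order; writing reverses once more, whence the reversal in `h`.
  refine Prog.computable (.seq .read (.seq (.push .D (.bit false)) (.seq .parse (.seq p .write))))
    ((2 * .X + 2) + (1 + ((13 * .X + 2) + (q.comp (12 * .X + 1) +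
      (11 * q'.comp (12 * .X + 1) + 2))))) fun a => ?_
  have hs := sz_symbols_le (ea a)
  have h1 : Runs .read (stk [] [] (ea a) []) _ _ := Runs.read (ea a)
  have h2 := Runs.parse (ea a).reverse [] (d := []) (b := []) (c := [])
  have h3 := (hp (ea a) [] [] [] []).mono ((hq _).trans (polyEval_mono q hs))
  have h4 := Runs.write (f (ea a)) (fun x hx => hb (g a) x (by simpa [h] using hx)) (d := [])
    (a := []) (b := []) (c := [])
  have h5 : (f (ea a)).length ≤ q'.eval (12 * (ea a).length + 1) :=
    (hq' _).trans (polyEval_mono q' hs)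
  simp only [List.reverse_reverse, List.append_nil] at h1 h2 h3 h4
  rw [h, List.reverse_reverse] at h4
  rw [h] at h3
  have := h1.seq (Runs.seq Runs.pushD (h2.seq (h3.seq h4)))
  refine this.mono ?_
  simp only [h] at h5
  simp [Polynomial.eval_comp] at h5 ⊢
  omega

end MarkovShap

/-! ### The score as a recursion along the chain. -/

namespace MarkovShap

/-! ### Sums over coalitions along a Markov chain -/

/-- One position of a chain: transition matrix, value to explain, factor of the function, and
whether the position is free, or forced into or out of the coalitions. -/
structure Layer where
  mat : Bool → Bool → ℚ
  x : Bool
  g : Bool → ℚ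
  tag : Option Bool

/-- Unit vectors. -/
def unitVec (x : Bool) : Bool → ℚ := fun b => if b = x then 1 else 0

/-- A row vector times a matrix. -/
def vecMat (u : Bool → ℚ) (M : Bool → Bool → ℚ) : Bool → ℚ :=
  fun b => u false * M false b + u true * M true b

/-- The weight of the trajectory `X` that starts at `a`. -/
def chainWeight : {n : ℕ} → (Fin n → Bool → Bool → ℚ) → (Fin n → Bool → ℚ) → Bool →
    (Fin n → Bool) → ℚ
  | 0, _, _, _, _ => 1
  | _ + 1, M, g, a, X => M 0 a (X 0) * g 0 (X 0) *
      chainWeight (fun j => M j.succ) (fun j => g j.succ) (X 0) (fun j => X j.succ)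

/-- The total weight of the trajectories that agree with `x` at the positions marked by `s`. -/
def chainSum {n : ℕ} (M : Fin n → Bool → Bool → ℚ) (g : Fin n → Bool → ℚ) (x s : Fin n → Bool)
    (a : Bool) : ℚ :=
  ∑ X : Fin n → Bool, if ∀ j, s j = true → X j = x j then chainWeight M g a X else 0

theorem sum_fin_succ {M : Type*} [AddCommMonoid M] {n : ℕ} (f : (Fin (n + 1) → Bool) → M) :
    ∑ X, f X = ∑ b, ∑ X, f (Fin.cons b X) := by
  rw [← Fintype.sum_prod_type' (f := fun b X => f (Fin.cons b X))]
  exact (Fintype.sum_equiv (Fin.consEquiv fun _ => Bool) _ _ fun _ => rfl).symm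

theorem chainSum_succ {n : ℕ} (M : Fin (n + 1) → Bool → Bool → ℚ) (g : Fin (n + 1) → Bool → ℚ)
    (x s : Fin (n + 1) → Bool) (a : Bool) :
    chainSum M g x s a = ∑ b, if s 0 = true → b = x 0 then M 0 a b * g 0 b *
      chainSum (fun j => M j.succ) (fun j => g j.succ) (fun j => x j.succ) (fun j => s j.succ) b
      else 0 := by
  rw [chainSum, sum_fin_succ]
  refine Finset.sum_congr rfl fun b _ => ?_
  split_ifs with h
  · rw [chainSum, Finset.mul_sum]
    refine Finset.sum_congr rfl fun X _ => ?_
    rw [mul_ite, mul_zero]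
    refine if_congr ?_ rfl rfl
    simpa [Fin.forall_fin_succ] using fun _ => h
  · refine Finset.sum_eq_zero fun X _ => if_neg fun h' => h ?_
    simpa using h' 0

/-- The total weight for a given start vector. -/
def chainSumVec {n : ℕ} (M : Fin n → Bool → Bool → ℚ) (g : Fin n → Bool → ℚ) (x s : Fin n → Bool)
    (u : Bool → ℚ) : ℚ :=
  u false * chainSum M g x s false + u true * chainSum M g x s true

/-- The Markov property: a position in the coalition collapses the vector to a multiple of a unit
vector, so a scalar splits off and the past is forgotten. At any other position the vector is just
propagated. -/
theorem chainSumVec_succ {n : ℕ} (M : Fin (n + 1) → Bool → Bool → ℚ) (g : Fin (n + 1) → Bool → ℚ)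
    (x s : Fin (n + 1) → Bool) (u : Bool → ℚ) :
    chainSumVec M g x s u = if s 0 = true then
      (vecMat u (M 0) (x 0) * g 0 (x 0)) * chainSumVec (fun j => M j.succ) (fun j => g j.succ)
        (fun j => x j.succ) (fun j => s j.succ) (unitVec (x 0))
      else chainSumVec (fun j => M j.succ) (fun j => g j.succ) (fun j => x j.succ)
        (fun j => s j.succ) (fun b => vecMat u (M 0) b * g 0 b) := by
  rw [chainSumVec, chainSum_succ, chainSum_succ]
  cases s 0 <;> cases x 0 <;> simp [chainSumVec, vecMat, unitVec] <;> ring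

theorem chainSumVec_zero {n : ℕ} (M : Fin n → Bool → Bool → ℚ) (g : Fin n → Bool → ℚ)
    (x s : Fin n → Bool) : chainSumVec M g x s (fun _ => 0) = 0 := by
  simp [chainSumVec]

/-- Weighted sum over coalitions of conditional expectations, by recursion along the chain. -/
def pathSum (w : ℕ → ℚ) : List Layer → (Bool → ℚ) → (Bool → ℚ) → ℕ → ℚ
  | [], u, d, k => (u false + u true) / (d false + d true) * w k
  | ℓ :: L, u, d, k =>
    pathSum w L (fun b => if ℓ.tag = some true then 0 else vecMat u ℓ.mat b * ℓ.g b)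
      (vecMat d ℓ.mat) k +
    vecMat u ℓ.mat ℓ.x * ℓ.g ℓ.x / vecMat d ℓ.mat ℓ.x *
      (if ℓ.tag = none then pathSum w L (unitVec ℓ.x) (unitVec ℓ.x) (k + 1)
       else if ℓ.tag = some true then pathSum w L (unitVec ℓ.x) (unitVec ℓ.x) k else 0)

/-- The coalitions compatible with the tags. -/
def Compatible {n : ℕ} (τ : Fin n → Option Bool) (s : Fin n → Bool) : Prop :=
  ∀ j, τ j = none ∨ τ j = some (s j)

instance {n : ℕ} (τ : Fin n → Option Bool) (s : Fin n → Bool) : Decidable (Compatible τ s) :=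
  inferInstanceAs (Decidable (∀ _, _))

/-- The number of free positions in a coalition. -/
def freeCount {n : ℕ} (τ : Fin n → Option Bool) (s : Fin n → Bool) : ℕ :=
  ∑ j, if τ j = none ∧ s j = true then 1 else 0

theorem compatible_cons {n : ℕ} (τ : Fin (n + 1) → Option Bool) (b : Bool) (s : Fin n → Bool) :
    Compatible τ (Fin.cons b s) ↔
      (τ 0 = none ∨ τ 0 = some b) ∧ Compatible (fun j => τ j.succ) s := by
  simp [Compatible, Fin.forall_fin_succ]

theorem freeCount_cons {n : ℕ} (τ : Fin (n + 1) → Option Bool) (b : Bool) (s : Fin n → Bool) :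
    freeCount τ (Fin.cons b s) =
      (if τ 0 = none ∧ b = true then 1 else 0) + freeCount (fun j => τ j.succ) s := by
  rw [freeCount, Fin.sum_univ_succ]
  rfl

/-- The coalitions are split by whether they contain the first position. If they do, the scalars
split off by `chainSumVec_succ` form the quotient in `pathSum`. No denominator has to be nonzero,
since `mul_div_mul_comm` also holds with division by zero. -/
theorem pathSum_ofFn (w : ℕ → ℚ) {n : ℕ} (ℓ : Fin n → Layer) (u d : Bool → ℚ) (k : ℕ) :
    pathSum w (List.ofFn ℓ) u d k = ∑ s : Fin n → Bool, if Compatible (fun j => (ℓ j).tag) s then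
      w (k + freeCount (fun j => (ℓ j).tag) s) *
        (chainSumVec (fun j => (ℓ j).mat) (fun j => (ℓ j).g) (fun j => (ℓ j).x) s u /
          chainSumVec (fun j => (ℓ j).mat) (fun _ _ => 1) (fun j => (ℓ j).x) s d) else 0 := by
  induction n generalizing u d k with
  | zero =>
    simp [pathSum, Compatible, freeCount, chainSumVec, chainSum, chainWeight, mul_comm]
  | succ n ih =>
    rw [sum_fin_succ, Fintype.sum_bool, List.ofFn_succ, pathSum]
    simp only [compatible_cons, freeCount_cons, chainSumVec_succ, Fin.cons_zero, Fin.cons_succ]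
    rcases htag : (ℓ 0).tag with _ | _ | _
    · simp [ih, add_comm, Finset.mul_sum, mul_div_mul_comm, mul_left_comm]
      exact Finset.sum_congr rfl fun s _ => by rw [add_assoc]
    · simp [ih]
    -- A forced member: the branch that leaves it out runs with the zero vector as numerator and
    -- vanishes.
    · simp [ih, chainSumVec_zero, Finset.mul_sum, mul_div_mul_comm, mul_left_comm]

/-- A common factor of both vectors and all the matrices cancels. -/
theorem pathSum_scale (w : ℕ → ℚ) {n : ℕ} (ℓ ℓ' : Fin n → Layer) (c : Fin n → ℚ)
    (hc : ∀ j, c j ≠ 0) (hM : ∀ j a b, (ℓ' j).mat a b = c j * (ℓ j).mat a b)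
    (hx : ∀ j, (ℓ' j).x = (ℓ j).x) (hg : ∀ j, (ℓ' j).g = (ℓ j).g)
    (ht : ∀ j, (ℓ' j).tag = (ℓ j).tag) (u d : Bool → ℚ) (e : ℚ) (he : e ≠ 0) (k : ℕ) :
    pathSum w (List.ofFn ℓ') (fun b => e * u b) (fun b => e * d b) k =
      pathSum w (List.ofFn ℓ) u d k := by
  induction n generalizing u d e k with
  | zero => simp [pathSum, ← mul_add, mul_div_mul_left _ _ he]
  | succ n ih =>
    have h1 : ∀ v : Bool → ℚ, vecMat (fun b => e * v b) (ℓ' 0).mat =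
        fun b => (e * c 0) * vecMat v (ℓ 0).mat b := by
      intro v
      funext b
      simp only [vecMat, hM]
      ring
    have he' : e * c 0 ≠ 0 := mul_ne_zero he (hc 0)
    have h2 := fun u d e he k => ih (fun j => ℓ j.succ) (fun j => ℓ' j.succ) (fun j => c j.succ)
      (fun j => hc j.succ) (fun j => hM j.succ) (fun j => hx j.succ) (fun j => hg j.succ)
      (fun j => ht j.succ) u d e he k
    have h3 := fun u d k => h2 u d 1 one_ne_zero k
    have h4 : (fun b => if (ℓ 0).tag = some true then 0 else
        e * c 0 * vecMat u (ℓ 0).mat b * (ℓ 0).g b) = fun b => (e * c 0) *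
          if (ℓ 0).tag = some true then 0 else vecMat u (ℓ 0).mat b * (ℓ 0).g b := by
      funext b
      split_ifs <;> ring
    simp only [one_mul] at h3
    rw [List.ofFn_succ, List.ofFn_succ, pathSum, pathSum]
    simp only [h1, h3, hx, hg, ht, h4]
    -- The quotient loses `e * c 0` directly. In the first summand, `h3` has already replaced the
    -- layers under the scaled vectors; it is undone there so that `h2` can remove the factor.
    rw [mul_assoc, mul_div_mul_left _ _ he', ← h3 (fun b => e * c 0 * _), h2 _ _ _ he']

/-! ### Values of coalitions -/

theorem chainWeight_eq_mul_prod {n : ℕ} (M : Fin n → Bool → Bool → ℚ) (g : Fin n → Bool → ℚ)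
    (a : Bool) (X : Fin n → Bool) :
    chainWeight M g a X = chainWeight M (fun _ _ => 1) a X * ∏ j, g j (X j) := by
  induction n generalizing a with
  | zero => simp [chainWeight]
  | succ n ih =>
    rw [chainWeight, chainWeight, ih, Fin.prod_univ_succ]
    ring

theorem prod_trans_eq_chainWeight {n : ℕ} (M : Fin n → Bool → Bool → ℚ) (X : Fin (n + 1) → Bool) :
    ∏ k : Fin n, M k (X k.castSucc) (X k.succ) =
      chainWeight M (fun _ _ => 1) (X 0) (fun j => X j.succ) := by
  induction n with
  | zero => simp [chainWeight]
  | succ n ih =>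
    rw [Fin.prod_univ_succ, chainWeight, mul_one]
    exact congrArg _ (ih (fun j => M j.succ) (fun j => X j.succ))

/-- The initial distribution followed by the transition matrices. -/
def MarkovChain.mats {n : ℕ} (P : MarkovChain n) : Fin (n + 1) → Bool → Bool → ℚ :=
  Fin.cons (fun _ b => (P.init b).val) fun k a b => (P.trans k a b).val

/-- The first matrix has equal rows, so the fictitious start state `a` is irrelevant. -/
theorem MarkovChain.prob_eq {n : ℕ} (P : MarkovChain n) (a : Bool) (X : Fin (n + 1) → Bool) :
    P.prob X = chainWeight P.mats (fun _ _ => 1) a X := by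
  rw [prob, chainWeight, mul_one]
  exact congrArg _ (prod_trans_eq_chainWeight (fun k a b => (P.trans k a b).val) X)

theorem value_prod {n : ℕ} (P : MarkovChain n) (g : Fin (n + 1) → Bool → ℚ)
    (x : Fin (n + 1) → Bool) (S : Finset (Fin (n + 1))) :
    value (fun X => ∏ j, g j (X j)) x P.prob S =
      chainSumVec P.mats g x (fun j => decide (j ∈ S)) (unitVec false) /
        chainSumVec P.mats (fun _ _ => 1) x (fun j => decide (j ∈ S)) (unitVec false) := by
  simp [value, chainSumVec, unitVec, chainSum, Finset.sum_filter, P.prob_eq false,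
    chainWeight_eq_mul_prod P.mats g]

theorem value_sum {N : ℕ} {ι : Type*} (l : List ι) (f : ι → (Fin N → Bool) → ℚ) (x : Fin N → Bool)
    (P : (Fin N → Bool) → ℚ) (S : Finset (Fin N)) :
    value (fun X => (l.map fun c => f c X).sum) x P S =
      (l.map fun c => value (f c) x P S).sum := by
  induction l with
  | nil => simp [value]
  | cons c l ih =>
    rw [List.map_cons, List.sum_cons, ← ih]
    simp [value, mul_add, Finset.sum_add_distrib, add_div]

/-- The Shapley-like sum with weights `w` of the sizes of coalitions. -/
def weightedSum {N : ℕ} (w : ℕ → ℚ) (i : Fin N) (v : Finset (Fin N) → ℚ) : ℚ :=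
  ∑ S : Finset (Fin N) with i ∉ S, w S.card * (v (insert i S) - v S)

/-- Indicator vectors with value `b` at `i` correspond to coalitions `S` without `i`. As `i` is not
a free position, the count is `S.card` for both values of `b`; hence both terms of the marginal
contribution of `i` get the same weight. -/
theorem sum_compatible {N : ℕ} (i : Fin N) (b : Bool) (F : ℕ → (Fin N → Bool) → ℚ) :
    (∑ s : Fin N → Bool, if Compatible (Function.update (fun _ => none) i (some b)) s then
      F (freeCount (Function.update (fun _ => none) i (some b)) s) s else 0) =
    ∑ S : Finset (Fin N) with i ∉ S,
      F S.card (fun j => decide (j ∈ if b then insert i S else S)) := by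
  have hc : ∀ s : Fin N → Bool, Compatible (Function.update (fun _ => none) i (some b)) s ↔
      s i = b := by
    intro s
    constructor
    · intro h
      simpa [eq_comm] using h i
    · intro h j
      by_cases hj : j = i
      · subst hj; simp [h]
      · simp [hj]
  rw [← Finset.sum_filter]
  refine Finset.sum_bij' (fun s _ => Finset.univ.filter fun j => s j = true ∧ j ≠ i)
    (fun S _ => fun j => decide (j ∈ if b then insert i S else S)) ?_ ?_ ?_ ?_ ?_
  · intro s _
    simp
  · intro S hS
    have : i ∉ S := by simpa using hS
    simp only [Finset.mem_filter, Finset.mem_univ, true_and, hc]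
    cases b <;> simp [this]
  · intro s hs
    have h : s i = b := by simpa [hc] using hs
    funext j
    by_cases hj : j = i
    · subst hj
      cases b <;> simp [h]
    · cases b <;> simp [hj]
  · intro S hS
    have : i ∉ S := by simpa using hS
    ext j
    by_cases hj : j = i
    · subst hj; simp [this]
    · cases b <;> simp [hj]
  · intro s hs
    have h : s i = b := by simpa [hc] using hs
    congr 1
    · rw [freeCount, Finset.card_filter]
      refine Finset.sum_congr rfl fun j _ => if_congr ?_ rfl rfl
      by_cases hj : j = i
      · subst hj; simp
      · simp [hj]
    · funext j
      by_cases hj : j = i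
      · subst hj
        cases b <;> simp [h]
      · cases b <;> simp [hj]

/-- The layers for feature `i`, with `i` forced into (`b = true`) or out of the coalitions. -/
def MarkovChain.layers {n : ℕ} (P : MarkovChain n) (x : Fin (n + 1) → Bool)
    (g : Fin (n + 1) → Bool → ℚ) (i : Fin (n + 1)) (b : Bool) (j : Fin (n + 1)) : Layer :=
  ⟨P.mats j, x j, g j, Function.update (fun _ => none) i (some b) j⟩

theorem weightedSum_value_prod {n : ℕ} (w : ℕ → ℚ) (P : MarkovChain n) (g : Fin (n + 1) → Bool → ℚ)
    (x : Fin (n + 1) → Bool) (i : Fin (n + 1)) :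
    weightedSum w i (value (fun X => ∏ j, g j (X j)) x P.prob) =
      pathSum w (List.ofFn (P.layers x g i true)) (unitVec false) (unitVec false) 0 -
      pathSum w (List.ofFn (P.layers x g i false)) (unitVec false) (unitVec false) 0 := by
  have h := fun b => sum_compatible i b fun k s => w k *
    (chainSumVec P.mats g x s (unitVec false) /
      chainSumVec P.mats (fun _ _ => 1) x s (unitVec false))
  rw [pathSum_ofFn, pathSum_ofFn]
  simp only [zero_add]
  refine Eq.trans ?_ (congrArg₂ (· - ·) (h true).symm (h false).symm)
  rw [weightedSum, ← Finset.sum_sub_distrib]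
  refine Finset.sum_congr rfl fun S _ => ?_
  rw [value_prod, value_prod, mul_sub]
  simp

/-- The weights of the SHAP score, multiplied by `N!`. -/
def shapWeight (N : ℕ) (alt : Bool) (k : ℕ) : ℕ :=
  if alt then if k + 1 < N then (k + 1).factorial * (N - (k + 1) - 1).factorial else 0
  else if k < N then k.factorial * (N - k - 1).factorial else 0

theorem shap_eq_weightedSum {N : ℕ} (f : (Fin N → Bool) → ℚ) (x : Fin N → Bool) (i : Fin N)
    (P : (Fin N → Bool) → ℚ) : shap f x i P =
      weightedSum (fun k => (N.factorial : ℚ)⁻¹ * shapWeight N false k) i (value f x P) := by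
  refine Finset.sum_congr rfl fun S hS => ?_
  have h : S.card < N := by
    simpa using Finset.card_lt_univ_of_notMem (by simpa using hS : i ∉ S)
  simp only [shapWeight, h, if_true, Bool.false_eq_true, if_false]
  rw [div_eq_inv_mul]

/-- A coalition without `i` contributes zero. The others are `insert i S` with `i ∉ S`, so the
weight is taken at `S.card + 1`; the excluded set of all features is the case `S.card + 1 = N`. -/
theorem shapAlt_eq_weightedSum {N : ℕ} (f : (Fin N → Bool) → ℚ) (x : Fin N → Bool) (i : Fin N)
    (P : (Fin N → Bool) → ℚ) : shapAlt f x i P =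
      weightedSum (fun k => (N.factorial : ℚ)⁻¹ * shapWeight N true k) i (value f x P) := by
  have h1 : shapAlt f x i P = ∑ S : Finset (Fin N) with S ≠ Finset.univ ∧ i ∈ S,
      ((S.card.factorial * (N - S.card - 1).factorial : ℕ) : ℚ) / (N.factorial : ℚ) *
        (value f x P S - value f x P (S.erase i)) := by
    rw [shapAlt, ← Finset.filter_filter]
    symm
    refine Finset.sum_filter_of_ne fun S _ h => ?_
    by_contra hi
    simp [Finset.erase_eq_of_notMem hi] at h
  have h2 : weightedSum (fun k => (N.factorial : ℚ)⁻¹ * shapWeight N true k) i (value f x P) =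
      ∑ S : Finset (Fin N) with i ∉ S ∧ S.card + 1 < N,
        (N.factorial : ℚ)⁻¹ * shapWeight N true S.card *
          (value f x P (insert i S) - value f x P S) := by
    rw [weightedSum, ← Finset.filter_filter]
    symm
    refine Finset.sum_filter_of_ne fun S _ h => ?_
    by_contra hi
    simp [shapWeight, hi] at h
  rw [h1, h2]
  refine Finset.sum_bij' (fun S _ => S.erase i) (fun S _ => insert i S) ?_ ?_ ?_ ?_ ?_
  · intro S hS
    simp only [Finset.mem_filter, Finset.mem_univ, true_and] at hS ⊢
    refine ⟨Finset.notMem_erase _ _, ?_⟩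
    rw [Finset.card_erase_add_one hS.2]
    simpa using (Finset.card_lt_iff_ne_univ S).2 hS.1
  · intro S hS
    simp only [Finset.mem_filter, Finset.mem_univ, true_and] at hS ⊢
    refine ⟨?_, Finset.mem_insert_self _ _⟩
    rw [← Finset.card_lt_iff_ne_univ, Finset.card_insert_of_notMem hS.1]
    simpa using hS.2
  · intro S hS
    exact Finset.insert_erase (Finset.mem_filter.1 hS).2.2
  · intro S hS
    exact Finset.erase_insert (Finset.mem_filter.1 hS).2.1
  · intro S hS
    simp only [Finset.mem_filter, Finset.mem_univ, true_and] at hS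
    have h3 := Finset.card_erase_add_one hS.2
    have h4 : S.card < N := by simpa using (Finset.card_lt_iff_ne_univ S).2 hS.1
    rw [Finset.insert_erase hS.2]
    simp only [shapWeight, h3, h4, if_true]
    rw [div_eq_inv_mul]

/-! ### Decision trees as sums of products -/

/-- Restrict the factors of a product by the answer `b` to the query of `v`. -/
def restrict {N : ℕ} (g : Fin N → Bool → Bool) (v : Fin N) (b : Bool) : Fin N → Bool → Bool :=
  fun j c => if j = v then g j c && (c == b) else g j c

/-- For every leaf with output `true`, the indicator functions of the constraints on the path. -/
def DecisionTree.cubes {N : ℕ} : DecisionTree N → (Fin N → Bool → Bool) → List (Fin N → Bool → Bool)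
  | .leaf b, g => if b then [g] else []
  | .node v lo hi, g => lo.cubes (restrict g v false) ++ hi.cubes (restrict g v true)

/-- The product of the factors. -/
def cubeProd {N : ℕ} (g : Fin N → Bool → Bool) (X : Fin N → Bool) : ℚ :=
  ∏ j, if g j (X j) then 1 else 0

theorem cubeProd_restrict {N : ℕ} (g : Fin N → Bool → Bool) (v : Fin N) (b : Bool)
    (X : Fin N → Bool) :
    cubeProd (restrict g v b) X = if X v = b then cubeProd g X else 0 := by
  split_ifs with h
  · refine Finset.prod_congr rfl fun j _ => ?_
    by_cases hj : j = v
    · subst hj; simp [restrict, h]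
    · simp [restrict, hj]
  · exact Finset.prod_eq_zero (Finset.mem_univ v) (by simp [restrict, h])

/-- Every input follows exactly one path. A path with contradictory answers is harmless, since one
of its factors is identically zero. -/
theorem DecisionTree.sum_cubes {N : ℕ} (T : DecisionTree N) (g : Fin N → Bool → Bool)
    (X : Fin N → Bool) :
    ((T.cubes g).map fun c => cubeProd c X).sum = T.toFun X * cubeProd g X := by
  induction T generalizing g with
  | leaf b => cases b <;> simp [cubes, toFun, eval]
  | node v lo hi ihl ihh =>
    rw [cubes, List.map_append, List.sum_append, ihl, ihh, cubeProd_restrict, cubeProd_restrict]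
    cases h : X v <;> simp [toFun, eval, h]

theorem DecisionTree.toFun_eq {N : ℕ} (T : DecisionTree N) :
    T.toFun = fun X => ((T.cubes fun _ _ => true).map fun c => cubeProd c X).sum := by
  funext X
  rw [T.sum_cubes]
  simp [cubeProd]

theorem weightedSum_sum {N : ℕ} {ι : Type*} (l : List ι) (w : ℕ → ℚ) (i : Fin N)
    (v : ι → Finset (Fin N) → ℚ) : weightedSum w i (fun S => (l.map fun c => v c S).sum) =
      (l.map fun c => weightedSum w i (v c)).sum := by
  induction l with
  | nil => simp [weightedSum]
  | cons c l ih =>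
    rw [List.map_cons, List.sum_cons, ← ih]
    simp only [weightedSum, List.map_cons, List.sum_cons, ← Finset.sum_add_distrib]
    exact Finset.sum_congr rfl fun S _ => by ring

/-- The factors of a product as functions with rational values. -/
def cubeFactor {N : ℕ} (g : Fin N → Bool → Bool) (j : Fin N) (b : Bool) : ℚ :=
  if g j b then 1 else 0

/-- Shapley-like sums for decision trees, by recursion along the chain for every leaf. -/
theorem weightedSum_tree {n : ℕ} (w : ℕ → ℚ) (P : MarkovChain n) (T : DecisionTree (n + 1))
    (x : Fin (n + 1) → Bool) (i : Fin (n + 1)) :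
    weightedSum w i (value T.toFun x P.prob) =
      ((T.cubes fun _ _ => true).map fun c => pathSum w
        (List.ofFn (P.layers x (cubeFactor c) i true)) (unitVec false) (unitVec false) 0).sum -
      ((T.cubes fun _ _ => true).map fun c => pathSum w
        (List.ofFn (P.layers x (cubeFactor c) i false)) (unitVec false) (unitVec false) 0).sum := by
  have h : value T.toFun x P.prob = fun S =>
      ((T.cubes fun _ _ => true).map fun c => value (cubeProd c) x P.prob S).sum := by
    funext S
    rw [T.toFun_eq, value_sum]
  have h' := fun c => weightedSum_value_prod w P (cubeFactor c) x i
  rw [h, weightedSum_sum]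
  induction T.cubes fun _ _ => true with
  | nil => simp
  | cons c l ih =>
    simp only [List.map_cons, List.sum_cons, ih]
    rw [show cubeProd c = fun X => ∏ j, cubeFactor c j (X j) from rfl, h']
    ring

end MarkovShap

/-! ### Exact evaluation of the recursion in natural numbers. -/

namespace MarkovShap

/-! ### The algorithm: dynamic programming with a common denominator -/

/-- A layer with natural number entries: the matrix, row by row, the value to explain, the factors,
and the tag (free, otherwise forced into the coalitions). -/
abbrev NatLayer : Type := (ℕ × ℕ × ℕ × ℕ) × Bool × (Bool × Bool) × (Bool × Bool)

/-- A component of a pair. -/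
def select {α : Type} (x : Bool) (v : α × α) : α := bif x then v.2 else v.1

/-- A row vector times a matrix. -/
def rowMul (v : ℕ × ℕ) (m : ℕ × ℕ × ℕ × ℕ) : ℕ × ℕ :=
  (v.1 * m.1 + v.2 * m.2.2.1, v.1 * m.2.1 + v.2 * m.2.2.2)

/-- Multiply the entries of a vector by factors in `{0, 1}`. -/
def mask (g : Bool × Bool) (v : ℕ × ℕ) : ℕ × ℕ := (bif g.1 then v.1 else 0, bif g.2 then v.2 else 0)

/-- The entry of the table of a layer that is used for count `k`. -/
def lookup (t : Bool × Bool) (y : List ℕ) (k : ℕ) : ℕ :=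
  bif t.1 then y.getD (k + 1) 0 else bif t.2 then y.getD k 0 else 0

/-- The state of a scan: numerator vector, denominator vector, product of the denominators,
accumulated table. -/
abbrev ScanState : Type := (ℕ × ℕ) × (ℕ × ℕ) × ℕ × List ℕ

/-- One step of a scan. -/
def scanStep (ks : List ℕ) (s : ScanState) (e : NatLayer × List ℕ) : ScanState :=
  (mask (e.1.2.2.2.1 || !e.1.2.2.2.2, e.1.2.2.2.1 || !e.1.2.2.2.2)
      (mask e.1.2.2.1 (rowMul s.1 e.1.1)),
    rowMul s.2.1 e.1.1,
    s.2.2.1 * select e.1.2.1 (rowMul s.2.1 e.1.1),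
    ks.map fun k => s.2.2.2.getD k 0 * select e.1.2.1 (rowMul s.2.1 e.1.1) +
      select e.1.2.1 (mask e.1.2.2.1 (rowMul s.1 e.1.1)) * s.2.2.1 * lookup e.1.2.2.2 e.2 k)

/-- Scan the layers behind a position with value `x`. -/
def scan (ks : List ℕ) (x : Bool) (st : List (NatLayer × List ℕ)) : ScanState :=
  st.foldl (scanStep ks) (mask (!x, x) (1, 1), mask (!x, x) (1, 1), 1, [])

/-- The layer that ends the chain. -/
def sink : NatLayer := ((1, 0, 1, 0), false, (true, true), (false, true))

/-- Multiply all tables by a number. -/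
def scaleTables (c : ℕ) (st : List (NatLayer × List ℕ)) : List (NatLayer × List ℕ) :=
  st.map fun e => (e.1, e.2.map fun y => y * c)

/-- Add a layer in front, with its table. The first component is the common denominator. -/
def dpStep (ks : List ℕ) (ℓ : NatLayer) (s : ℕ × List (NatLayer × List ℕ)) :
    ℕ × List (NatLayer × List ℕ) :=
  (s.1 * (scan ks ℓ.2.1 s.2).2.2.1,
    (ℓ, (scan ks ℓ.2.1 s.2).2.2.2) :: scaleTables (scan ks ℓ.2.1 s.2).2.2.1 s.2)

/-- Process all layers, for the table `w` of weights. -/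
def dp (ks w : List ℕ) (L : List NatLayer) : ℕ × List (NatLayer × List ℕ) :=
  L.foldr (dpStep ks) (1, [(sink, w)])

/-- Numerator and denominator of the weighted sum for a chain. -/
def dpResult (ks w : List ℕ) (L : List NatLayer) : ℕ × ℕ :=
  ((scan ks false (dp ks w L).2).2.2.2.getD 0 0,
    (dp ks w L).1 * (scan ks false (dp ks w L).2).2.2.1)

/-! ### Correctness of the algorithm -/

/-- A pair of numbers as a vector. -/
def pairVec (v : ℕ × ℕ) : Bool → ℚ := fun b => (select b v : ℕ)

/-- The layer with the given natural number entries. -/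
def NatLayer.toLayer (ℓ : NatLayer) : Layer where
  mat a b := (select b (select a ((ℓ.1.1, ℓ.1.2.1), (ℓ.1.2.2.1, ℓ.1.2.2.2))) : ℕ)
  x := ℓ.2.1
  g b := if select b ℓ.2.2.1 then 1 else 0
  tag := if ℓ.2.2.2.1 then none else some ℓ.2.2.2.2

theorem pairVec_rowMul (v : ℕ × ℕ) (ℓ : NatLayer) :
    pairVec (rowMul v ℓ.1) = vecMat (pairVec v) ℓ.toLayer.mat := by
  funext b
  cases b <;> simp [pairVec, rowMul, vecMat, NatLayer.toLayer, select]

theorem pairVec_mask (v : ℕ × ℕ) (g : Bool × Bool) (b : Bool) :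
    pairVec (mask g v) b = pairVec v b * if select b g then 1 else 0 := by
  rcases g with ⟨_ | _, _ | _⟩ <;> cases b <;> simp [pairVec, mask, select]

theorem pairVec_unit (x : Bool) : pairVec (mask (!x, x) (1, 1)) = unitVec x := by
  funext b
  cases x <;> cases b <;> simp [pairVec, mask, select, unitVec]

/-- All transition probabilities of the layer are positive. -/
def NatLayer.Pos (ℓ : NatLayer) : Prop := 0 < ℓ.1.1 ∧ 0 < ℓ.1.2.1 ∧ 0 < ℓ.1.2.2.1 ∧ 0 < ℓ.1.2.2.2

/-- This is where positivity of the transition probabilities is used: no denominator in a scan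
vanishes. -/
theorem rowMul_pos {v : ℕ × ℕ} {ℓ : NatLayer} (hℓ : ℓ.Pos) (hv : 0 < v.1 + v.2) :
    0 < (rowMul v ℓ.1).1 ∧ 0 < (rowMul v ℓ.1).2 := by
  obtain ⟨h1, h2, h3, h4⟩ := hℓ
  rcases Nat.eq_zero_or_pos v.1 with h | h
  · have : 0 < v.2 := by omega
    simp only [rowMul]
    constructor <;> positivity
  · simp only [rowMul]
    constructor <;> positivity

/-- The count never decreases along the recursion, so tables may be cut off at `K`. -/
theorem pathSum_eq_zero {w : ℕ → ℚ} {K : ℕ} (hw : ∀ k, K ≤ k → w k = 0) (L : List Layer)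
    (u d : Bool → ℚ) (k : ℕ) (hk : K ≤ k) : pathSum w L u d k = 0 := by
  induction L generalizing u d k with
  | nil => simp [pathSum, hw k hk]
  | cons ℓ L ih => simp [pathSum, ih _ _ _ hk, ih _ _ (k + 1) (by omega)]

theorem getD_map_range (K : ℕ) (f : ℕ → ℕ) (k : ℕ) :
    ((List.range K).map f).getD k 0 = if k < K then f k else 0 := by
  split_ifs with h
  · simp [List.getD, h]
  · simp [List.getD, h]

/-- The list contains the layers together with their tables, over the common denominator `D`. -/
def HasTables (w : ℕ → ℚ) (D : ℕ) : List NatLayer → List (NatLayer × List ℕ) → Prop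
  | [], st => ∃ y, st = [(sink, y)] ∧ ∀ k, (y.getD k 0 : ℚ) = D * w k
  | ℓ :: L, st => ∃ y st', st = (ℓ, y) :: st' ∧ (∀ k, (y.getD k 0 : ℚ) =
      D * pathSum w (L.map NatLayer.toLayer) (unitVec ℓ.2.1) (unitVec ℓ.2.1) k) ∧
      HasTables w D L st'

/-- A scan unrolls the branch of `pathSum` that leaves positions out. With `a / b` the scalar that
splits off at a position, a step adds `a / b` times the table entry there to the partial sum `acc /
p`, over the new denominator `p * b`. The claim is the resulting identity, multiplied out. -/
theorem scan_spec {w : ℕ → ℚ} {K D : ℕ} (hw : ∀ k, K ≤ k → w k = 0) {L : List NatLayer}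
    {st : List (NatLayer × List ℕ)} (hL : ∀ ℓ ∈ L, ℓ.Pos) (hst : HasTables w D L st)
    (u d : ℕ × ℕ) (p : ℕ) (acc : List ℕ) (hd : 0 < d.1 + d.2) (hp : 0 < p)
    (hacc : ∀ k, K ≤ k → acc.getD k 0 = 0) :
    0 < (st.foldl (scanStep (List.range K)) (u, d, p, acc)).2.2.1 ∧ ∀ k,
      (p : ℚ) * ((st.foldl (scanStep (List.range K)) (u, d, p, acc)).2.2.2.getD k 0 : ℕ) =
        (st.foldl (scanStep (List.range K)) (u, d, p, acc)).2.2.1 *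
          (acc.getD k 0 + p * D * pathSum w (L.map NatLayer.toLayer) (pairVec u) (pairVec d) k) := by
  induction L generalizing st u d p acc with
  | nil =>
    obtain ⟨y, rfl, hy⟩ := hst
    have hd' : (d.1 + d.2 : ℚ) ≠ 0 := by exact_mod_cast hd.ne'
    -- The sink is an uncounted forced member whose matrix sends both states to `false`. Its scalar
    -- is the quotient of the sums of the two vectors, so with the table of the weights it
    -- reproduces the base case of `pathSum`.
    refine ⟨by simp [scanStep, sink, select, rowMul, hp]; omega, fun k => ?_⟩
    simp only [List.foldl_cons, List.foldl_nil, scanStep, getD_map_range, List.map_nil, pathSum]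
    by_cases hk : k < K
    · simp only [hk, if_true, sink, select, rowMul, mask, lookup, pairVec, cond_true, cond_false]
      push_cast
      rw [hy]
      field_simp
    · rw [hacc k (by omega), hw k (by omega), if_neg hk]
      simp
  | cons ℓ L ih =>
    obtain ⟨y, st', rfl, hy, hst'⟩ := hst
    have hℓ : ℓ.Pos := hL ℓ (by simp)
    have hpos := rowMul_pos hℓ hd
    have hsel : 0 < select ℓ.2.1 (rowMul d ℓ.1) := by
      cases ℓ.2.1
      exacts [hpos.1, hpos.2]
    have hsel' : ((select ℓ.2.1 (rowMul d ℓ.1) : ℕ) : ℚ) ≠ 0 := by exact_mod_cast hsel.ne'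
    have hlook : ∀ k, (lookup ℓ.2.2.2 y k : ℚ) = D * (if ℓ.toLayer.tag = none then
        pathSum w (L.map NatLayer.toLayer) (unitVec ℓ.2.1) (unitVec ℓ.2.1) (k + 1)
        else if ℓ.toLayer.tag = some true then
        pathSum w (L.map NatLayer.toLayer) (unitVec ℓ.2.1) (unitVec ℓ.2.1) k else 0) := by
      intro k
      rcases ℓ with ⟨m, x, g, t, t'⟩
      cases t <;> cases t' <;> simp [lookup, NatLayer.toLayer, hy, -List.getD_eq_getElem?_getD]
    rw [List.foldl_cons]
    have hu1 : pairVec (mask ℓ.2.2.1 (rowMul u ℓ.1)) =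
        fun b => vecMat (pairVec u) ℓ.toLayer.mat b * ℓ.toLayer.g b := by
      funext b
      rw [pairVec_mask, pairVec_rowMul]
      rfl
    have hu2 : pairVec (mask (ℓ.2.2.2.1 || !ℓ.2.2.2.2, ℓ.2.2.2.1 || !ℓ.2.2.2.2)
        (mask ℓ.2.2.1 (rowMul u ℓ.1))) = fun b => if ℓ.toLayer.tag = some true then 0 else
          vecMat (pairVec u) ℓ.toLayer.mat b * ℓ.toLayer.g b := by
      funext b
      rw [pairVec_mask, hu1]
      rcases ℓ with ⟨m, x, g, t, t'⟩
      cases t <;> cases t' <;> cases b <;> simp [NatLayer.toLayer, select]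
    have ha : ((select ℓ.2.1 (mask ℓ.2.2.1 (rowMul u ℓ.1)) : ℕ) : ℚ) =
        vecMat (pairVec u) ℓ.toLayer.mat ℓ.toLayer.x * ℓ.toLayer.g ℓ.toLayer.x :=
      congrFun hu1 ℓ.2.1
    have hb : ((select ℓ.2.1 (rowMul d ℓ.1) : ℕ) : ℚ) =
        vecMat (pairVec d) ℓ.toLayer.mat ℓ.toLayer.x :=
      congrFun (pairVec_rowMul d ℓ) ℓ.2.1
    obtain ⟨h1, h2⟩ := ih (fun ℓ h => hL ℓ (by simp [h])) hst'
      (scanStep (List.range K) (u, d, p, acc) (ℓ, y)).1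
      (scanStep (List.range K) (u, d, p, acc) (ℓ, y)).2.1
      (scanStep (List.range K) (u, d, p, acc) (ℓ, y)).2.2.1
      (scanStep (List.range K) (u, d, p, acc) (ℓ, y)).2.2.2
      (Nat.add_pos_left hpos.1 _) (Nat.mul_pos hp hsel)
      (fun k hk => by simp [scanStep, hk])
    refine ⟨h1, fun k => ?_⟩
    have h3 := h2 k
    generalize (st'.foldl (scanStep (List.range K))
      (scanStep (List.range K) (u, d, p, acc) (ℓ, y))) = r at h1 h2 h3 ⊢
    have h4 : (((scanStep (List.range K) (u, d, p, acc) (ℓ, y)).2.2.2.getD k 0 : ℕ) : ℚ) =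
        (acc.getD k 0 : ℕ) * (select ℓ.2.1 (rowMul d ℓ.1) : ℕ) +
          (select ℓ.2.1 (mask ℓ.2.2.1 (rowMul u ℓ.1)) : ℕ) * p * lookup ℓ.2.2.2 y k := by
      simp only [scanStep, getD_map_range]
      by_cases hk : k < K
      · simp [hk]
      -- Beyond `K` the step stores nothing, and nothing is lost.
      · have h5 : (lookup ℓ.2.2.2 y k : ℚ) = 0 := by
          rw [hlook, pathSum_eq_zero hw _ _ _ k (by omega),
            pathSum_eq_zero hw _ _ _ (k + 1) (by omega)]
          simp
        rw [h5, hacc k (by omega), if_neg hk]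
        simp
    rw [h4, hlook] at h3
    rw [show (scanStep (List.range K) (u, d, p, acc) (ℓ, y)).1 = mask (ℓ.2.2.2.1 || !ℓ.2.2.2.2,
      ℓ.2.2.2.1 || !ℓ.2.2.2.2) (mask ℓ.2.2.1 (rowMul u ℓ.1)) from rfl,
      show (scanStep (List.range K) (u, d, p, acc) (ℓ, y)).2.1 = rowMul d ℓ.1 from rfl,
      show (scanStep (List.range K) (u, d, p, acc) (ℓ, y)).2.2.1 =
        p * select ℓ.2.1 (rowMul d ℓ.1) from rfl, hu2, pairVec_rowMul] at h3
    rw [List.map_cons, pathSum, ← ha, ← hb]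
    -- The induction hypothesis starts from the denominator `p * b`, so it proves the claim
    -- multiplied by `b`.
    refine mul_left_cancel₀ hsel' ?_
    push_cast at h3 ⊢
    rw [show ℓ.toLayer.x = ℓ.2.1 from rfl]
    field_simp
    linear_combination h3

theorem HasTables.scale {w : ℕ → ℚ} {D : ℕ} {L : List NatLayer} {st : List (NatLayer × List ℕ)}
    (h : HasTables w D L st) (c : ℕ) : HasTables w (D * c) L (scaleTables c st) := by
  have hmap : ∀ (y : List ℕ) (k : ℕ), (y.map fun v => v * c).getD k 0 = y.getD k 0 * c := by
    intro y k
    simp only [List.getD, List.getElem?_map]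
    cases y[k]? <;> simp
  induction L generalizing st with
  | nil =>
    obtain ⟨y, rfl, hy⟩ := h
    refine ⟨_, rfl, fun k => ?_⟩
    rw [hmap]
    push_cast
    rw [hy]
    ring
  | cons ℓ L ih =>
    obtain ⟨y, st', rfl, hy, hst'⟩ := h
    refine ⟨_, _, rfl, fun k => ?_, ih hst'⟩
    rw [hmap]
    push_cast
    rw [hy]
    ring

theorem scan_unit_spec {w : ℕ → ℚ} {K D : ℕ} (hw : ∀ k, K ≤ k → w k = 0) {L : List NatLayer}
    {st : List (NatLayer × List ℕ)} (hL : ∀ ℓ ∈ L, ℓ.Pos) (hst : HasTables w D L st) (x : Bool) :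
    0 < (scan (List.range K) x st).2.2.1 ∧ ∀ k,
      ((scan (List.range K) x st).2.2.2.getD k 0 : ℚ) = (D * (scan (List.range K) x st).2.2.1 : ℕ) *
        pathSum w (L.map NatLayer.toLayer) (unitVec x) (unitVec x) k := by
  have h := scan_spec hw hL hst (mask (!x, x) (1, 1)) (mask (!x, x) (1, 1)) 1 []
    (by cases x <;> simp [mask]) one_pos (by simp)
  refine ⟨h.1, fun k => ?_⟩
  have h2 := h.2 k
  rw [pairVec_unit] at h2
  simp only [Nat.cast_one, one_mul, List.getD_nil, Nat.cast_zero, zero_add] at h2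
  refine h2.trans ?_
  push_cast
  simp only [scan]
  ring

theorem dp_spec {w : List ℕ} {K : ℕ} (hw : w.length ≤ K) {L : List NatLayer}
    (hL : ∀ ℓ ∈ L, ℓ.Pos) : 0 < (dp (List.range K) w L).1 ∧
      HasTables (fun k => (w.getD k 0 : ℕ)) (dp (List.range K) w L).1 L
        (dp (List.range K) w L).2 := by
  have hw' : ∀ k, K ≤ k → ((w.getD k 0 : ℕ) : ℚ) = 0 := by
    intro k hk
    rw [List.getD_eq_default _ _ (by omega)]
    rfl
  induction L with
  | nil => exact ⟨one_pos, w, rfl, fun k => by simp [dp]⟩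
  | cons ℓ L ih =>
    obtain ⟨h1, h2⟩ := ih fun ℓ h => hL ℓ (by simp [h])
    obtain ⟨h3, h4⟩ := scan_unit_spec hw' (fun ℓ h => hL ℓ (by simp [h])) h2 ℓ.2.1
    exact ⟨Nat.mul_pos h1 h3, _, _, rfl, h4, h2.scale _⟩

theorem dpResult_spec {w : List ℕ} {K : ℕ} (hw : w.length ≤ K) {L : List NatLayer}
    (hL : ∀ ℓ ∈ L, ℓ.Pos) : 0 < (dpResult (List.range K) w L).2 ∧
      ((dpResult (List.range K) w L).1 : ℚ) / (dpResult (List.range K) w L).2 =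
        pathSum (fun k => (w.getD k 0 : ℕ)) (L.map NatLayer.toLayer) (unitVec false)
          (unitVec false) 0 := by
  have hw' : ∀ k, K ≤ k → ((w.getD k 0 : ℕ) : ℚ) = 0 := by
    intro k hk
    rw [List.getD_eq_default _ _ (by omega)]
    rfl
  obtain ⟨h1, h2⟩ := dp_spec hw hL
  obtain ⟨h3, h4⟩ := scan_unit_spec hw' hL h2 false
  have h5 : 0 < (dpResult (List.range K) w L).2 := Nat.mul_pos h1 h3
  refine ⟨h5, ?_⟩
  rw [div_eq_iff (by exact_mod_cast h5.ne'), mul_comm]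
  exact h4 0

end MarkovShap

/-! ### Digit bounds for the dynamic program. -/

namespace MarkovShap

open Computability Code

variable {α β γ δ σ : Type} [Code α] [Code β] [Code γ] [Code δ] [Code σ]

/-! ### Running time of the algorithm -/

@[fun_prop]
theorem PTime.select {x : α → Bool} {v : α → β × β} (hx : PTime x) (hv : PTime v) :
    PTime fun a => MarkovShap.select (x a) (v a) := by
  unfold MarkovShap.select
  fun_prop

@[fun_prop]
theorem PTime.rowMul {v : α → ℕ × ℕ} {m : α → ℕ × ℕ × ℕ × ℕ} (hv : PTime v) (hm : PTime m) :
    PTime fun a => MarkovShap.rowMul (v a) (m a) := by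
  unfold MarkovShap.rowMul
  fun_prop

@[fun_prop]
theorem PTime.mask {g : α → Bool × Bool} {v : α → ℕ × ℕ} (hg : PTime g) (hv : PTime v) :
    PTime fun a => MarkovShap.mask (g a) (v a) := by
  unfold MarkovShap.mask
  fun_prop

@[fun_prop]
theorem PTime.lookup {t : α → Bool × Bool} {y : α → List ℕ} {k : α → ℕ} (ht : PTime t)
    (hy : PTime y) (hk : PTime k) : PTime fun a => MarkovShap.lookup (t a) (y a) (k a) := by
  unfold MarkovShap.lookup
  fun_prop

@[fun_prop]
theorem PTime.scanStep {ks : α → List ℕ} {s : α → ScanState} {e : α → NatLayer × List ℕ}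
    (hk : PTime ks) (hs : PTime s) (he : PTime e) :
    PTime fun a => MarkovShap.scanStep (ks a) (s a) (e a) := by
  unfold MarkovShap.scanStep
  fun_prop

/-- The entries of the matrix have at most `q` binary digits. -/
def NatLayer.SizeLE (q : ℕ) (ℓ : NatLayer) : Prop :=
  ℓ.1.1 < 2 ^ q ∧ ℓ.1.2.1 < 2 ^ q ∧ ℓ.1.2.2.1 < 2 ^ q ∧ ℓ.1.2.2.2 < 2 ^ q

theorem rowMul_lt {q s : ℕ} {ℓ : NatLayer} (h : ℓ.SizeLE q) {v : ℕ × ℕ} (h1 : v.1 < 2 ^ s)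
    (h2 : v.2 < 2 ^ s) :
    (rowMul v ℓ.1).1 < 2 ^ (s + q + 1) ∧ (rowMul v ℓ.1).2 < 2 ^ (s + q + 1) := by
  obtain ⟨ha, hb, hc, hd⟩ := h
  have e : 2 ^ (s + q + 1) = 2 ^ s * 2 ^ q + 2 ^ s * 2 ^ q := by ring
  rw [e]
  exact ⟨Nat.add_lt_add (Nat.mul_lt_mul'' h1 ha) (Nat.mul_lt_mul'' h2 hc),
    Nat.add_lt_add (Nat.mul_lt_mul'' h1 hb) (Nat.mul_lt_mul'' h2 hd)⟩

theorem mask_le (g : Bool × Bool) (v : ℕ × ℕ) : (mask g v).1 ≤ v.1 ∧ (mask g v).2 ≤ v.2 := by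
  rcases g with ⟨_ | _, _ | _⟩ <;> simp [mask]

theorem select_lt {m : ℕ} (x : Bool) {v : ℕ × ℕ} (h1 : v.1 < m) (h2 : v.2 < m) :
    select x v < m := by
  cases x <;> assumption

theorem getD_lt {m : ℕ} (hm : 0 < m) {y : List ℕ} (h : ∀ n ∈ y, n < m) (k : ℕ) :
    y.getD k 0 < m := by
  by_cases hk : k < y.length
  · rw [List.getD_eq_getElem _ _ hk]
    exact h _ (List.getElem_mem hk)
  · rwa [List.getD_eq_default _ _ (by omega)]

theorem lookup_lt {m : ℕ} (hm : 0 < m) (t : Bool × Bool) {y : List ℕ} (h : ∀ n ∈ y, n < m)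
    (k : ℕ) : lookup t y k < m := by
  have h1 := getD_lt hm h
  rcases t with ⟨_ | _, _ | _⟩ <;> simp [lookup, hm, h1, -List.getD_eq_getElem?_getD]

/-- Bounds on the numbers in the state of a scan. -/
def ScanState.SizeLE (s t v : ℕ) (S : ScanState) : Prop :=
  (S.1.1 < 2 ^ s ∧ S.1.2 < 2 ^ s) ∧ (S.2.1.1 < 2 ^ s ∧ S.2.1.2 < 2 ^ s) ∧ S.2.2.1 < 2 ^ t ∧
    ∀ n ∈ S.2.2.2, n < 2 ^ (t + v)

/-- Bounds on the numbers in a list of layers with tables. -/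
def TablesSizeLE (q v : ℕ) (st : List (NatLayer × List ℕ)) : Prop :=
  ∀ e ∈ st, e.1.SizeLE q ∧ ∀ n ∈ e.2, n < 2 ^ v

/-- Multiplication by a matrix costs `q + 1` digits. The denominator needs only `t + s + q + 1`; the
additional digit absorbs the sum in the tables, so that these keep exceeding the denominator by `v`
digits. -/
theorem ScanState.SizeLE.step {s t v q : ℕ} {S : ScanState} (hS : ScanState.SizeLE s t v S)
    (ks : List ℕ) {e : NatLayer × List ℕ} (he : e.1.SizeLE q) (he' : ∀ n ∈ e.2, n < 2 ^ v) :
    ScanState.SizeLE (s + q + 1) (t + s + q + 2) v (scanStep ks S e) := by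
  obtain ⟨⟨h1, h2⟩, ⟨h3, h4⟩, h5, h6⟩ := hS
  obtain ⟨hu1, hu2⟩ := rowMul_lt he h1 h2
  obtain ⟨hd1, hd2⟩ := rowMul_lt he h3 h4
  obtain ⟨hm1, hm2⟩ := mask_le e.1.2.2.1 (rowMul S.1 e.1.1)
  obtain ⟨hm3, hm4⟩ := mask_le (e.1.2.2.2.1 || !e.1.2.2.2.2, e.1.2.2.2.1 || !e.1.2.2.2.2)
    (mask e.1.2.2.1 (rowMul S.1 e.1.1))
  have hsel := select_lt e.1.2.1 hd1 hd2
  have hsel' := select_lt e.1.2.1 (hm1.trans_lt hu1) (hm2.trans_lt hu2)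
  refine ⟨⟨(hm3.trans hm1).trans_lt hu1, (hm4.trans hm2).trans_lt hu2⟩, ⟨hd1, hd2⟩, ?_, ?_⟩
  · refine (Nat.mul_lt_mul'' h5 hsel).trans_le ?_
    rw [← pow_add]
    exact Nat.pow_le_pow_right (by simp) (by omega)
  · intro n hn
    obtain ⟨k, -, rfl⟩ := List.mem_map.1 hn
    have ha := Nat.mul_lt_mul'' (getD_lt (by positivity) h6 k) hsel
    have hb := Nat.mul_lt_mul'' (Nat.mul_lt_mul'' hsel' h5)
      (lookup_lt (by positivity) e.1.2.2.2 he' k)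
    refine (Nat.add_lt_add ha hb).trans_eq ?_
    ring

theorem ScanState.SizeLE.foldl {s t v q : ℕ} {S : ScanState} (hS : ScanState.SizeLE s t v S)
    (ks : List ℕ) {st : List (NatLayer × List ℕ)} (hst : TablesSizeLE q v st) :
    ScanState.SizeLE (s + st.length * (q + 1))
      (t + st.length * (s + st.length * (q + 1) + 1)) v (st.foldl (scanStep ks) S) := by
  have mono : ∀ {s t s' t' : ℕ} {S : ScanState}, ScanState.SizeLE s t v S → s ≤ s' → t ≤ t' →
      ScanState.SizeLE s' t' v S := by
    intro s t s' t' S h hs ht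
    have e1 : 2 ^ s ≤ 2 ^ s' := Nat.pow_le_pow_right (by simp) hs
    have e2 : 2 ^ t ≤ 2 ^ t' := Nat.pow_le_pow_right (by simp) ht
    have e3 : 2 ^ (t + v) ≤ 2 ^ (t' + v) := Nat.pow_le_pow_right (by simp) (by omega)
    obtain ⟨⟨h1, h2⟩, ⟨h3, h4⟩, h5, h6⟩ := h
    exact ⟨⟨h1.trans_le e1, h2.trans_le e1⟩, ⟨h3.trans_le e1, h4.trans_le e1⟩, h5.trans_le e2,
      fun n hn => (h6 n hn).trans_le e3⟩
  induction st generalizing s t S with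
  | nil => simpa using hS
  | cons e st ih =>
    obtain ⟨h1, h2⟩ := hst e (by simp)
    refine mono (ih (hS.step ks h1 h2) fun e he => hst e (by simp [he])) ?_ ?_
    · simp only [List.length_cons]
      ring_nf
      omega
    · simp only [List.length_cons]
      nlinarith [Nat.zero_le (st.length * (q + 1))]

/-- A bound on the number of digits after a scan of `R` layers. -/
def scanSize (q R : ℕ) : ℕ := 1 + R * (R * (q + 1) + 2)

theorem scanSize_mono {q q' R R' : ℕ} (hq : q ≤ q') (hR : R ≤ R') :
    scanSize q R ≤ scanSize q' R' := by
  unfold scanSize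
  gcongr

theorem scan_sizeLE {q v : ℕ} (ks : List ℕ) (x : Bool) {st : List (NatLayer × List ℕ)}
    (hst : TablesSizeLE q v st) :
    ScanState.SizeLE (1 + st.length * (q + 1)) (scanSize q st.length) v (scan ks x st) := by
  have h : ScanState.SizeLE 1 1 v (mask (!x, x) (1, 1), mask (!x, x) (1, 1), 1, []) := by
    cases x <;> simp [ScanState.SizeLE, mask]
  have h1 := h.foldl ks hst
  rw [show 1 + st.length * (1 + st.length * (q + 1) + 1) = scanSize q st.length by
    unfold scanSize; ring] at h1
  exact h1

theorem sz_nat_le_of_lt {n m : ℕ} (h : n < 2 ^ m) : sz n ≤ 4 * m + 1 :=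
  (sz_nat_le n).trans (by have := size_le_iff.2 h; omega)

theorem sz_list_nat_le {l : List ℕ} {m c : ℕ} (h : ∀ n ∈ l, n < 2 ^ m) (hc : l.length ≤ c) :
    sz l ≤ c * (4 * m + 2) + 1 := by
  refine (sz_le_of_forall_le fun n hn => sz_nat_le_of_lt (h n hn)).trans ?_
  gcongr

theorem length_scan_le (ks : List ℕ) (x : Bool) (st : List (NatLayer × List ℕ)) :
    (scan ks x st).2.2.2.length ≤ ks.length := by
  rcases List.eq_nil_or_concat st with rfl | ⟨l, e, rfl⟩
  · simp [scan]
  · simp [scan, scanStep]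

theorem ScanState.SizeLE.sz_le {s t v : ℕ} {S : ScanState} (hS : ScanState.SizeLE s t v S)
    {c : ℕ} (hc : S.2.2.2.length ≤ c) :
    MarkovShap.sz S ≤ 16 * s + 4 * t + c * (4 * (t + v) + 2) + 20 := by
  obtain ⟨⟨h1, h2⟩, ⟨h3, h4⟩, h5, h6⟩ := hS
  have h1 := sz_nat_le_of_lt h1
  have h2 := sz_nat_le_of_lt h2
  have h3 := sz_nat_le_of_lt h3
  have h4 := sz_nat_le_of_lt h4
  have h5 := sz_nat_le_of_lt h5
  have h6 := sz_list_nat_le h6 hc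
  simp only [sz_prod]
  omega

theorem lt_two_pow_of_sz_le {n m : ℕ} (h : sz n ≤ m) : n < 2 ^ m :=
  size_le_iff.1 ((size_le_sz n).trans h)

theorem NatLayer.sizeLE_of_sz_le {ℓ : NatLayer} {m : ℕ} (h : sz ℓ ≤ m) : ℓ.SizeLE m := by
  simp only [sz_prod] at h
  exact ⟨lt_two_pow_of_sz_le (by omega), lt_two_pow_of_sz_le (by omega),
    lt_two_pow_of_sz_le (by omega), lt_two_pow_of_sz_le (by omega)⟩

/-- The length of a representation bounds the digits of all numbers in it, so the size of the
argument can serve for both parameters. -/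
theorem tablesSizeLE_sz (st : List (NatLayer × List ℕ)) : TablesSizeLE (sz st) (sz st) st := by
  intro e he
  have h := sz_le_of_mem he
  rw [sz_prod] at h
  refine ⟨NatLayer.sizeLE_of_sz_le (by omega), fun n hn => lt_two_pow_of_sz_le ?_⟩
  have := sz_le_of_mem hn
  omega

@[fun_prop]
theorem PolyBd.scanSize {q R : α → ℕ} (hq : PolyBd q) (hR : PolyBd R) :
    PolyBd fun a => MarkovShap.scanSize (q a) (R a) := by
  unfold MarkovShap.scanSize
  fun_prop

@[fun_prop]
theorem PTime.scan {ks : α → List ℕ} {x : α → Bool} {st : α → List (NatLayer × List ℕ)}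
    (hk : PTime ks) (hx : PTime x) (hst : PTime st) :
    PTime fun a => MarkovShap.scan (ks a) (x a) (st a) := by
  have hZ := hst.sz
  have hK := hk.sz
  refine PTime.foldl_of_le (l := st) (f := fun a => MarkovShap.scanStep (ks a)) hst
    (i := fun a => (MarkovShap.mask (!x a, x a) (1, 1), MarkovShap.mask (!x a, x a) (1, 1), 1, []))
    (by fun_prop) (by fun_prop)
    (B := fun a => 16 * (1 + MarkovShap.sz (st a) * (MarkovShap.sz (st a) + 1)) +
      4 * MarkovShap.scanSize (MarkovShap.sz (st a)) (MarkovShap.sz (st a)) +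
      MarkovShap.sz (ks a) * (4 * (MarkovShap.scanSize (MarkovShap.sz (st a))
        (MarkovShap.sz (st a)) + MarkovShap.sz (st a)) + 2) + 20) (by fun_prop) ?_
  intro a l' hl'
  have h1 : TablesSizeLE (MarkovShap.sz (st a)) (MarkovShap.sz (st a)) l' :=
    fun e he => tablesSizeLE_sz (st a) e (hl'.subset he)
  have h2 := hl'.length_le.trans (length_lt_sz (st a)).le
  refine ((scan_sizeLE (ks a) (x a) h1).sz_le ((length_scan_le (ks a) (x a) l').trans
    (length_lt_sz (ks a)).le)).trans ?_
  have h3 := scanSize_mono (le_refl (MarkovShap.sz (st a))) h2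
  gcongr

@[fun_prop]
theorem PTime.scaleTables {c : α → ℕ} {st : α → List (NatLayer × List ℕ)} (hc : PTime c)
    (hst : PTime st) : PTime fun a => MarkovShap.scaleTables (c a) (st a) := by
  unfold MarkovShap.scaleTables
  fun_prop

@[fun_prop]
theorem PTime.dpStep {ks : α → List ℕ} {ℓ : α → NatLayer}
    {s : α → ℕ × List (NatLayer × List ℕ)} (hk : PTime ks) (hℓ : PTime ℓ) (hs : PTime s) :
    PTime fun a => MarkovShap.dpStep (ks a) (ℓ a) (s a) := by
  unfold MarkovShap.dpStep
  fun_prop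

theorem map_fst_dp (ks w : List ℕ) (L : List NatLayer) :
    (dp ks w L).2.map Prod.fst = L ++ [sink] := by
  induction L with
  | nil => rfl
  | cons ℓ L ih =>
    simp only [dp, List.foldr_cons, dpStep, List.map_cons, scaleTables, List.map_map,
      List.cons_append, List.cons.injEq, true_and]
    exact ih

theorem length_dp (ks w : List ℕ) (L : List NatLayer) : (dp ks w L).2.length = L.length + 1 := by
  simpa using congrArg List.length (map_fst_dp ks w L)

theorem length_table_dp (ks w : List ℕ) (L : List NatLayer) :
    ∀ e ∈ (dp ks w L).2, e.2.length ≤ ks.length + w.length := by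
  induction L with
  | nil => simp [dp]
  | cons ℓ L ih =>
    intro e he
    rcases List.mem_cons.1 he with rfl | he
    · exact (length_scan_le ks ℓ.2.1 _).trans (by omega)
    · obtain ⟨e', he', rfl⟩ := List.mem_map.1 he
      simpa using ih e' he'

/-- A layer multiplies the denominator and the old tables by one number of at most `scanSize q R`
digits, and its own table exceeds the old bound by no more than that. So the number of digits grows
linearly in the number of layers. Positivity of `v` and `q` makes room for the initial denominator 1
and the entries 1 of the sink. -/
theorem dp_sizeLE {q v R : ℕ} (ks w : List ℕ) (hv : 0 < v) (hq : 0 < q) (hw : ∀ n ∈ w, n < 2 ^ v)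
    {L : List NatLayer} (hL : ∀ ℓ ∈ L, ℓ.SizeLE q) (hR : L.length < R) :
    (dp ks w L).1 < 2 ^ (v + L.length * scanSize q R) ∧
      TablesSizeLE q (v + L.length * scanSize q R) (dp ks w L).2 := by
  induction L with
  | nil =>
    have h1 : 1 < 2 ^ v := Nat.one_lt_two_pow hv.ne'
    have h2 : 1 < 2 ^ q := Nat.one_lt_two_pow hq.ne'
    simpa [dp, TablesSizeLE, NatLayer.SizeLE, sink, h1, h2] using hw
  | cons ℓ L ih =>
    rw [List.length_cons] at hR
    obtain ⟨h1, h2⟩ := ih (fun ℓ h => hL ℓ (by simp [h])) (by omega)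
    obtain ⟨-, -, h3, h4⟩ := scan_sizeLE ks ℓ.2.1 h2
    have h5 : scanSize q (dp ks w L).2.length ≤ scanSize q R :=
      scanSize_mono le_rfl (by rw [length_dp]; omega)
    have h6 : v + (ℓ :: L).length * scanSize q R =
        (v + L.length * scanSize q R) + scanSize q R := by
      rw [List.length_cons]; ring
    have h7 := h3.trans_le (Nat.pow_le_pow_right (by simp) h5)
    rw [h6]
    refine ⟨?_, ?_⟩
    · rw [pow_add]
      exact Nat.mul_lt_mul'' h1 h7
    · intro e he
      rcases List.mem_cons.1 he with rfl | he
      · exact ⟨hL _ (by simp), fun n hn => (h4 n hn).trans_le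
          (Nat.pow_le_pow_right (by simp) (by omega))⟩
      · obtain ⟨e', he', rfl⟩ := List.mem_map.1 he
        obtain ⟨h8, h9⟩ := h2 e' he'
        refine ⟨h8, fun n hn => ?_⟩
        obtain ⟨n', hn', rfl⟩ := List.mem_map.1 hn
        rw [pow_add]
        exact Nat.mul_lt_mul'' (h9 n' hn') h7

theorem sz_dp_le {q v R : ℕ} (ks w : List ℕ) (hv : 0 < v) (hq : 0 < q) (hw : ∀ n ∈ w, n < 2 ^ v)
    {L : List NatLayer} (hL : ∀ ℓ ∈ L, ℓ.SizeLE q) (hR : L.length < R) {m : ℕ}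
    (hm : ∀ ℓ ∈ L, sz ℓ ≤ m) :
    sz (dp ks w L) ≤ (4 * (v + R * scanSize q R) + 1) + (R * (m + sz sink +
      ((ks.length + w.length) * (4 * (v + R * scanSize q R) + 2) + 1) + 2) + 1) + 1 := by
  obtain ⟨h1, h2⟩ := dp_sizeLE ks w hv hq hw hL hR
  have h3 : v + L.length * scanSize q R ≤ v + R * scanSize q R := by gcongr
  have h4 : (2 : ℕ) ^ (v + L.length * scanSize q R) ≤ 2 ^ (v + R * scanSize q R) :=
    Nat.pow_le_pow_right (by simp) h3
  rw [sz_prod]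
  refine Nat.add_le_add (Nat.add_le_add (sz_nat_le_of_lt (h1.trans_le h4))
    ((sz_le_of_forall_le (m := m + sz sink +
      ((ks.length + w.length) * (4 * (v + R * scanSize q R) + 2) + 1) + 1) ?_).trans ?_)) le_rfl
  · intro e he
    have h5 := sz_list_nat_le (fun n hn => ((h2 e he).2 n hn).trans_le h4)
      (length_table_dp ks w L e he)
    have h6 : sz e.1 ≤ m + sz sink := by
      have h7 : e.1 ∈ L ++ [sink] := map_fst_dp ks w L ▸ List.mem_map_of_mem he
      rcases List.mem_append.1 h7 with h | h
      · exact (hm _ h).trans (by omega)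
      · rw [List.mem_singleton.1 h]; omega
    rw [sz_prod]
    omega
  · rw [length_dp]
    gcongr
    omega

@[fun_prop]
theorem PTime.dp {ks w : α → List ℕ} {L : α → List NatLayer} (hk : PTime ks) (hw : PTime w)
    (hL : PTime L) : PTime fun a => MarkovShap.dp (ks a) (w a) (L a) := by
  have hZ := hL.sz
  have hK := hk.sz
  have hW := hw.sz
  refine (PTime.foldl_of_le (l := fun a => (L a).reverse)
    (f := fun a s ℓ => MarkovShap.dpStep (ks a) ℓ s) (i := fun a => (1, [(sink, w a)]))
    (by fun_prop) (by fun_prop) (by fun_prop)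
    (B := fun a => (4 * (MarkovShap.sz (w a) + MarkovShap.sz (L a) *
      MarkovShap.scanSize (MarkovShap.sz (L a)) (MarkovShap.sz (L a))) + 1) +
      (MarkovShap.sz (L a) * (MarkovShap.sz (L a) + MarkovShap.sz sink +
      ((MarkovShap.sz (ks a) + MarkovShap.sz (w a)) * (4 * (MarkovShap.sz (w a) +
        MarkovShap.sz (L a) * MarkovShap.scanSize (MarkovShap.sz (L a)) (MarkovShap.sz (L a))) + 2)
        + 1) + 2) + 1) + 1) (by fun_prop) ?_).congr fun a => ?_
  · intro a l' hl'
    have hsub : ∀ ℓ ∈ l'.reverse, ℓ ∈ L a := fun ℓ h => by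
      simpa using hl'.subset (by simpa using h)
    have h1 := sz_dp_le (ks a) (w a) (sz_pos (w a)) (sz_pos (L a))
      (fun n hn => lt_two_pow_of_sz_le (sz_le_of_mem hn).le) (L := l'.reverse)
      (fun ℓ h => NatLayer.sizeLE_of_sz_le (sz_le_of_mem (hsub ℓ h)).le) (R := MarkovShap.sz (L a))
      (by simpa using hl'.length_le.trans_lt (by simpa using length_lt_sz (L a)))
      (fun ℓ h => (sz_le_of_mem (hsub ℓ h)).le)
    have h2 : MarkovShap.dp (ks a) (w a) l'.reverse =
        l'.foldl (fun s ℓ => MarkovShap.dpStep (ks a) ℓ s) (1, [(sink, w a)]) := by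
      simp [MarkovShap.dp]
    rw [h2] at h1
    refine h1.trans ?_
    have h3 := (length_lt_sz (ks a)).le
    have h4 := (length_lt_sz (w a)).le
    gcongr
  · simp [MarkovShap.dp]

@[fun_prop]
theorem PTime.dpResult {ks w : α → List ℕ} {L : α → List NatLayer} (hk : PTime ks) (hw : PTime w)
    (hL : PTime L) : PTime fun a => MarkovShap.dpResult (ks a) (w a) (L a) := by
  unfold MarkovShap.dpResult
  fun_prop

end MarkovShap

/-! ### Assembling the score of an instance. -/

namespace MarkovShap

open Computability Code

variable {α β γ δ σ : Type} [Code α] [Code β] [Code γ] [Code δ] [Code σ]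

/-! ### Weights -/

/-- The factorial of `k`, for the list of the numbers below a bound of `k`. -/
def rangeFactorial (r : List ℕ) (k : ℕ) : ℕ :=
  (r.map fun j => bif decide (j < k) then j + 1 else 1).prod

@[fun_prop]
theorem PTime.rangeFactorial {r : α → List ℕ} {k : α → ℕ} (hr : PTime r) (hk : PTime k) :
    PTime fun a => MarkovShap.rangeFactorial (r a) (k a) := by
  unfold MarkovShap.rangeFactorial
  fun_prop

theorem rangeFactorial_range {N k : ℕ} (h : k ≤ N) :
    rangeFactorial (List.range N) k = k.factorial := by
  -- Without the hypothesis `k ≤ N` the product stops at the smaller number; this form is suitable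
  -- for induction on `N`.
  have key : ∀ N, rangeFactorial (List.range N) k = (min k N).factorial := by
    intro N
    induction N with
    | zero => simp [rangeFactorial]
    | succ N ih =>
      rw [rangeFactorial, List.range_succ, List.map_append, List.prod_append]
      rw [rangeFactorial] at ih
      rw [ih]
      by_cases hN : N < k
      · rw [min_eq_right hN.le, min_eq_right (Nat.succ_le_of_lt hN), Nat.factorial_succ]
        simp [hN, mul_comm]
      · rw [min_eq_left (by omega), min_eq_left (by omega)]
        simp [hN]
  rw [key, min_eq_left h]

/-- The table of the weights of the score. -/
def weightTable (alt : Bool) (r : List ℕ) : List ℕ :=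
  r.map fun k => bif alt then bif decide (k + 1 < r.length) then
      rangeFactorial r (k + 1) * rangeFactorial r (r.length - (k + 1) - 1) else 0
    else rangeFactorial r k * rangeFactorial r (r.length - k - 1)

@[fun_prop]
theorem PTime.weightTable (alt : Bool) {r : α → List ℕ} (hr : PTime r) :
    PTime fun a => MarkovShap.weightTable alt (r a) := by
  unfold MarkovShap.weightTable
  fun_prop

theorem getD_weightTable (alt : Bool) (N k : ℕ) :
    (weightTable alt (List.range N)).getD k 0 = shapWeight N alt k := by
  rw [weightTable, getD_map_range, List.length_range, shapWeight]
  cases alt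
  · by_cases h : k < N
    · simp only [h, if_true, cond_false, Bool.false_eq_true, if_false]
      rw [rangeFactorial_range h.le, rangeFactorial_range (by omega)]
    · simp [h]
  · by_cases h : k + 1 < N
    · simp only [h, show k < N by omega, if_true, cond_true, decide_true]
      rw [rangeFactorial_range h.le, rangeFactorial_range (by omega)]
    · simp [h]

/-! ### The score as a fraction -/

/-- The sum of two fractions. -/
def addFrac (s f : ℕ × ℕ) : ℕ × ℕ := (s.1 * f.2 + f.1 * s.2, s.2 * f.2)

theorem foldl_addFrac {ι : Type} (l : List ι) (f : ι → ℕ × ℕ) (hf : ∀ c ∈ l, 0 < (f c).2)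
    (s : ℕ × ℕ) (hs : 0 < s.2) : 0 < (l.foldl (fun s c => addFrac s (f c)) s).2 ∧
      ((l.foldl (fun s c => addFrac s (f c)) s).1 : ℚ) /
        (l.foldl (fun s c => addFrac s (f c)) s).2 =
      s.1 / s.2 + (l.map fun c => ((f c).1 : ℚ) / (f c).2).sum := by
  induction l generalizing s with
  | nil => simp [hs]
  | cons c l ih =>
    have hc := hf c (by simp)
    obtain ⟨h1, h2⟩ := ih (fun c h => hf c (by simp [h])) (addFrac s (f c)) (Nat.mul_pos hs hc)
    refine ⟨h1, h2.trans ?_⟩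
    have hs' : (s.2 : ℚ) ≠ 0 := by exact_mod_cast hs.ne'
    have hc' : ((f c).2 : ℚ) ≠ 0 := by exact_mod_cast hc.ne'
    simp only [addFrac, List.map_cons, List.sum_cons]
    push_cast
    field_simp
    ring

/-- The data of an instance: the vector to explain, the feature, the matrices with natural number
entries, and the paths of the tree to the leaves with output `true`. -/
abbrev Data : Type := List Bool × ℕ × List (ℕ × ℕ × ℕ × ℕ) × List (List (Bool × Bool))

/-- The layers for a path, with the feature forced into (`b = true`) or out of the coalitions. -/
def Data.layers (D : Data) (b : Bool) (c : List (Bool × Bool)) : List NatLayer :=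
  (List.range D.1.length).map fun j => (D.2.2.1.getD j (0, 0, 0, 0), D.1.getD j false,
    c.getD j (true, true), (!decide (j = D.2.1), b))

/-- The contribution of a path. -/
def Data.pathResult (D : Data) (alt b : Bool) (c : List (Bool × Bool)) : ℕ × ℕ :=
  dpResult (List.range D.1.length) (weightTable alt (List.range D.1.length)) (D.layers b c)

/-- The sum of the contributions of all paths. -/
def Data.total (D : Data) (alt b : Bool) : ℕ × ℕ :=
  D.2.2.2.foldl (fun s c => addFrac s (D.pathResult alt b c)) (0, 1)

@[fun_prop]
theorem PTime.pathResult (alt b : Bool) {D : α → Data} {c : α → List (Bool × Bool)} (hD : PTime D)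
    (hc : PTime c) : PTime fun a => (D a).pathResult alt b (c a) := by
  unfold Data.pathResult Data.layers
  fun_prop

/-- The maximum of the two sizes grows by an amount depending on `f` only, as `PTime.foldl`
requires. Their sum need not: the denominator `s.2` also enters the new numerator. -/
theorem addFrac_size_le (s f : ℕ × ℕ) : max (addFrac s f).1.size (addFrac s f).2.size ≤
    max s.1.size s.2.size + (f.1.size + f.2.size + 1) := by
  have h1 := size_mul_le s.1 f.2
  have h2 := size_mul_le f.1 s.2
  have h3 := size_mul_le s.2 f.2
  refine max_le ?_ (h3.trans (by omega))
  have e1 : s.1 * f.2 < 2 ^ (max s.1.size s.2.size + (f.1.size + f.2.size)) :=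
    size_le_iff.1 (by omega)
  have e2 : f.1 * s.2 < 2 ^ (max s.1.size s.2.size + (f.1.size + f.2.size)) :=
    size_le_iff.1 (by omega)
  rw [size_le_iff, ← add_assoc, pow_succ, addFrac]
  dsimp only
  omega

@[fun_prop]
theorem PTime.total (alt b : Bool) : PTime fun D : Data => D.total alt b := by
  have h1 : PTime fun p : Data × List (Bool × Bool) => p.1.pathResult alt b p.2 :=
    PTime.pathResult alt b (by fun_prop) (by fun_prop)
  have h2 : PTime fun p : Data × (ℕ × ℕ) × List (Bool × Bool) => p.1.pathResult alt b p.2.2 :=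
    PTime.pathResult alt b (by fun_prop) (by fun_prop)
  refine PTime.foldl (l := fun D : Data => D.2.2.2) (i := fun _ => (0, 1))
    (f := fun (D : Data) s c => addFrac s (D.pathResult alt b c)) (by fun_prop) (by fun_prop) ?_
    (fun s => max s.1.size s.2.size) (8 * .X + 3) ?_ (.const _)
    (G := fun p => (p.1.pathResult alt b p.2).1.size + (p.1.pathResult alt b p.2).2.size + 1)
    (((PolyBd.size h1.fst).add (.size h1.snd)).add (.const 1)) fun D s c => addFrac_size_le _ _
  · have h3 : PTime fun p : Data × (ℕ × ℕ) × List (Bool × Bool) => p.2.1 := by fun_prop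
    exact ((h3.fst.mul h2.snd).add (h2.fst.mul h3.snd)).pair (h3.snd.mul h2.snd)
  · intro s
    have h1 := sz_nat_le s.1
    have h2 := sz_nat_le s.2
    simp only [sz_prod, Polynomial.eval_add, Polynomial.eval_mul, Polynomial.eval_X,
      Polynomial.eval_ofNat]
    omega

/-- The positive part of the numerator, its negative part, and the denominator of the score. -/
def Data.score (D : Data) (alt : Bool) : ℕ × ℕ × ℕ :=
  ((D.total alt true).1 * (D.total alt false).2, (D.total alt false).1 * (D.total alt true).2,
    (D.total alt true).2 * (D.total alt false).2 *
      rangeFactorial (List.range D.1.length) D.1.length)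

@[fun_prop]
theorem PTime.score (alt : Bool) {D : α → Data} (hD : PTime D) :
    PTime fun a => (D a).score alt := by
  have h : PTime fun D : Data => D.score alt := by
    unfold Data.score
    fun_prop
  exact h.comp hD

/-! ### The data of an instance -/

/-- Numerator and denominator of a positive fraction. -/
def Fraction.raw (q : Fraction) : ℕ × ℕ := (q.num.natAbs, q.den)

/-- The entries of a matrix of positive fractions. -/
def rawMatrix (F : Bool → Bool → Fraction) : (ℕ × ℕ) × (ℕ × ℕ) × (ℕ × ℕ) × (ℕ × ℕ) :=
  ((F false false).raw, (F false true).raw, (F true false).raw, (F true true).raw)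

/-- Multiply the entries of a matrix by the product of all denominators. -/
def clearDenom (m : (ℕ × ℕ) × (ℕ × ℕ) × (ℕ × ℕ) × (ℕ × ℕ)) : ℕ × ℕ × ℕ × ℕ :=
  (m.1.1 * (m.2.1.2 * m.2.2.1.2 * m.2.2.2.2), m.2.1.1 * (m.1.2 * m.2.2.1.2 * m.2.2.2.2),
    m.2.2.1.1 * (m.1.2 * m.2.1.2 * m.2.2.2.2), m.2.2.2.1 * (m.1.2 * m.2.1.2 * m.2.2.1.2))

/-- The initial distribution, as a matrix with equal rows, followed by the transition matrices. -/
def MarkovChain.fractions {n : ℕ} (P : MarkovChain n) : Fin (n + 1) → Bool → Bool → Fraction :=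
  Fin.cons (fun _ b => P.init b) P.trans

theorem MarkovChain.mats_eq {n : ℕ} (P : MarkovChain n) (j : Fin (n + 1)) (a b : Bool) :
    P.mats j a b = (P.fractions j a b).val := by
  refine Fin.cases ?_ (fun k => ?_) j <;> rfl

theorem MarkovChain.fractions_pos {n : ℕ} (P : MarkovChain n) (j : Fin (n + 1)) (a b : Bool) :
    0 < (P.fractions j a b).val := by
  refine Fin.cases ?_ (fun k => ?_) j
  · exact P.init_pos b
  · exact P.trans_pos k a b

/-- The list of the factors of a product. -/
def cubeList {N : ℕ} (g : Fin N → Bool → Bool) : List (Bool × Bool) :=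
  List.ofFn fun j => (g j false, g j true)

/-- The data of an instance. -/
def Instance.data (a : Instance) : Data :=
  (List.ofFn a.x, a.i, List.ofFn fun j => clearDenom (rawMatrix (a.P.fractions j)),
    (a.tree.cubes fun _ _ => true).map cubeList)

/-- The layers of an instance for a product, with natural number entries. -/
def Instance.natLayers (a : Instance) (b : Bool) (g : Fin (a.n + 1) → Bool → Bool)
    (j : Fin (a.n + 1)) : NatLayer :=
  (clearDenom (rawMatrix (a.P.fractions j)), a.x j, (g j false, g j true),
    (!decide ((j : ℕ) = a.i), b))

theorem layers_data (a : Instance) (b : Bool) (g : Fin (a.n + 1) → Bool → Bool) :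
    a.data.layers b (cubeList g) = List.ofFn (a.natLayers b g) := by
  refine List.ext_getElem (by simp [Data.layers, Instance.data]) fun j h1 h2 => ?_
  have hj : j < a.n + 1 := by simpa using h2
  simp [Data.layers, Instance.data, Instance.natLayers, cubeList, Nat.le_of_lt_succ hj,
    -List.ofFn_succ]

theorem Fraction.raw_eq {q : Fraction} (h : 0 < q.val) :
    0 < q.raw.1 ∧ 0 < q.raw.2 ∧ q.val = q.raw.1 / q.raw.2 := by
  have h1 : (0 : ℚ) < q.den := by exact_mod_cast q.den_pos
  have h2 : 0 < q.num := by
    rw [Fraction.val, div_pos_iff_of_pos_right h1] at h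
    exact_mod_cast h
  refine ⟨by simp only [Fraction.raw]; omega, q.den_pos, ?_⟩
  rw [Fraction.val, Fraction.raw]
  congr 1
  have h3 : ((q.num.natAbs : ℤ) : ℚ) = q.num := by rw [Int.natAbs_of_nonneg h2.le]
  rw [← h3, Int.cast_natCast]

theorem natLayers_pos (a : Instance) (b : Bool) (g : Fin (a.n + 1) → Bool → Bool) :
    ∀ ℓ ∈ List.ofFn (a.natLayers b g), ℓ.Pos := by
  intro ℓ hℓ
  obtain ⟨j, rfl⟩ := List.mem_ofFn.1 hℓ
  have h := fun b c => Fraction.raw_eq (a.P.fractions_pos j b c)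
  obtain ⟨h1, h2, -⟩ := h false false
  obtain ⟨h3, h4, -⟩ := h false true
  obtain ⟨h5, h6, -⟩ := h true false
  obtain ⟨h7, h8, -⟩ := h true true
  refine ⟨?_, ?_, ?_, ?_⟩ <;> simp only [Instance.natLayers, clearDenom, rawMatrix] <;> positivity

theorem pathSum_natLayers (w : ℕ → ℚ) (a : Instance) (b : Bool) (g : Fin (a.n + 1) → Bool → Bool) :
    pathSum w ((List.ofFn (a.natLayers b g)).map NatLayer.toLayer) (unitVec false)
      (unitVec false) 0 = pathSum w (List.ofFn (a.P.layers a.x (cubeFactor g) a.i b))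
        (unitVec false) (unitVec false) 0 := by
  have h := fun j b c => Fraction.raw_eq (a.P.fractions_pos j b c)
  have h1 := pathSum_scale w (a.P.layers a.x (cubeFactor g) a.i b)
    (fun j => (a.natLayers b g j).toLayer)
    -- The scaling factor of a position is the product of its four denominators, which `clearDenom`
    -- multiplies into the matrix.
    (fun j => ((a.P.fractions j false false).raw.2 * (a.P.fractions j false true).raw.2 *
      (a.P.fractions j true false).raw.2 * (a.P.fractions j true true).raw.2 : ℕ))
    (fun j => ?_) ?_ (fun j => rfl) ?_ ?_ (unitVec false) (unitVec false) 1 one_ne_zero 0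
  · simp only [one_mul] at h1
    rw [List.map_ofFn, ← h1]
    rfl
  · have h1 := (h j false false).2.1
    have h2 := (h j false true).2.1
    have h3 := (h j true false).2.1
    have h4 := (h j true true).2.1
    positivity
  · intro j c d
    have h1 : ∀ c d, ((a.P.fractions j c d).raw.2 : ℚ) ≠ 0 := fun c d => by
      exact_mod_cast (h j c d).2.1.ne'
    have h2 := h1 false false
    have h3 := h1 false true
    have h4 := h1 true false
    have h5 := h1 true true
    have h6 : (a.P.layers a.x (cubeFactor g) a.i b j).mat c d =
        (a.P.fractions j c d).raw.1 / (a.P.fractions j c d).raw.2 :=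
      (a.P.mats_eq j c d).trans (h j c d).2.2
    rw [h6]
    cases c <;> cases d <;>
      simp only [NatLayer.toLayer, Instance.natLayers, clearDenom, rawMatrix, select, cond_true,
        cond_false] <;> push_cast <;> field_simp
  · intro j
    funext c
    cases c <;> simp [NatLayer.toLayer, Instance.natLayers, MarkovChain.layers, cubeFactor, select]
  · intro j
    by_cases hj : j = a.i
    · subst hj
      simp [NatLayer.toLayer, Instance.natLayers, MarkovChain.layers]
    · have hj' : (j : ℕ) ≠ a.i := fun h => hj (Fin.ext h)
      simp [NatLayer.toLayer, Instance.natLayers, MarkovChain.layers, hj, hj']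

theorem pathResult_data (a : Instance) (alt b : Bool) (g : Fin (a.n + 1) → Bool → Bool) :
    0 < (a.data.pathResult alt b (cubeList g)).2 ∧
      ((a.data.pathResult alt b (cubeList g)).1 : ℚ) / (a.data.pathResult alt b (cubeList g)).2 =
        pathSum (fun k => shapWeight (a.n + 1) alt k)
          (List.ofFn (a.P.layers a.x (cubeFactor g) a.i b)) (unitVec false) (unitVec false) 0 := by
  have hN : a.data.1.length = a.n + 1 := by simp [Instance.data]
  have h := dpResult_spec (w := weightTable alt (List.range (a.n + 1))) (K := a.n + 1)
    (by simp [weightTable]) (natLayers_pos a b g)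
  simp only [getD_weightTable, pathSum_natLayers] at h
  rw [Data.pathResult, hN, layers_data]
  exact h

theorem total_data (a : Instance) (alt b : Bool) : 0 < (a.data.total alt b).2 ∧
    ((a.data.total alt b).1 : ℚ) / (a.data.total alt b).2 =
      ((a.tree.cubes fun _ _ => true).map fun c => pathSum (fun k => shapWeight (a.n + 1) alt k)
        (List.ofFn (a.P.layers a.x (cubeFactor c) a.i b)) (unitVec false)
        (unitVec false) 0).sum := by
  obtain ⟨h1, h2⟩ := foldl_addFrac a.data.2.2.2 (a.data.pathResult alt b) (fun c hc => by
    obtain ⟨g, -, rfl⟩ := List.mem_map.1 hc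
    exact (pathResult_data a alt b g).1) (0, 1) one_pos
  refine ⟨h1, h2.trans ?_⟩
  rw [show a.data.2.2.2 = (a.tree.cubes fun _ _ => true).map cubeList from rfl, List.map_map]
  simp [Function.comp_def, pathResult_data]

/-- The weighted sum with weights that are multiplied by a number. -/
theorem weightedSum_mul {N : ℕ} (e : ℚ) (w : ℕ → ℚ) (i : Fin N) (v : Finset (Fin N) → ℚ) :
    weightedSum (fun k => e * w k) i v = e * weightedSum w i v := by
  simp only [weightedSum, Finset.mul_sum, mul_assoc]

theorem score_data (a : Instance) (alt : Bool) : 0 < (a.data.score alt).2.2 ∧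
    (((a.data.score alt).1 : ℚ) - (a.data.score alt).2.1) / (a.data.score alt).2.2 =
      weightedSum (fun k => ((a.n + 1).factorial : ℚ)⁻¹ * shapWeight (a.n + 1) alt k) a.i
        (value a.tree.toFun a.x a.P.prob) := by
  have hN : a.data.1.length = a.n + 1 := by simp [Instance.data]
  obtain ⟨h1, h2⟩ := total_data a alt true
  obtain ⟨h3, h4⟩ := total_data a alt false
  rw [weightedSum_mul, weightedSum_tree, ← h2, ← h4]
  simp only [Data.score, hN, rangeFactorial_range le_rfl]
  have h5 := Nat.factorial_pos (a.n + 1)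
  refine ⟨by positivity, ?_⟩
  push_cast
  have h1' : ((a.data.total alt true).2 : ℚ) ≠ 0 := by exact_mod_cast h1.ne'
  have h3' : ((a.data.total alt false).2 : ℚ) ≠ 0 := by exact_mod_cast h3.ne'
  have h5' : ((a.n + 1).factorial : ℚ) ≠ 0 := by exact_mod_cast h5.ne'
  field_simp

/-- The score as a fraction. -/
def Instance.scoreFraction (alt : Bool) (a : Instance) : Fraction where
  num := (a.data.score alt).1 - (a.data.score alt).2.1
  den := (a.data.score alt).2.2
  den_pos := (score_data a alt).1

theorem scoreFraction_false_val (a : Instance) : (a.scoreFraction false).val = a.shap := by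
  rw [Instance.shap, shap_eq_weightedSum, ← (score_data a false).2]
  simp [Fraction.val, Instance.scoreFraction]

theorem scoreFraction_true_val (a : Instance) : (a.scoreFraction true).val = a.shapAlt := by
  rw [Instance.shapAlt, shapAlt_eq_weightedSum, ← (score_data a true).2]
  simp [Fraction.val, Instance.scoreFraction]

end MarkovShap

/-! ### Parsing the input word and writing the result. -/

namespace MarkovShap

open Computability Code

variable {α β γ δ σ : Type} [Code α] [Code β] [Code γ] [Code δ] [Code σ]

/-! ### Reading an instance -/

theorem PTime.of_symTriple : PTime fun x : Γ' => symTriple x := .of_code_eq fun _ => rfl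

@[fun_prop]
theorem PTime.symTriple {f : α → Γ'} (hf : PTime f) : PTime fun a => MarkovShap.symTriple (f a) :=
  of_symTriple.comp hf

/-- The bits up to the first other symbol. -/
def readBits (s : List Γ') : List Bool :=
  (s.takeWhile fun x => (symTriple x).1).map fun x => (symTriple x).2.2

/-- The word behind the first symbol that is not a bit. -/
def skipBits (s : List Γ') : List Γ' := (s.dropWhile fun x => (symTriple x).1).tail

@[fun_prop]
theorem PTime.readBits {s : α → List Γ'} (hs : PTime s) :
    PTime fun a => MarkovShap.readBits (s a) := by
  unfold MarkovShap.readBits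
  fun_prop

@[fun_prop]
theorem PTime.skipBits {s : α → List Γ'} (hs : PTime s) :
    PTime fun a => MarkovShap.skipBits (s a) := by
  unfold MarkovShap.skipBits
  fun_prop

theorem readBits_append (l : List Bool) (s : List Γ') :
    readBits (l.map Γ'.bit ++ [Γ'.comma] ++ s) = l := by
  induction l with
  | nil => rfl
  | cons b l ih =>
    simp only [readBits] at ih
    simpa [readBits, symTriple] using ih

theorem skipBits_append (l : List Bool) (s : List Γ') :
    skipBits (l.map Γ'.bit ++ [Γ'.comma] ++ s) = s := by
  induction l with
  | nil => rfl
  | cons b l ih =>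
    simp only [skipBits] at ih
    simpa [skipBits, symTriple] using ih

theorem encodeNat_eq_bits (n : ℕ) : encodeNat n = n.bits := by
  have hp : ∀ p : PosNum, encodePosNum p = (p : ℕ).bits := by
    intro p
    induction p with
    | one => simp [encodePosNum]
    | bit0 p ih =>
      rw [encodePosNum, ih, PosNum.cast_bit0, ← two_mul, Nat.bit0_bits _ (by
        have := PosNum.cast_pos (α := ℕ) p
        omega)]
    | bit1 p ih => rw [encodePosNum, ih, PosNum.cast_bit1, ← two_mul, Nat.bit1_bits]
  have h : ∀ m : Num, encodeNum m = (m : ℕ).bits := by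
    rintro (_ | p)
    · rfl
    · exact hp p
  rw [encodeNat, h]
  simp

theorem readBits_encodeBin (m : ℕ) (s : List Γ') :
    (readBits (encodeBin m ++ s)).foldr Nat.bit 0 = m := by
  rw [encodeBin, readBits_append, encodeNat_eq_bits, foldr_bit_bits]

/-- Read numerator and denominator of a fraction. -/
def readFraction (s : List Γ') : ℕ × ℕ :=
  ((readBits s.tail).foldr Nat.bit 0, (readBits (skipBits s.tail)).foldr Nat.bit 0)

/-- The word behind a fraction. -/
def skipFraction (s : List Γ') : List Γ' := skipBits (skipBits s.tail)

@[fun_prop]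
theorem PTime.readFraction {s : α → List Γ'} (hs : PTime s) :
    PTime fun a => MarkovShap.readFraction (s a) := by
  unfold MarkovShap.readFraction
  fun_prop

@[fun_prop]
theorem PTime.skipFraction {s : α → List Γ'} (hs : PTime s) :
    PTime fun a => MarkovShap.skipFraction (s a) := by
  unfold MarkovShap.skipFraction
  fun_prop

theorem readFraction_append (q : Fraction) (s : List Γ') :
    readFraction (q.encode ++ s) = q.raw := by
  simp only [readFraction, Fraction.encode, List.cons_append, List.tail_cons, List.append_assoc,
    readBits_encodeBin, Fraction.raw]
  rw [encodeBin, skipBits_append, readBits_encodeBin]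

theorem skipFraction_append (q : Fraction) (s : List Γ') : skipFraction (q.encode ++ s) = s := by
  simp only [skipFraction, Fraction.encode, List.cons_append, List.tail_cons, List.append_assoc]
  rw [encodeBin, skipBits_append, encodeBin, skipBits_append]

/-- Read a matrix. -/
def readMatrix (s : List Γ') : (ℕ × ℕ) × (ℕ × ℕ) × (ℕ × ℕ) × (ℕ × ℕ) :=
  (readFraction s, readFraction (skipFraction s), readFraction (skipFraction (skipFraction s)),
    readFraction (skipFraction (skipFraction (skipFraction s))))

/-- The word behind a matrix. -/
def skipMatrix (s : List Γ') : List Γ' :=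
  skipFraction (skipFraction (skipFraction (skipFraction s)))

@[fun_prop]
theorem PTime.readMatrix {s : α → List Γ'} (hs : PTime s) :
    PTime fun a => MarkovShap.readMatrix (s a) := by
  unfold MarkovShap.readMatrix
  fun_prop

@[fun_prop]
theorem PTime.skipMatrix {s : α → List Γ'} (hs : PTime s) :
    PTime fun a => MarkovShap.skipMatrix (s a) := by
  unfold MarkovShap.skipMatrix
  fun_prop

theorem readMatrix_append (M : Bool → Bool → Fraction) (s : List Γ') :
    readMatrix (encodeMatrix M ++ s) = rawMatrix M := by
  simp only [readMatrix, encodeMatrix, List.append_assoc, readFraction_append, skipFraction_append,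
    rawMatrix]

theorem skipMatrix_append (M : Bool → Bool → Fraction) (s : List Γ') :
    skipMatrix (encodeMatrix M ++ s) = s := by
  simp only [skipMatrix, encodeMatrix, List.append_assoc, skipFraction_append]

theorem skipBits_sublist (s : List Γ') : (skipBits s).Sublist s :=
  (List.tail_sublist _).trans (List.dropWhile_sublist _)

theorem skipMatrix_sublist (s : List Γ') : (skipMatrix s).Sublist s := by
  have h : ∀ s, (skipFraction s).Sublist s := fun s =>
    ((skipBits_sublist _).trans (skipBits_sublist _)).trans (List.tail_sublist _)
  exact (h _).trans ((h _).trans ((h _).trans (h _)))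

/-- The positions of as many consecutive matrices as the list is long, and the word behind them. -/
def matrixPositions (l : List Bool) (s : List Γ') : List (List Γ') × List Γ' :=
  l.foldl (fun st _ => (st.1 ++ [st.2], skipMatrix st.2)) ([], s)

-- Whole suffixes of the input are collected and decoded later. Every suffix is no larger than `s
-- a`, which bounds the state although the increment depends on it.
@[fun_prop]
theorem PTime.matrixPositions {l : α → List Bool} {s : α → List Γ'} (hl : PTime l)
    (hs : PTime s) : PTime fun a => MarkovShap.matrixPositions (l a) (s a) := by
  have h1 := hl.sz
  have h2 := hs.sz
  refine PTime.foldl_of_le hl (i := fun a => ([], s a))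
    (f := fun _ st _ => (st.1 ++ [st.2], MarkovShap.skipMatrix st.2)) (by fun_prop) (by fun_prop)
    (B := fun a => MarkovShap.sz (l a) * (MarkovShap.sz (s a) + 1) + MarkovShap.sz (s a) + 2)
    (by fun_prop) fun a l' hl' => ?_
  have key : ∀ (m : List Bool) (st : List (List Γ') × List Γ'),
      MarkovShap.sz st.2 ≤ MarkovShap.sz (s a) →
      MarkovShap.sz (m.foldl (fun st _ => (st.1 ++ [st.2], MarkovShap.skipMatrix st.2)) st) ≤
        MarkovShap.sz st.1 + m.length * (MarkovShap.sz (s a) + 1) + MarkovShap.sz (s a) + 1 := by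
    intro m
    induction m with
    | nil =>
      intro st hst
      simp only [List.foldl_nil, sz_prod, List.length_nil]
      omega
    | cons b m ih =>
      intro st hst
      refine (ih _ ((sz_sublist_le (skipMatrix_sublist st.2)).trans hst)).trans ?_
      have h3 := sz_append st.1 [st.2]
      simp only [sz_cons, sz_nil] at h3
      simp only [List.length_cons]
      ring_nf
      omega
  refine (key l' _ le_rfl).trans ?_
  have h4 := hl'.length_le.trans (length_lt_sz (l a)).le
  have h5 : l'.length * (MarkovShap.sz (s a) + 1) ≤
    MarkovShap.sz (l a) * (MarkovShap.sz (s a) + 1) := by gcongr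
  simp only [sz_nil]
  omega

theorem matrixPositions_append {n : ℕ} (M : Fin n → Bool → Bool → Fraction) {l : List Bool}
    (hl : l.length = n) (s : List Γ') :
    (matrixPositions l ((List.ofFn fun k => encodeMatrix (M k)).flatten ++ s)).1.map readMatrix =
      (List.ofFn fun k => rawMatrix (M k)) ∧
    (matrixPositions l ((List.ofFn fun k => encodeMatrix (M k)).flatten ++ s)).2 = s := by
  have key : ∀ (n : ℕ) (M : Fin n → Bool → Bool → Fraction) (l : List Bool) (acc : List (List Γ')),
      l.length = n →
      ((l.foldl (fun (st : List (List Γ') × List Γ') _ => (st.1 ++ [st.2], skipMatrix st.2))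
        (acc, (List.ofFn fun k => encodeMatrix (M k)).flatten ++ s)).1.map readMatrix =
        acc.map readMatrix ++ List.ofFn fun k => rawMatrix (M k)) ∧
      (l.foldl (fun (st : List (List Γ') × List Γ') _ => (st.1 ++ [st.2], skipMatrix st.2))
        (acc, (List.ofFn fun k => encodeMatrix (M k)).flatten ++ s)).2 = s := by
    intro n
    induction n with
    | zero =>
      intro M l acc hl
      rw [List.eq_nil_of_length_eq_zero hl]
      simp
    | succ n ih =>
      intro M l acc hl
      obtain ⟨b, l, rfl⟩ := List.exists_cons_of_length_eq_add_one hl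
      simp only [List.length_cons, Nat.add_right_cancel_iff] at hl
      have h := ih (fun k => M k.succ) l
        (acc ++ [encodeMatrix (M 0) ++ ((List.ofFn fun k : Fin n => encodeMatrix (M k.succ)).flatten
          ++ s)]) hl
      simp only [List.ofFn_succ, List.flatten_cons, List.append_assoc, List.foldl_cons,
        skipMatrix_append]
      simpa only [List.map_append, List.map_cons, List.map_nil, readMatrix_append,
        List.append_assoc, List.singleton_append] using h
  simpa [matrixPositions] using key n M l [] hl

/-! ### Reading a decision tree -/

/-- Restrict a product by an answer to a query. -/
def refine (r : List ℕ) (c : List (Bool × Bool)) (v : ℕ) (b : Bool) : List (Bool × Bool) :=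
  r.map fun j => bif decide (j = v) then
    ((c.getD j (true, true)).1 && !b, (c.getD j (true, true)).2 && b) else c.getD j (true, true)

/-- The state of the reading of a decision tree: whether an index is being read, the part of it
that has been read, the products for the pending subtrees, and the products found. -/
abbrev TreeState : Type := Bool × List Bool × List (List (Bool × Bool)) × List (List (Bool × Bool))

/-- Read a symbol of a decision tree. -/
def treeStep (r : List ℕ) (s : TreeState) (x : Γ') : TreeState :=
  bif (symTriple x).1 then
    bif s.1 then (true, true :: s.2.1, s.2.2)
    else (false, [], s.2.2.1.tail,
      bif (symTriple x).2.2 then s.2.2.2 ++ [s.2.2.1.headD []] else s.2.2.2)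
  else bif (symTriple x).2.1 then (true, [], s.2.2)
  else (false, [], refine r (s.2.2.1.headD []) s.2.1.length false ::
    refine r (s.2.2.1.headD []) s.2.1.length true :: s.2.2.1.tail, s.2.2.2)

/-- Read a decision tree. -/
def readTree (r : List ℕ) (s : List Γ') : List (List (Bool × Bool)) :=
  (s.foldl (treeStep r) (false, [], [r.map fun _ => (true, true)], [])).2.2.2

theorem sz_refine_le (r : List ℕ) (c : List (Bool × Bool)) (v : ℕ) (b : Bool) :
    sz (refine r c v b) ≤ r.length * 8 + 1 := by
  refine (sz_le_of_forall_le (m := 7) fun e _ => ?_).trans (by simp [refine])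
  have h1 := sz_bool_le e.1
  have h2 := sz_bool_le e.2
  rw [sz_prod]
  omega

/-- A leaf moves a pending product to the output, or discards it, and never copies it. The comma
after an index creates two products, each with `r.length` entries of bounded size. -/
theorem sz_treeStep_le (r : List ℕ) (s : TreeState) (x : Γ') :
    sz (treeStep r s x) ≤ sz s + (2 * (r.length * 8 + 1) + 10) := by
  rcases s with ⟨f, n, c, o⟩
  have h1 := sz_refine_le r (c.headD []) n.length false
  have h2 := sz_refine_le r (c.headD []) n.length true
  have h3 := sz_sublist_le (List.tail_sublist c)
  have h4 := sz_append o [c.headD []]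
  have h5 : sz c.tail + sz (c.headD []) ≤ sz c + 1 := by
    cases c <;> simp
    omega
  have h6 := sz_bool_le f
  have h7 := sz_bool_le false
  have h8 := sz_bool_le true
  have h9 := sz_pos f
  have h10 := sz_pos n
  simp only [treeStep]
  cases (symTriple x).1 <;> cases f <;> cases (symTriple x).2.1 <;> cases (symTriple x).2.2 <;>
    simp only [cond_true, cond_false, sz_prod, sz_cons, sz_nil] at * <;> omega

@[fun_prop]
theorem PTime.refine {r : α → List ℕ} {c : α → List (Bool × Bool)} {v : α → ℕ} {b : α → Bool}
    (hr : PTime r) (hc : PTime c) (hv : PTime v) (hb : PTime b) :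
    PTime fun a => MarkovShap.refine (r a) (c a) (v a) (b a) := by
  unfold MarkovShap.refine
  fun_prop

@[fun_prop]
theorem PTime.readTree {r : α → List ℕ} {s : α → List Γ'} (hr : PTime r) (hs : PTime s) :
    PTime fun a => MarkovShap.readTree (r a) (s a) := by
  refine ((PTime.foldl_sz hs (i := fun a => (false, [], [(r a).map fun _ => (true, true)], []))
    (f := fun a => treeStep (r a)) (by fun_prop) ?_
    (G := fun p => 2 * ((r p.1).length * 8 + 1) + 10) ?_
    fun a s b => sz_treeStep_le (r a) s b).snd.snd.snd :)
  · unfold treeStep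
    fun_prop
  · have h := hr.sz
    exact (PolyBd.comp (g := fun a => 2 * (MarkovShap.sz (r a) * 8 + 1) + 10) (by fun_prop)
      PTime.of_fst).mono fun p => by
        have := (length_lt_sz (r p.1)).le
        gcongr

theorem refine_cubeList {N : ℕ} (g : Fin N → Bool → Bool) (v : Fin N) (b : Bool) :
    refine (List.range N) (cubeList g) v b = cubeList (restrict g v b) := by
  refine List.ext_getElem (by simp [refine, cubeList]) fun j h1 h2 => ?_
  have hj : j < N := by simpa [cubeList] using h2
  by_cases hv : j = v
  · subst hv
    cases b <;> simp [refine, cubeList, restrict]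
  · have hv' : (⟨j, hj⟩ : Fin N) ≠ v := fun h => hv (congrArg Fin.val h)
    simp [refine, cubeList, restrict, hv, hv', hj]

theorem unaryEncodeNat_eq (n : ℕ) : unaryEncodeNat n = List.replicate n true := by
  induction n with
  | zero => rfl
  | succ n ih => rw [unaryEncodeNat, ih, List.replicate_succ]

theorem foldl_treeStep_unary (r : List ℕ) (n : ℕ) (l : List Bool)
    (st : List (List (Bool × Bool)) × List (List (Bool × Bool))) :
    ((List.replicate n true).map Γ'.bit).foldl (treeStep r) (true, l, st) =
      (true, List.replicate n true ++ l, st) := by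
  induction n generalizing l with
  | zero => rfl
  | succ n ih =>
    rw [List.replicate_succ, List.map_cons, List.foldl_cons]
    refine (ih (true :: l)).trans ?_
    rw [← List.replicate_succ, List.replicate_succ', List.append_assoc]
    rfl

/-- Prefix notation is read with a stack of pending products. Reading a whole subtree takes its
product from the top and appends the products of its accepting leaves to the output, in the order of
`DecisionTree.cubes`. -/
theorem foldl_treeStep {N : ℕ} (T : DecisionTree N) (g : Fin N → Bool → Bool)
    (c o : List (List (Bool × Bool))) :
    T.encode.foldl (treeStep (List.range N)) (false, [], cubeList g :: c, o) =
      (false, [], c, o ++ (T.cubes g).map cubeList) := by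
  induction T generalizing g c o with
  | leaf b => cases b <;> simp [DecisionTree.encode, DecisionTree.cubes, treeStep, symTriple]
  | node v lo hi ihl ihh =>
    rw [DecisionTree.encode, List.foldl_cons, List.foldl_append, List.foldl_append, encodeUnary,
      List.foldl_append, unaryEncodeNat_eq]
    rw [show treeStep (List.range N) (false, [], cubeList g :: c, o) Γ'.bra =
      (true, [], cubeList g :: c, o) from rfl, foldl_treeStep_unary, List.append_nil]
    have h : [Γ'.comma].foldl (treeStep (List.range N))
        (true, List.replicate v true, cubeList g :: c, o) = (false, [],
          cubeList (restrict g v false) :: cubeList (restrict g v true) :: c, o) := by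
      simp [treeStep, symTriple, refine_cubeList]
    rw [h, ihl, ihh, DecisionTree.cubes, List.map_append, List.append_assoc]

theorem readTree_encode {N : ℕ} (T : DecisionTree N) :
    readTree (List.range N) T.encode = (T.cubes fun _ _ => true).map cubeList := by
  have h : (List.range N).map (fun _ => (true, true)) = cubeList fun (_ : Fin N) _ => true := by
    refine List.ext_getElem (by simp [cubeList]) fun j h1 h2 => by simp [cubeList]
  rw [readTree, h, foldl_treeStep]
  simp

/-! ### The function on words -/

/-- Read an instance. -/
def readInstance (s : List Γ') : Data :=
  (readBits s, (readBits (skipBits s)).length,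
    -- The initial distribution is used for both rows of the first matrix. The tail of the vector is
    -- the clock for the transition matrices, of which there is one fewer than variables.
    (((readFraction (skipBits (skipBits s)), readFraction (skipFraction (skipBits (skipBits s))),
      readFraction (skipBits (skipBits s)), readFraction (skipFraction (skipBits (skipBits s)))) ::
      (matrixPositions (readBits s).tail
        (skipFraction (skipFraction (skipBits (skipBits s))))).1.map readMatrix).map clearDenom),
    readTree (List.range (readBits s).length) (matrixPositions (readBits s).tail
      (skipFraction (skipFraction (skipBits (skipBits s))))).2)

theorem readInstance_encode (a : Instance) : readInstance a.encode = a.data := by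
  have h1 : readBits a.encode = List.ofFn a.x := by
    rw [Instance.encode, encodeVector, readBits_append]
  have h2 : skipBits a.encode = encodeUnary a.i ++ (a.P.encode ++ a.tree.encode) := by
    rw [Instance.encode, encodeVector, skipBits_append]
  have h3 : readBits (skipBits a.encode) = List.replicate a.i true := by
    rw [h2, encodeUnary, readBits_append, unaryEncodeNat_eq]
  have h4 : skipBits (skipBits a.encode) = (a.P.init false).encode ++ ((a.P.init true).encode ++
      ((List.ofFn fun k => encodeMatrix (a.P.trans k)).flatten ++ a.tree.encode)) := by
    rw [h2, encodeUnary, skipBits_append, MarkovChain.encode]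
    simp only [List.append_assoc]
  have h5 := matrixPositions_append a.P.trans (l := (List.ofFn a.x).tail) (by simp) a.tree.encode
  simp only [readInstance, h3, h4, h1, readFraction_append, skipFraction_append, h5.1, h5.2,
    List.length_ofFn, readTree_encode, List.length_replicate, Instance.data]
  congr 3
  rw [List.ofFn_succ, List.map_cons, List.map_ofFn]
  rfl

@[fun_prop]
theorem PTime.bitSymbol {f : α → Bool} (hf : PTime f) : PTime fun a => Γ'.bit (f a) :=
  ((PTime.const true).pair ((PTime.const false).pair hf)).of_code fun _ => rfl

/-- The word for a fraction with numerator `r.1 - r.2.1` and denominator `r.2.2`. -/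
def writeFraction (r : ℕ × ℕ × ℕ) : List Γ' :=
  Γ'.bit (decide (r.1 < r.2.1)) ::
    (((((r.1 - r.2.1) + (r.2.1 - r.1)).bits.map fun b => Γ'.bit b) ++ [Γ'.comma]) ++
      ((r.2.2.bits.map fun b => Γ'.bit b) ++ [Γ'.comma]))

theorem writeFraction_score (alt : Bool) (a : Instance) :
    writeFraction (a.data.score alt) = (a.scoreFraction alt).encode := by
  rw [writeFraction, Fraction.encode, encodeBin, encodeBin, encodeNat_eq_bits, encodeNat_eq_bits]
  -- With truncated subtraction at least one of the summands is zero.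
  have h : ∀ x y : ℕ, ((x : ℤ) - y).natAbs = (x - y) + (y - x) := fun x y => by omega
  simp only [Instance.scoreFraction, h]
  exact congrArg₂ List.cons (congrArg Γ'.bit (decide_eq_decide.2 (by omega))) rfl

theorem PTime.solve (alt : Bool) :
    PTime fun s : List Γ' => (writeFraction ((readInstance s).score alt)).reverse := by
  have h1 : PTime fun s : List Γ' => readInstance s := by
    unfold readInstance clearDenom
    fun_prop
  have h2 : PTime fun r : ℕ × ℕ × ℕ => writeFraction r := by
    unfold writeFraction
    fun_prop
  exact (h2.comp (PTime.score alt h1)).reverse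

theorem mem_encodeFraction (q : Fraction) : ∀ x ∈ q.encode, x = .comma ∨ ∃ v, x = .bit v := by
  intro x hx
  simp only [Fraction.encode, encodeBin, List.mem_cons, List.mem_append, List.mem_map,
    List.not_mem_nil, or_false] at hx
  rcases hx with h | (⟨b, -, h⟩ | h) | (⟨b, -, h⟩ | h)
  exacts [.inr ⟨_, h⟩, .inr ⟨b, h.symm⟩, .inl h, .inr ⟨b, h.symm⟩, .inl h]

theorem scoreFraction_computable (alt : Bool) : Nonempty (Turing.TM2ComputableInPolyTime
    Instance.encode Fraction.encode (Instance.scoreFraction alt)) :=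
  (PTime.solve alt).computable
    (fun a => by rw [readInstance_encode, writeFraction_score]) mem_encodeFraction

end MarkovShap

/-- Computing the SHAP score of a decision tree under a Markovian distribution over boolean vectors
is in FP, and so is computing the variant `shapAlt` of the score. -/
theorem mainTheorem3 :
    MarkovShap.InFP MarkovShap.Instance.encode MarkovShap.Instance.shap ∧
      MarkovShap.InFP MarkovShap.Instance.encode MarkovShap.Instance.shapAlt :=
  ⟨⟨MarkovShap.Instance.scoreFraction false, MarkovShap.scoreFraction_false_val,
      MarkovShap.scoreFraction_computable false⟩,
    ⟨MarkovShap.Instance.scoreFraction true, MarkovShap.scoreFraction_true_val,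
      MarkovShap.scoreFraction_computable true⟩⟩
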